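/- Let $\mathbf S=[-Q,Q]^2$ ($Q>0$) with opposite edges identified (flat torus, area $|\mathbf S|=4Q^2$, $\|\cdot\|$ the Euclidean distance to $0$ on the torus). Let $\lambda,L,C,\mathcal N_0>0$ and let $l:[0,\infty)\to[0,\infty)$ be non-increasing with $l(0)=1$. Consider the spatial birth-death network with link length $T=0$: points $x_p$ arrive at times $b_p$ according to a Poisson point process of intensity $\lambda\,dx\,dt$ on $\mathbf S\times(0,\infty)$ and carry i.i.d. exponential file sizes $L_p$ of mean $L$, independent of the arrivals; at time $0$ a random finite simple configuration $\phi_0$, independent of the arrivals and of all file sizes, is present, whose points have $b_p=0$ and i.i.d. exponential residual file sizes of mean $L$. Point $p$ leaves at $$d_p=\inf\Big\{t>b_p:\int_{b_p}^{t}R(x_p,\phi_u)\,du\ge L_p\Big\},\qquad R(x,\phi)=C\log_2\Big(1+\frac{l(0)}{\mathcal N_0+\sum_{y\in\phi\setminus\{x\}}l(\|y-x\|)}\Big),$$ where $\phi_u$ is the point process of the points with $b_p\le u<d_p$. For a stationary point process $\phi$ on $\mathbf S$ with intensity $\beta=\mathbb E[\phi(\mathbf S)]/|\mathbf S|\in(0,\infty)$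 and Palm expectation $\mathbb E^0_\phi[F(\phi)]=\frac{1}{\beta|\mathbf S|}\mathbb E\big[\sum_{x\in\phi}F(\phi-x)\big]$, the Ripley K-function is $K_\phi(r)=\frac1\beta\,\mathbb E^0_\phi[\phi(B(0,r))-1]$, with $B(0,r)=\{z\in\mathbf S:\|z\|\le r\}$. Corollary. Suppose that $(\phi_t)_{t\ge0}$ is in steady state, i.e. the law of $\phi_t$ does not depend on $t\ge 0$. Let $\beta<\infty$ be the intensity of $\phi_0$ and let $\psi$ be a Poisson point process on $\mathbf S$ with intensity $\beta$. Then $$K_{\phi_0}(r)\ \ge\ K_\psi(r)\qquad\text{for all } r\ge 0 .$$ -/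

import Mathlib

open MeasureTheory ProbabilityTheory Set
open scoped ENNReal NNReal

noncomputable section

/-! ### The spatial domain -/

/-- The square `[-Q, Q] × [-Q, Q]` with opposite edges identified.  Its `volume` is the product
of the length measures of the two circles of circumference `2Q`, of total mass `(2Q)²`. -/
abbrev Torus (Q : ℝ) : Type := AddCircle (2 * Q) × AddCircle (2 * Q)

/-- The flat (Euclidean) distance of a point of the torus to the origin.  (The norm of
`AddCircle (2 * Q)` is the length of the shortest representative; the norm that Mathlib puts on
the product is the maximum and is not used.) -/
def torusNorm {Q : ℝ} (x : Torus Q) : ℝ := √(‖x.1‖ ^ 2 + ‖x.2‖ ^ 2)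

/-! ### Point processes, Palm expectations, the Ripley K-function

A point process on `E` is a random counting measure `Φ : Ω → Measure E`; `Measure E` carries the
σ-algebra generated by the evaluations `μ ↦ μ B`. -/

section PointProcess

variable {Ω : Type*} [MeasurableSpace Ω]

/-- `Ψ` is a Poisson point process with intensity measure `ν`: the number of points in a set of
finite `ν`-mass is Poisson with that mean, and the numbers of points in disjoint sets are
independent. -/
structure IsPoissonPointProcess {E : Type*} [MeasurableSpace E] (ν : Measure E)
    (Ψ : Ω → Measure E) (P : Measure Ω) : Prop where
  measurable : Measurable Ψ
  law : ∀ B : Set E, MeasurableSet B → ν B ≠ ∞ →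
    HasLaw (fun ω => Ψ ω B)
      ((poissonMeasure (ν B).toNNReal).map (fun n : ℕ => (n : ℝ≥0∞))) P
  indep : ∀ (n : ℕ) (B : Fin n → Set E), (∀ i, MeasurableSet (B i)) →
    Pairwise (fun i j => Disjoint (B i) (B j)) → iIndepFun (fun i ω => Ψ ω (B i)) P

variable {Q : ℝ} [Fact (0 < 2 * Q)]

/-- The intensity of a (spatially stationary) point process on the torus: the mean number of
points per unit area. -/
def intensity (P : Measure Ω) (Φ : Ω → Measure (Torus Q)) : ℝ≥0∞ :=
  (∫⁻ ω, Φ ω univ ∂P) / volume (univ : Set (Torus Q))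

/-- The Palm expectation `𝔼⁰_Φ[F] = (β |S|)⁻¹ 𝔼[∑_{x ∈ Φ} F(Φ - x)]` of a (spatially stationary)
point process on the torus `S` with intensity `β`, where `Φ - x` is `Φ` seen from its point `x`. -/
def palmExpectation (P : Measure Ω) (Φ : Ω → Measure (Torus Q))
    (F : Measure (Torus Q) → ℝ≥0∞) : ℝ≥0∞ :=
  (intensity P Φ * volume (univ : Set (Torus Q)))⁻¹ *
    ∫⁻ ω, ∫⁻ x, F ((Φ ω).map (fun y => y - x)) ∂(Φ ω) ∂P

/-- The Ripley K-function `K_Φ(r) = β⁻¹ 𝔼⁰_Φ[Φ(B(0, r)) - 1]`. -/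
def ripleyK (P : Measure Ω) (Φ : Ω → Measure (Torus Q)) (r : ℝ) : ℝ≥0∞ :=
  (intensity P Φ)⁻¹ * palmExpectation P Φ (fun μ => μ {z | torusNorm z ≤ r} - 1)

end PointProcess

/-! ### The dynamics with zero link length -/

section Dynamics

variable {Q : ℝ}

/-- The interference `I(x, φ) = ∑_{y ∈ φ ∖ {x}} l(‖y - x‖)`. -/
def interference (l : ℝ → ℝ) (x : Torus Q) (φ : Measure (Torus Q)) : ℝ :=
  ∫ y in {x}ᶜ, l (torusNorm (y - x)) ∂φ

/-- The Shannon rate `R(x, φ) = C log₂ (1 + l(0) / (N₀ + I(x, φ)))`. -/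
def rate (C N0 : ℝ) (l : ℝ → ℝ) (x : Torus Q) (φ : Measure (Torus Q)) : ℝ :=
  C * Real.logb 2 (1 + l 0 / (N0 + interference l x φ))

/-- The random data of the network on the time interval `[0, ∞)`.  The link `Sum.inl i` with
`i < initNum` is present at time `0`; the link `Sum.inr n` arrives at time `arrival n`. -/
structure LinkProcess (Q : ℝ) (Ω : Type*) where
  /-- number of links present at time `0` -/
  initNum : Ω → ℕ
  /-- location of each link -/
  pos : ℕ ⊕ ℕ → Ω → Torus Q
  /-- arrival times of the links that arrive after time `0` -/
  arrival : ℕ → Ω → ℝ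
  /-- number of bits that the link still has to transmit at time `0` (links present at time `0`),
  or file size (links arriving later) -/
  size : ℕ ⊕ ℕ → Ω → ℝ
  /-- departure times, `⊤` for a link that never leaves -/
  death : ℕ ⊕ ℕ → Ω → EReal

namespace LinkProcess

variable {Ω : Type*} (X : LinkProcess Q Ω)

/-- The time from which on a link transmits. -/
def birth : ℕ ⊕ ℕ → Ω → ℝ
  | Sum.inl _, _ => 0
  | Sum.inr n, ω => X.arrival n ω

/-- The link belongs to the network (labels `Sum.inl i` with `i ≥ initNum` are unused). -/
def Present : ℕ ⊕ ℕ → Ω → Prop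
  | Sum.inl i, ω => i < X.initNum ω
  | Sum.inr _, _ => True

/-- The link `p` is alive at time `t`. -/
def Alive (p : ℕ ⊕ ℕ) (t : ℝ) (ω : Ω) : Prop :=
  X.Present p ω ∧ X.birth p ω ≤ t ∧ (t : EReal) < X.death p ω

open Classical in
/-- The point process `φ_t` of the links alive at time `t`. -/
def config (t : ℝ) (ω : Ω) : Measure (Torus Q) :=
  Measure.sum fun p => if X.Alive p t ω then Measure.dirac (X.pos p ω) else 0

/-- `X` follows the spatial birth-death dynamics with arrival intensity `lam`, mean file size `L`,
bandwidth constant `C`, noise power `N0` and path-loss function `l`, started at time `0` from a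
random simple finite configuration.  Since exponential file sizes are memoryless, the residual
file sizes of the links present at time `0` have the same exponential law. -/
structure IsBirthDeath [Fact (0 < 2 * Q)] [MeasurableSpace Ω] (X : LinkProcess Q Ω)
    (lam L C N0 : ℝ) (l : ℝ → ℝ) (P : Measure Ω) : Prop where
  measurable_initNum : Measurable X.initNum
  measurable_pos : ∀ p, Measurable (X.pos p)
  measurable_arrival : ∀ n, Measurable (X.arrival n)
  measurable_size : ∀ p, Measurable (X.size p)
  measurable_death : ∀ p, Measurable (X.death p)
  /-- the initial configuration is simple -/
  init_simple : ∀ᵐ ω ∂P, ∀ i < X.initNum ω, ∀ j < X.initNum ω,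
    X.pos (Sum.inl i) ω = X.pos (Sum.inl j) ω → i = j
  /-- arrivals form a Poisson point process of intensity `lam dx dt` on `S × (0, ∞)` -/
  arrivals_poisson : IsPoissonPointProcess
    (ENNReal.ofReal lam • (volume : Measure (Torus Q)).prod (volume.restrict (Ioi (0 : ℝ))))
    (fun ω => Measure.sum fun n => Measure.dirac (X.pos (Sum.inr n) ω, X.arrival n ω)) P
  /-- file sizes are i.i.d. exponential with mean `L` -/
  size_law : ∀ p, HasLaw (X.size p) (expMeasure (1 / L)) P
  size_indep : iIndepFun X.size P
  /-- arrivals and file sizes are independent -/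
  arrivals_indep_size : IndepFun
    (fun ω n => (X.pos (Sum.inr n) ω, X.arrival n ω)) (fun ω p => X.size p ω) P
  /-- the initial configuration is independent of arrivals and file sizes -/
  init_indep : IndepFun
    (fun ω => (X.initNum ω, fun i => X.pos (Sum.inl i) ω))
    (fun ω => ((fun n => (X.pos (Sum.inr n) ω, X.arrival n ω)), fun p => X.size p ω)) P
  /-- a link leaves once it has transmitted its file at the instantaneous rates
  `R(x_p, φ_u)`: `d_p = inf {t > b_p : ∫_{b_p}^t R(x_p, φ_u) du ≥ L_p}` -/
  death_eq : ∀ᵐ ω ∂P, ∀ p, X.Present p ω → X.death p ω =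
    sInf ((fun t : ℝ => (t : EReal)) '' {t : ℝ | X.birth p ω < t ∧
      X.size p ω ≤ ∫ u in (X.birth p ω)..t, rate C N0 l (X.pos p ω) (X.config u ω)})

/-- The Markov process `φ_t` is in steady state: its law does not depend on time. -/
def IsSteadyState [MeasurableSpace Ω] (X : LinkProcess Q Ω) (P : Measure Ω) : Prop :=
  ∀ t : ℝ, 0 ≤ t → IdentDistrib (X.config t) (X.config 0) P P

end LinkProcess

end Dynamics

end

/-! Both K-functions carry the same normalising factors, so only the mean numbers of ordered pairs
of points with relative position in the disc `B` have to be compared. For the Poisson process this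
mean is at most `(β|S|)(β|B|)` (`lintegral_pairFunctional_le`), and in steady state it is at least
that value (`IsBirthDeath.lintegral_pairFunctional_ge`).

The lower bound rests on monotonicity. An extra link or a larger file raises the interference,
lowers all rates and delays all departures (`IsSol.le_of_match`, `Embeds.alive`). Hence, for a
system started empty, being alive at a given time is an increasing function of the Poisson arrivals
and their marks, and increasing functions of independent data are positively correlated. So, given
that a link sits at `x` and is still alive, the mean number of other links in `x + B` is at least
what it is without this information; inserting the link at `x` only helps the others, and by
translation invariance the remaining mean is `|B|/|S|` times the mean total number.

To make this precise with little machinery, time is cut into `m` slices of length `h`, and a slot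
records the only arrival of its slice, or `0`. The slots are independent (`map_slots_eq_pi`), and
`0` is a minimal state of probability at least `1 - q` with `q = θh`. No order on the remaining
states is needed: a Harris inequality with error `m q ^ 2` follows from minimality of `0` alone
(`integral_mul_ge_pi`). Conditioning on one slot being occupied contributes another factor `q`, so
the total error in `integral_pairCount_ge` has orders `q` and `m ^ 2 q ^ 3`, which vanish as the
mesh does.

The initial configuration of the steady state is arbitrary, so its influence must be shown to fade.
By stationarity the mean number of links is the same at all times, and by the memoryless property
the residual sizes are bounded in probability; so with probability at least `1 - ε` the system is
quiet at any given time, meaning few links with little left to send. A quiet system without arrivals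
during a fixed period `K` becomes empty, and having no arrivals has a fixed positive probability
independent of the past. Thus the probability of having found links at all of the times `0, K, …,
nK` becomes at most `2ε` (`Driven.exists_prob_busy_le`). Once the system has been empty, its later
state is that of a system driven by the arrivals alone (`alive_of_empty`). The pair bound for such
systems therefore holds at time `nK` up to a small error (`Driven.pairSum_ge`), and stationarity
carries it back to time `0`. A cutoff `M` on the number of links keeps all quantities bounded; it is
removed last. -/

set_option linter.unusedSectionVars false

noncomputable section

namespace SpatialBD

variable {ι κ V : Type*}

/-! ### Deterministic dynamics -/

/-- Link `i` of the system `z` (position, birth time, file size) with departure times `d` is alive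
at time `t`.  Links with non-positive size are never alive. -/
def AliveAt (z : ι → V × ℝ × ℝ) (d : ι → EReal) (i : ι) (t : ℝ) : Prop :=
  0 < (z i).2.2 ∧ (z i).2.1 ≤ t ∧ (t : EReal) < d i

open Classical in
/-- Total interference at the location `x` at time `t`. -/
def interf [Sub V] (w : V → ℝ≥0∞) (z : ι → V × ℝ × ℝ) (d : ι → EReal) (x : V) (t : ℝ) : ℝ≥0∞ :=
  ∑' j, if AliveAt z d j t then w ((z j).1 - x) else 0

/-- First time after `b` at which the integral of the rate `f` from `b` on reaches `ℓ`. -/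
def exitTime (f : ℝ → ℝ≥0∞) (b ℓ : ℝ) : EReal :=
  sInf ((fun t : ℝ => (t : EReal)) '' {t : ℝ | b < t ∧ ENNReal.ofReal ℓ ≤ ∫⁻ u in Ioo b t, f u})

/-- The departure times `d` solve the dynamics driven by `z`. -/
def IsSol [Sub V] (w : V → ℝ≥0∞) (g : ℝ≥0∞ → ℝ≥0∞) (z : ι → V × ℝ × ℝ) (d : ι → EReal) : Prop :=
  ∀ i, 0 < (z i).2.2 →
    d i = exitTime (fun u => g (interf w z d (z i).1 u)) (z i).2.1 (z i).2.2

/-- Service rate as a function of the interference. -/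
structure IsRate (g : ℝ≥0∞ → ℝ≥0∞) : Prop where
  anti : Antitone g
  cont : Continuous g
  lt_top : g 0 < ∞
  pos : ∀ a, a ≠ ∞ → 0 < g a

lemma IsRate.le {g : ℝ≥0∞ → ℝ≥0∞} (hg : IsRate g) (a : ℝ≥0∞) : g a ≤ g 0 := hg.anti (zero_le)

/-- A bounded rate has an integral that is continuous in its endpoint, so the infimum is attained
and the sublevel sets of the exit time are described by the integral up to `t` itself. -/
lemma exitTime_le_iff {f : ℝ → ℝ≥0∞} {c : ℝ≥0∞} (hc : c ≠ ∞) (hf : ∀ u, f u ≤ c) (b ℓ t : ℝ) :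
    exitTime f b ℓ ≤ (t : EReal) ↔ b ≤ t ∧ ENNReal.ofReal ℓ ≤ ∫⁻ u in Ioo b t, f u := by
  have key : ∀ s : ℝ, t < s → exitTime f b ℓ ≤ (t : EReal) →
      b < s ∧ ENNReal.ofReal ℓ ≤ ∫⁻ u in Ioo b s, f u := by
    intro s hs h
    have h1 : exitTime f b ℓ < (s : EReal) := lt_of_le_of_lt h (by exact_mod_cast hs)
    obtain ⟨_, ⟨r, hr, rfl⟩, hrs⟩ := sInf_lt_iff.1 h1
    have hrs' : r < s := EReal.coe_lt_coe_iff.1 hrs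
    exact ⟨hr.1.trans hrs', hr.2.trans (lintegral_mono_set (Ioo_subset_Ioo_right hrs'.le))⟩
  constructor
  · intro h
    refine ⟨le_of_forall_gt fun s hs => (key s hs h).1, ?_⟩
    have h2 : ∀ s : ℝ, t < s →
        ENNReal.ofReal ℓ ≤ (∫⁻ u in Ioo b t, f u) + c * ENNReal.ofReal (s - t) := by
      intro s hs
      refine (key s hs h).2.trans ?_
      have hsub : Ioo b s ⊆ Ioo b t ∪ Ico t s := by
        intro u hu
        rcases lt_or_ge u t with h | h
        · exact Or.inl ⟨hu.1, h⟩
        · exact Or.inr ⟨h, hu.2⟩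
      refine (lintegral_mono_set hsub).trans ((lintegral_union_le _ _ _).trans ?_)
      gcongr
      calc ∫⁻ u in Ico t s, f u ≤ ∫⁻ u in Ico t s, c := lintegral_mono fun u => hf u
        _ = c * ENNReal.ofReal (s - t) := by simp
    have h3 : Filter.Tendsto (fun s : ℝ => (∫⁻ u in Ioo b t, f u) + c * ENNReal.ofReal (s - t))
        (nhdsWithin t (Ioi t)) (nhds ((∫⁻ u in Ioo b t, f u) + c * ENNReal.ofReal (t - t))) := by
      refine Filter.Tendsto.mono_left ?_ nhdsWithin_le_nhds
      refine Filter.Tendsto.add tendsto_const_nhds (ENNReal.Tendsto.const_mul ?_ (Or.inr hc))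
      exact ENNReal.tendsto_ofReal ((continuous_id.sub continuous_const).tendsto t)
    simp only [sub_self, ENNReal.ofReal_zero, mul_zero, add_zero] at h3
    exact ge_of_tendsto h3 (by filter_upwards [self_mem_nhdsWithin] with s hs using h2 s hs)
  · rintro ⟨hb, hl⟩
    refine le_of_forall_gt_imp_ge_of_dense fun a ha => ?_
    obtain ⟨s, hs1, hs2⟩ := EReal.lt_iff_exists_real_btwn.1 ha
    refine le_trans (sInf_le ⟨s, ⟨?_, ?_⟩, rfl⟩) hs2.le
    · exact lt_of_le_of_lt hb (by exact_mod_cast hs1)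
    · refine hl.trans (lintegral_mono_set (Ioo_subset_Ioo_right ?_))
      exact_mod_cast hs1.le

lemma le_exitTime (f : ℝ → ℝ≥0∞) (b ℓ : ℝ) : (b : EReal) ≤ exitTime f b ℓ := by
  refine le_sInf ?_
  rintro _ ⟨t, ht, rfl⟩
  exact EReal.coe_le_coe_iff.2 ht.1.le

lemma exitTime_anti {f f' : ℝ → ℝ≥0∞} (h : ∀ u, f' u ≤ f u) (b ℓ : ℝ) :
    exitTime f b ℓ ≤ exitTime f' b ℓ := by
  refine sInf_le_sInf (image_mono ?_)
  rintro t ⟨h1, h2⟩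
  exact ⟨h1, h2.trans (lintegral_mono h)⟩

/-! ### Comparison of two solutions by matching links -/

section Comparison

variable [AddCommGroup V] {w : V → ℝ≥0∞} {g : ℝ≥0∞ → ℝ≥0∞}

/-- Interference depends only on relative positions, so a common translation is harmless, and an
injective matching of alive links can only add terms. -/
lemma interf_le_of_match {z : ι → V × ℝ × ℝ} {z' : κ → V × ℝ × ℝ} {d : ι → EReal}
    {d' : κ → EReal} {S : Set ι} {e : ι → κ} (hinj : InjOn e S) {y : V}
    (hpos : ∀ i ∈ S, (z' (e i)).1 = (z i).1 + y) {u : ℝ}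
    (hS : ∀ j, AliveAt z d j u → j ∈ S ∧ AliveAt z' d' (e j) u) (x : V) :
    interf w z d x u ≤ interf w z' d' (x + y) u := by
  classical
  unfold interf
  have h0 : Function.support (fun j => if AliveAt z d j u then w ((z j).1 - x) else 0) ⊆ S := by
    intro j hj
    by_contra hjS
    exact hj (if_neg fun h => hjS (hS j h).1)
  rw [← tsum_subtype_eq_of_support_subset h0]
  have hinj' : Function.Injective (fun j : S => e j) := fun a b hab =>
    Subtype.ext (hinj a.2 b.2 hab)
  refine le_trans (ENNReal.tsum_le_tsum fun j => ?_)
    (ENNReal.tsum_comp_le_tsum_of_injective hinj'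
      (fun j' => if AliveAt z' d' j' u then w ((z' j').1 - (x + y)) else 0))
  split_ifs with h1 h2
  · rw [hpos j j.2, add_sub_add_right_eq_sub]
  · exact absurd (hS j h1).2 h2
  · exact zero_le
  · exact le_rfl

/-- Comparison of two solutions: links of `z` in `S` are matched by `e` with links of `z'`. -/
theorem IsSol.le_of_match (hg : IsRate g) {z : ι → V × ℝ × ℝ} {z' : κ → V × ℝ × ℝ}
    {d : ι → EReal} {d' : κ → EReal} (hd : IsSol w g z d) (hd' : IsSol w g z' d')
    (S : Set ι) (e : ι → κ) (y : V) (τ : ℝ) (hfin : {i ∈ S | (z i).2.1 ≤ τ}.Finite)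
    (hinj : InjOn e S) (hS : ∀ i ∈ S, 0 < (z i).2.2) (hS' : ∀ i ∈ S, 0 < (z' (e i)).2.2)
    (hpos : ∀ i ∈ S, (z' (e i)).1 = (z i).1 + y)
    (hbirth : ∀ i ∈ S, (z' (e i)).2.1 = (z i).2.1)
    (hsize : ∀ i ∈ S, d' (e i) ≤ τ → (z i).2.2 ≤ (z' (e i)).2.2)
    (hout : ∀ j ∉ S, ∀ i ∈ S, ∀ u, (z i).2.1 < u → u < τ → ¬ AliveAt z d j u) :
    ∀ i ∈ S, d' (e i) ≤ τ → d i ≤ d' (e i) := by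
  by_contra! hcon
  obtain ⟨i0, hi0S, hi0τ, hi0⟩ := hcon
  have hlow : ∀ i ∈ S, ((z i).2.1 : EReal) ≤ d' (e i) := by
    intro i hi
    rw [hd' _ (hS' i hi), ← hbirth i hi]
    exact le_exitTime _ _ _
  let T : Set ι := {i ∈ S | d' (e i) ≤ τ ∧ d' (e i) < d i}
  have hTfin : T.Finite := hfin.subset fun i hi =>
    ⟨hi.1, by exact_mod_cast (hlow i hi.1).trans hi.2.1⟩
  -- Among the violating links take one whose match leaves `z'` first. Until that time no match has
  -- left too early, so the interference in `z'` dominates and the link must leave `z` by then, a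
  -- contradiction.
  obtain ⟨i, hiT, himin⟩ := exists_min_image T (fun i => d' (e i)) hTfin ⟨i0, hi0S, hi0τ, hi0⟩
  obtain ⟨hiS, hiτ, hi⟩ := hiT
  obtain ⟨σ, hσ⟩ : ∃ σ : ℝ, d' (e i) = (σ : EReal) := by
    have h1 : d' (e i) ≠ ⊤ := (lt_of_le_of_lt hiτ (EReal.coe_lt_top τ)).ne
    have h2 : d' (e i) ≠ ⊥ := (lt_of_lt_of_le (EReal.bot_lt_coe _) (hlow i hiS)).ne'
    exact ⟨_, (EReal.coe_toReal h1 h2).symm⟩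
  have hστ : σ ≤ τ := by rw [hσ] at hiτ; exact_mod_cast hiτ
  have halive : ∀ u, (z i).2.1 < u → u < σ → ∀ j, AliveAt z d j u →
      j ∈ S ∧ AliveAt z' d' (e j) u := by
    intro u hbu huσ j hj
    have hjS : j ∈ S := by
      by_contra hjS
      exact hout j hjS i hiS u hbu (huσ.trans_le hστ) hj
    refine ⟨hjS, hS' j hjS, (hbirth j hjS).trans_le hj.2.1, ?_⟩
    by_contra! hle
    have h1 : d' (e j) < d j := lt_of_le_of_lt hle hj.2.2
    have h2 : (u : EReal) < σ := by exact_mod_cast huσ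
    have h3 : d' (e j) ≤ τ := hle.trans (by exact_mod_cast (huσ.le.trans hστ))
    have h4 := himin j ⟨hjS, h3, h1⟩
    rw [hσ] at h4
    exact absurd (lt_of_le_of_lt hle h2) (not_lt.2 h4)
  have hex' := (hd' _ (hS' i hiS)).symm.trans hσ |>.le
  rw [exitTime_le_iff hg.lt_top.ne (fun u => hg.le _)] at hex'
  have hex : d i ≤ σ := by
    rw [hd i (hS i hiS), exitTime_le_iff hg.lt_top.ne (fun u => hg.le _)]
    refine ⟨(hbirth i hiS).symm.trans_le hex'.1,
      (ENNReal.ofReal_le_ofReal (hsize i hiS hiτ)).trans (hex'.2.trans ?_)⟩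
    rw [hbirth i hiS]
    refine setLIntegral_mono' measurableSet_Ioo fun u hu => hg.anti ?_
    rw [hpos i hiS]
    exact interf_le_of_match hinj hpos (halive u hu.1 hu.2) _
  rw [hσ] at hi
  exact absurd hi (not_lt.2 hex)

end Comparison

lemma tsum_iSup_of_monotone {f : ℕ → ι → ℝ≥0∞} (hf : Monotone f) :
    ∑' i, ⨆ n, f n i = ⨆ n, ∑' i, f n i := by
  let _ : MeasurableSpace ι := ⊤
  have : MeasurableSingletonClass ι := ⟨fun _ => trivial⟩
  simp only [← lintegral_count]
  exact lintegral_iSup (fun n => measurable_from_top) hf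

/-! ### Measurable dependence on the data -/

section Measurability

variable {A : Type*} [MeasurableSpace A] [MeasurableSpace V]

lemma measurableSet_aliveAt {z : A → ι → V × ℝ × ℝ} (hz : Measurable z)
    {d : A → ι → EReal} (hd : Measurable d) {t : A → ℝ} (ht : Measurable t) (i : ι) :
    MeasurableSet {a | AliveAt (z a) (d a) i (t a)} := by
  have hzi : Measurable fun a => z a i := (measurable_pi_apply i).comp hz
  have hdi : Measurable fun a => d a i := (measurable_pi_apply i).comp hd
  exact (measurableSet_lt measurable_const hzi.snd.snd).inter
    ((measurableSet_le hzi.snd.fst ht).inter (measurableSet_lt ht.coe_real_ereal hdi))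

lemma measurable_interf [Countable ι] [AddCommGroup V] [MeasurableSub₂ V] {w : V → ℝ≥0∞}
    (hw : Measurable w) {z : A → ι → V × ℝ × ℝ} (hz : Measurable z)
    {d : A → ι → EReal} (hd : Measurable d) {x : A → V} (hx : Measurable x)
    {t : A → ℝ} (ht : Measurable t) :
    Measurable fun a => interf w (z a) (d a) (x a) (t a) := by
  classical
  refine Measurable.tsum fun j => ?_
  refine Measurable.ite (measurableSet_aliveAt hz hd ht j) ?_ measurable_const
  exact hw.comp ((((measurable_pi_apply j).comp hz).fst).sub hx)

/-- By `exitTime_le_iff` the sublevel sets are given by integrals of a jointly measurable function,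
to which Tonelli applies. -/
lemma measurable_exitTime {f : A → ℝ → ℝ≥0∞} (hf : Measurable (Function.uncurry f)) {c : ℝ≥0∞}
    (hc : c ≠ ∞) (hfc : ∀ a u, f a u ≤ c) {b ℓ : A → ℝ} (hb : Measurable b) (hℓ : Measurable ℓ) :
    Measurable fun a => exitTime (f a) (b a) (ℓ a) := by
  refine measurable_of_Iic fun s => ?_
  induction s using EReal.rec with
  | bot =>
    convert MeasurableSet.empty
    ext a
    simp only [mem_preimage, mem_Iic, le_bot_iff, mem_empty_iff_false, iff_false]
    exact ((EReal.bot_lt_coe _).trans_le (le_exitTime (f a) (b a) (ℓ a))).ne'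
  | top => simp
  | coe t =>
    have : (fun a => exitTime (f a) (b a) (ℓ a)) ⁻¹' Iic (t : EReal) =
        {a | b a ≤ t} ∩ {a | ENNReal.ofReal (ℓ a) ≤
          ∫⁻ u, {p : A × ℝ | b p.1 < p.2 ∧ p.2 < t}.indicator (Function.uncurry f) (a, u)} := by
      ext a
      simp only [mem_preimage, mem_Iic, exitTime_le_iff hc (hfc a), mem_inter_iff, mem_ofPred_eq,
        ← lintegral_indicator measurableSet_Ioo]
      rfl
    rw [this]
    refine (measurableSet_le hb measurable_const).inter
      (measurableSet_le hℓ.ennreal_ofReal ?_)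
    refine Measurable.lintegral_prod_right' (hf.indicator ?_)
    exact (measurableSet_lt (hb.comp measurable_fst) measurable_snd).inter
      (measurableSet_lt measurable_snd measurable_const)

end Measurability

/-! ### Existence of departure times by monotone iteration -/

section Construction

variable [AddCommGroup V] (w : V → ℝ≥0∞) (g : ℝ≥0∞ → ℝ≥0∞)

/-- One step of the fixed point iteration for the departure times. -/
def deathStep (z : ι → V × ℝ × ℝ) (d : ι → EReal) : ι → EReal := fun i =>
  exitTime (fun u => g (interf w z d (z i).1 u)) (z i).2.1 (z i).2.2

/-- The departure times of the system `z`: the limit of the fixed point iteration. -/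
def deaths (z : ι → V × ℝ × ℝ) : ι → EReal :=
  fun i => ⨆ n, (deathStep w g z)^[n] ⊥ i

variable {w g}

lemma interf_mono (z : ι → V × ℝ × ℝ) (x : V) (t : ℝ) :
    Monotone fun d : ι → EReal => interf w z d x t := by
  classical
  intro d d' h
  refine ENNReal.tsum_le_tsum fun j => ?_
  split_ifs with h1 h2
  · exact le_rfl
  · exact absurd ⟨h1.1, h1.2.1, h1.2.2.trans_le (h j)⟩ h2
  · exact zero_le
  · exact le_rfl

lemma deathStep_mono (hg : IsRate g) (z : ι → V × ℝ × ℝ) : Monotone (deathStep w g z) :=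
  fun _ _ h i => exitTime_anti (fun u => hg.anti (interf_mono z _ u h)) _ _

/-- The strict inequality `t < d i` in the definition of being alive is what makes the interference
continuous along increasing departure times: `t` lies below the supremum only if it lies below some
term. -/
lemma interf_iSup {z : ι → V × ℝ × ℝ} {d : ℕ → ι → EReal} (hd : Monotone d) (x : V) (t : ℝ) :
    interf w z (fun i => ⨆ n, d n i) x t = ⨆ n, interf w z (d n) x t := by
  classical
  unfold interf
  rw [← tsum_iSup_of_monotone]
  · refine tsum_congr fun j => ?_
    split_ifs with h
    · obtain ⟨n, hn⟩ := lt_iSup_iff.1 h.2.2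
      refine le_antisymm ?_ (iSup_le fun n => ?_)
      · refine le_trans ?_ (le_iSup _ n)
        rw [if_pos ⟨h.1, h.2.1, hn⟩]
      · split_ifs <;> simp
    · refine (ENNReal.iSup_eq_zero.2 fun n => if_neg fun hn => h ?_).symm
      exact ⟨hn.1, hn.2.1, hn.2.2.trans_le (le_iSup (fun n => d n j) n)⟩
  · intro m n hmn j
    dsimp only
    split_ifs with h1 h2
    · exact le_rfl
    · exact absurd ⟨h1.1, h1.2.1, h1.2.2.trans_le (hd hmn j)⟩ h2
    · exact zero_le
    · exact le_rfl

lemma measurable_interf_time [Countable ι] [MeasurableSpace V] [MeasurableSub₂ V]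
    (hw : Measurable w) (z : ι → V × ℝ × ℝ) (d : ι → EReal) (x : V) :
    Measurable fun u => interf w z d x u :=
  measurable_interf hw (z := fun _ => z) measurable_const (d := fun _ => d) measurable_const
    measurable_const measurable_id

/-- Starting from `⊥`, the iterates of the monotone map `deathStep` increase. Interference commutes
with their supremum, the rate is continuous, and the integrals over bounded intervals decrease from
a finite value, so the limit is a fixed point. -/
theorem isSol_deaths [Countable ι] [MeasurableSpace V] [MeasurableSub₂ V] (hw : Measurable w)
    (hg : IsRate g) (z : ι → V × ℝ × ℝ) : IsSol w g z (deaths w g z) := by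
  intro i _
  have hmono : Monotone fun n => (deathStep w g z)^[n] ⊥ :=
    (deathStep_mono hg z).monotone_iterate_of_le_map bot_le
  change deaths w g z i = deathStep w g z (deaths w g z) i
  refine le_antisymm (iSup_le fun n => ?_) ?_
  · refine le_trans (hmono n.le_succ i) ?_
    simp only [Nat.succ_eq_add_one, Function.iterate_succ_apply']
    exact deathStep_mono hg z (fun j => le_iSup (fun n => (deathStep w g z)^[n] ⊥ j) n) i
  · refine EReal.le_of_forall_lt_iff_le.1 fun t ht => ?_
    have hn : ∀ n, deathStep w g z ((deathStep w g z)^[n] ⊥) i ≤ t := fun n => by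
      rw [← congrFun (Function.iterate_succ_apply' (deathStep w g z) n ⊥) i]
      exact (le_iSup (fun n => (deathStep w g z)^[n] ⊥ i) (n + 1)).trans ht.le
    simp only [deathStep, exitTime_le_iff hg.lt_top.ne (fun u => hg.le _)] at hn ⊢
    refine ⟨(hn 0).1, ?_⟩
    have hfin : ∫⁻ u in Ioo (z i).2.1 t,
        g (interf w z ((deathStep w g z)^[0] ⊥) (z i).1 u) ≠ ∞ := by
      refine ((lintegral_mono fun u => hg.le _).trans_lt ?_).ne
      simp [ENNReal.mul_lt_top, hg.lt_top]
    have hlim := lintegral_iInf (μ := volume.restrict (Ioo (z i).2.1 t))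
      (f := fun n u => g (interf w z ((deathStep w g z)^[n] ⊥) (z i).1 u))
      (fun n => hg.cont.measurable.comp (measurable_interf_time hw _ _ _))
      (fun m n hmn u => hg.anti (interf_mono z _ u (hmono hmn))) hfin
    have heq : ∀ u, ⨅ n, g (interf w z ((deathStep w g z)^[n] ⊥) (z i).1 u) =
        g (interf w z (deaths w g z) (z i).1 u) := fun u => by
      unfold deaths
      rw [interf_iSup hmono, hg.anti.map_ciSup_of_continuousAt hg.cont.continuousAt]
    simp only [heq] at hlim
    rw [hlim]
    exact le_iInf fun n => (hn n).2

lemma measurable_deaths [Countable ι] [MeasurableSpace V] [MeasurableSub₂ V] (hw : Measurable w)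
    (hg : IsRate g) : Measurable (deaths w g : (ι → V × ℝ × ℝ) → ι → EReal) := by
  have hn : ∀ n, Measurable fun z : ι → V × ℝ × ℝ => (deathStep w g z)^[n] ⊥ := by
    intro n
    induction n with
    | zero => exact measurable_const
    | succ n ih =>
      simp only [Function.iterate_succ_apply']
      refine measurable_pi_lambda _ fun i => ?_
      refine measurable_exitTime (c := g 0) ?_ hg.lt_top.ne (fun _ _ => hg.le _)
        (measurable_pi_apply i).snd.fst (measurable_pi_apply i).snd.snd
      refine hg.cont.measurable.comp (measurable_interf hw measurable_fst
        (ih.comp measurable_fst) ?_ measurable_snd)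
      exact ((measurable_pi_apply i).comp measurable_fst).fst
  exact measurable_pi_lambda _ fun i => Measurable.iSup fun n => (measurable_pi_apply i).comp (hn n)

end Construction

/-! ### Monotonicity of systems and uniqueness of departure times -/

section Systems

variable [AddCommGroup V] (w : V → ℝ≥0∞) (g : ℝ≥0∞ → ℝ≥0∞)

/-- Link `i` of the system `z` is alive at time `t`. -/
def Alive (z : ι → V × ℝ × ℝ) (i : ι) (t : ℝ) : Prop := AliveAt z (deaths w g z) i t

open Classical in
/-- Number of links alive at time `t`. -/
def count (z : ι → V × ℝ × ℝ) (t : ℝ) : ℝ≥0∞ := ∑' i, if Alive w g z i t then 1 else 0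

/-- Finitely many links arrive up to each time. -/
def LocFin (z : ι → V × ℝ × ℝ) : Prop := ∀ t, {i | 0 < (z i).2.2 ∧ (z i).2.1 ≤ t}.Finite

/-- The links of `z` are, up to a translation, among those of `z'`, with at most the same sizes. -/
structure Embeds (e : ι → κ) (y : V) (z : ι → V × ℝ × ℝ) (z' : κ → V × ℝ × ℝ) : Prop where
  inj : InjOn e {i | 0 < (z i).2.2}
  pos : ∀ i, 0 < (z i).2.2 → (z' (e i)).1 = (z i).1 + y
  birth : ∀ i, 0 < (z i).2.2 → (z' (e i)).2.1 = (z i).2.1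
  size : ∀ i, 0 < (z i).2.2 → (z i).2.2 ≤ (z' (e i)).2.2

/-- The system without the links arriving after time `s`. -/
def trunc (s : ℝ) (z : ι → V × ℝ × ℝ) : ι → V × ℝ × ℝ := fun i =>
  if (z i).2.1 ≤ s then z i else ((z i).1, (z i).2.1, 0)

open Classical in
/-- The system in which the file size of link `p` is reduced by `v`. -/
def shorten (p : ι) (v : ℝ) (z : ι → V × ℝ × ℝ) : ι → V × ℝ × ℝ :=
  Function.update z p ((z p).1, (z p).2.1, (z p).2.2 - v)

variable {w g}

lemma count_eq_zero_iff {z : ι → V × ℝ × ℝ} {t : ℝ} :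
    count w g z t = 0 ↔ ∀ i, ¬ Alive w g z i t := by
  simp [count, ENNReal.tsum_eq_zero]

lemma tsum_le_tsum_of_injOn {f : ι → ℝ≥0∞} {f' : κ → ℝ≥0∞} {S : Set ι} {e : ι → κ}
    (he : InjOn e S) (h0 : ∀ i ∉ S, f i = 0) (h : ∀ i ∈ S, f i ≤ f' (e i)) :
    ∑' i, f i ≤ ∑' j, f' j := by
  have hsupp : Function.support f ⊆ S := fun i hi => by
    by_contra hiS
    exact hi (h0 i hiS)
  rw [← tsum_subtype_eq_of_support_subset hsupp]
  have hinj' : Function.Injective (fun j : S => e j) := fun a b hab =>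
    Subtype.ext (he a.2 b.2 hab)
  exact (ENNReal.tsum_le_tsum fun j : S => h j j.2).trans
    (ENNReal.tsum_comp_le_tsum_of_injective hinj' f')

lemma count_le_count {z : ι → V × ℝ × ℝ} {z' : κ → V × ℝ × ℝ} {e : ι → κ} {t : ℝ}
    (he : InjOn e {i | Alive w g z i t}) (h : ∀ i, Alive w g z i t → Alive w g z' (e i) t) :
    count w g z t ≤ count w g z' t := by
  classical
  refine tsum_le_tsum_of_injOn he (fun i hi => if_neg hi) fun i hi => ?_
  rw [if_pos (h i hi), if_pos (show Alive w g z i t from hi)]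

lemma measurableSet_alive [Countable ι] [MeasurableSpace V] [MeasurableSub₂ V]
    (hw : Measurable w) (hg : IsRate g) (i : ι) (t : ℝ) :
    MeasurableSet {z : ι → V × ℝ × ℝ | Alive w g z i t} :=
  measurableSet_aliveAt measurable_id (measurable_deaths hw hg) measurable_const i

lemma measurable_count [Countable ι] [MeasurableSpace V] [MeasurableSub₂ V]
    (hw : Measurable w) (hg : IsRate g) (t : ℝ) :
    Measurable fun z : ι → V × ℝ × ℝ => count w g z t := by
  classical
  exact Measurable.tsum fun i =>
    Measurable.ite (measurableSet_alive hw hg i t) measurable_const measurable_const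

variable [Countable ι] [Countable κ] [MeasurableSpace V] [MeasurableSub₂ V]

lemma alive_of_match (hw : Measurable w) (hg : IsRate g) {z : ι → V × ℝ × ℝ}
    {z' : κ → V × ℝ × ℝ} (S : Set ι) (e : ι → κ) (y : V) (τ : ℝ)
    (hfin : {i ∈ S | (z i).2.1 ≤ τ}.Finite)
    (hinj : InjOn e S) (hS : ∀ i ∈ S, 0 < (z i).2.2) (hS' : ∀ i ∈ S, 0 < (z' (e i)).2.2)
    (hpos : ∀ i ∈ S, (z' (e i)).1 = (z i).1 + y)
    (hbirth : ∀ i ∈ S, (z' (e i)).2.1 = (z i).2.1)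
    (hsize : ∀ i ∈ S, deaths w g z' (e i) ≤ τ → (z i).2.2 ≤ (z' (e i)).2.2)
    (hout : ∀ j ∉ S, ∀ i ∈ S, ∀ u, (z i).2.1 < u → u < τ → ¬ Alive w g z j u)
    {i : ι} (hi : i ∈ S) {t : ℝ} (ht : t ≤ τ) (hit : Alive w g z i t) :
    Alive w g z' (e i) t := by
  refine ⟨hS' i hi, (hbirth i hi).trans_le hit.2.1, ?_⟩
  by_contra! hle
  have := IsSol.le_of_match hg (isSol_deaths hw hg z) (isSol_deaths hw hg z') S e y τ hfin hinj hS
    hS' hpos hbirth hsize hout i hi (hle.trans (EReal.coe_le_coe_iff.2 ht))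
  exact absurd hit.2.2 (not_lt.2 (this.trans hle))

/-- Attractiveness of the dynamics, the source of all positive correlations below: more links and
larger files keep every link alive longer. -/
lemma Embeds.alive (hw : Measurable w) (hg : IsRate g) {z : ι → V × ℝ × ℝ}
    {z' : κ → V × ℝ × ℝ} (hz : LocFin z) {e : ι → κ} {y : V} (he : Embeds e y z z') {i : ι} {t : ℝ}
    (hit : Alive w g z i t) : Alive w g z' (e i) t :=
  alive_of_match hw hg {i | 0 < (z i).2.2} e y t (hz t) he.inj (fun _ h => h)
    (fun i h => lt_of_lt_of_le h (he.size i h)) he.pos he.birth (fun i h _ => he.size i h)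
    (fun _ hj _ _ _ _ _ h => hj h.1) hit.1 le_rfl hit

lemma Embeds.count_le (hw : Measurable w) (hg : IsRate g) {z : ι → V × ℝ × ℝ}
    {z' : κ → V × ℝ × ℝ} (hz : LocFin z) {e : ι → κ} {y : V} (he : Embeds e y z z') (t : ℝ) :
    count w g z t ≤ count w g z' t :=
  count_le_count (he.inj.mono fun _ hi => hi.1) fun _ hi => he.alive hw hg hz hi

/-- Departure times are determined by the dynamics. -/
lemma IsSol.eq_deaths (hw : Measurable w) (hg : IsRate g) {z : ι → V × ℝ × ℝ} (hz : LocFin z)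
    {d : ι → EReal} (hd : IsSol w g z d) {i : ι} (hi : 0 < (z i).2.2) : d i = deaths w g z i := by
  -- Matching every link with itself compares any two solutions in both directions.
  have key : ∀ d d' : ι → EReal, IsSol w g z d → IsSol w g z d' → d i ≤ d' i := by
    intro d d' hd hd'
    refine EReal.le_of_forall_lt_iff_le.1 fun t ht => ?_
    refine (IsSol.le_of_match hg hd hd' {i | 0 < (z i).2.2} id 0 t (hz t) (injOn_id _) (fun _ h => h)
      (fun _ h => h) (fun _ _ => (add_zero _).symm) (fun _ _ => rfl) (fun _ _ _ => le_rfl)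
      (fun _ hj _ _ _ _ _ h => hj h.1) i hi ht.le).trans ht.le
  exact le_antisymm (key _ _ hd (isSol_deaths hw hg z)) (key _ _ (isSol_deaths hw hg z) hd)


end Systems

/-! ### Truncated and shortened systems -/

section Modifications

lemma trunc_size_pos_iff {z : ι → V × ℝ × ℝ} {s : ℝ} {i : ι} :
    0 < (trunc s z i).2.2 ↔ 0 < (z i).2.2 ∧ (z i).2.1 ≤ s := by
  unfold trunc
  split_ifs with h <;> simp [h]

lemma trunc_of_le {z : ι → V × ℝ × ℝ} {s : ℝ} {i : ι} (h : (z i).2.1 ≤ s) : trunc s z i = z i :=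
  if_pos h

@[simp] lemma trunc_pos (z : ι → V × ℝ × ℝ) (s : ℝ) (i : ι) : (trunc s z i).1 = (z i).1 := by
  unfold trunc; split_ifs <;> rfl

@[simp] lemma trunc_birth (z : ι → V × ℝ × ℝ) (s : ℝ) (i : ι) :
    (trunc s z i).2.1 = (z i).2.1 := by
  unfold trunc; split_ifs <;> rfl

lemma LocFin.trunc_finite {z : ι → V × ℝ × ℝ} (hz : LocFin z) (s : ℝ) :
    {i | 0 < (trunc s z i).2.2}.Finite :=
  (hz s).subset fun _ hi => trunc_size_pos_iff.1 hi

lemma LocFin.of_finite {z : ι → V × ℝ × ℝ} (h : {i | 0 < (z i).2.2}.Finite) : LocFin z :=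
  fun _ => h.subset fun _ hi => hi.1

lemma locFin_fin {m : ℕ} (z : Fin m → V × ℝ × ℝ) : LocFin z := .of_finite (Set.toFinite _)

lemma LocFin.trunc {z : ι → V × ℝ × ℝ} (hz : LocFin z) (s : ℝ) : LocFin (trunc s z) :=
  .of_finite (hz.trunc_finite s)

lemma measurable_trunc [MeasurableSpace V] (s : ℝ) :
    Measurable (trunc s : (ι → V × ℝ × ℝ) → ι → V × ℝ × ℝ) := by
  refine measurable_pi_lambda _ fun i => ?_
  have hi : Measurable fun z : ι → V × ℝ × ℝ => z i := measurable_pi_apply i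
  exact Measurable.ite (measurableSet_le hi.snd.fst measurable_const) hi
    (hi.fst.prodMk (hi.snd.fst.prodMk measurable_const))

lemma measurable_shorten [MeasurableSpace V] (p : ι) (v : ℝ) :
    Measurable (shorten p v : (ι → V × ℝ × ℝ) → ι → V × ℝ × ℝ) := by
  classical
  have hp : Measurable fun z : ι → V × ℝ × ℝ => z p := measurable_pi_apply p
  refine measurable_pi_lambda _ fun i => ?_
  by_cases h : i = p
  · subst h
    simpa [shorten] using hp.fst.prodMk (hp.snd.fst.prodMk (hp.snd.snd.sub measurable_const))
  · simpa [shorten, h] using measurable_pi_apply i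

@[simp] lemma shorten_same (p : ι) (v : ℝ) (z : ι → V × ℝ × ℝ) :
    shorten p v z p = ((z p).1, (z p).2.1, (z p).2.2 - v) := by simp [shorten]

lemma shorten_of_ne {p i : ι} (h : i ≠ p) (v : ℝ) (z : ι → V × ℝ × ℝ) :
    shorten p v z i = z i := by simp [shorten, h]

@[simp] lemma shorten_pos (p i : ι) (v : ℝ) (z : ι → V × ℝ × ℝ) :
    (shorten p v z i).1 = (z i).1 := by
  by_cases h : i = p
  · subst h; simp
  · rw [shorten_of_ne h]

@[simp] lemma shorten_birth (p i : ι) (v : ℝ) (z : ι → V × ℝ × ℝ) :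
    (shorten p v z i).2.1 = (z i).2.1 := by
  by_cases h : i = p
  · subst h; simp
  · rw [shorten_of_ne h]

lemma shorten_size_le {p i : ι} {v : ℝ} (hv : 0 ≤ v) (z : ι → V × ℝ × ℝ) :
    (shorten p v z i).2.2 ≤ (z i).2.2 := by
  by_cases h : i = p
  · subst h; simp [hv]
  · rw [shorten_of_ne h]

end Modifications

/-! ### Causality, regeneration at empty times, and emptying -/

section Systems

variable [AddCommGroup V] {w : V → ℝ≥0∞} {g : ℝ≥0∞ → ℝ≥0∞}

lemma embeds_trunc (s : ℝ) (z : ι → V × ℝ × ℝ) : Embeds id 0 (trunc s z) z := by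
  refine ⟨injOn_id _, fun i _ => by simp, fun i _ => by simp, fun i hi => ?_⟩
  rw [trunc_of_le (trunc_size_pos_iff.1 hi).2]
  exact le_rfl

lemma Embeds.shorten {z : ι → V × ℝ × ℝ} {z' : κ → V × ℝ × ℝ} {e : ι → κ} {y : V}
    (he : Embeds e y z z') {p : ι} (hp : 0 < (z p).2.2) {v : ℝ} (hv : 0 ≤ v) :
    Embeds e y (shorten p v z) (shorten (e p) v z') := by
  have hpos : ∀ i, 0 < (SpatialBD.shorten p v z i).2.2 → 0 < (z i).2.2 := fun i hi =>
    lt_of_lt_of_le hi (shorten_size_le hv z)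
  refine ⟨he.inj.mono hpos, fun i hi => ?_, fun i hi => ?_, fun i hi => ?_⟩
  · simpa using he.pos i (hpos i hi)
  · simpa using he.birth i (hpos i hi)
  · by_cases h : i = p
    · subst h
      simpa using he.size i (hpos i hi)
    · have h' : e i ≠ e p := fun h' => h (he.inj (hpos i hi) hp h')
      rw [shorten_of_ne h, shorten_of_ne h']
      exact he.size i (hpos i hi)

lemma Alive.size_pos {z : ι → V × ℝ × ℝ} {i : ι} {t : ℝ} (h : Alive w g z i t) :
    0 < (z i).2.2 := h.1

lemma Alive.birth_le {z : ι → V × ℝ × ℝ} {i : ι} {t : ℝ} (h : Alive w g z i t) :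
    (z i).2.1 ≤ t := h.2.1

variable [Countable ι] [Countable κ] [MeasurableSpace V] [MeasurableSub₂ V]

/-- Causality: links arriving after `s` cannot interfere before `s`, so the comparison theorem
applies in both directions. -/
lemma alive_trunc_iff (hw : Measurable w) (hg : IsRate g) {z : ι → V × ℝ × ℝ} (hz : LocFin z)
    {s t : ℝ} (hts : t ≤ s) {i : ι} : Alive w g (trunc s z) i t ↔ Alive w g z i t := by
  constructor
  · intro h
    exact (embeds_trunc s z).alive hw hg (hz.trunc s) h
  · intro h
    have hS : ∀ i ∈ {i | 0 < (z i).2.2 ∧ (z i).2.1 ≤ s}, 0 < (trunc s z i).2.2 := fun i hi =>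
      trunc_size_pos_iff.2 hi
    refine alive_of_match hw hg {i | 0 < (z i).2.2 ∧ (z i).2.1 ≤ s} id 0 t ?_ (injOn_id _)
      (fun i hi => hi.1) hS (fun i _ => by simp) (fun i _ => by simp)
      (fun i hi _ => by rw [id, trunc_of_le hi.2]) ?_ ⟨h.size_pos, h.birth_le.trans hts⟩ le_rfl h
    · exact (hz s).subset fun i hi => hi.1
    · intro j hj i _ u _ hut hju
      exact hj ⟨hju.size_pos, hju.birth_le.trans (hut.le.trans hts)⟩

lemma count_trunc (hw : Measurable w) (hg : IsRate g) {z : ι → V × ℝ × ℝ} (hz : LocFin z)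
    {s t : ℝ} (hts : t ≤ s) : count w g (trunc s z) t = count w g z t := by
  classical
  exact tsum_congr fun i => if_congr (alive_trunc_iff hw hg hz hts) rfl rfl

/-- After a time at which the system is empty, the past has no influence. -/
lemma alive_of_empty (hw : Measurable w) (hg : IsRate g) {z : ι → V × ℝ × ℝ}
    {z' : κ → V × ℝ × ℝ} (hz : LocFin z) {s t : ℝ} (hst : s ≤ t)
    (hs : ∀ i, ¬ Alive w g z i s) (e : ι → κ) (y : V)
    (hinj : InjOn e {i | 0 < (z i).2.2 ∧ s < (z i).2.1 ∧ (z i).2.1 ≤ t})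
    (hmatch : ∀ i, 0 < (z i).2.2 → s < (z i).2.1 → (z i).2.1 ≤ t →
      (z' (e i)).1 = (z i).1 + y ∧ (z' (e i)).2.1 = (z i).2.1 ∧ (z i).2.2 ≤ (z' (e i)).2.2)
    {i : ι} (hi : Alive w g z i t) : s < (z i).2.1 ∧ Alive w g z' (e i) t := by
  -- Links born by time `s` are gone at `s`, hence they never interfere with a link born later. They
  -- may therefore stay unmatched.
  have hdead : ∀ j, 0 < (z j).2.2 → (z j).2.1 ≤ s → deaths w g z j ≤ s := by
    intro j h1 h2
    by_contra! h
    exact hs j ⟨h1, h2, h⟩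
  have hsi : s < (z i).2.1 := by
    by_contra! h
    exact absurd (hi.2.2.trans_le (hdead i hi.size_pos h))
      (not_lt.2 (EReal.coe_le_coe_iff.2 hst))
  refine ⟨hsi, alive_of_match hw hg {i | 0 < (z i).2.2 ∧ s < (z i).2.1 ∧ (z i).2.1 ≤ t} e y t
    ((hz t).subset fun i hi => ⟨hi.1.1, hi.2⟩) hinj (fun i hi => hi.1)
    (fun i hi => hi.1.trans_le (hmatch i hi.1 hi.2.1 hi.2.2).2.2)
    (fun i hi => (hmatch i hi.1 hi.2.1 hi.2.2).1) (fun i hi => (hmatch i hi.1 hi.2.1 hi.2.2).2.1)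
    (fun i hi _ => (hmatch i hi.1 hi.2.1 hi.2.2).2.2) ?_ ⟨hi.size_pos, hsi, hi.birth_le⟩ le_rfl hi⟩
  intro j hj i hi u hiu hut hju
  have hsj : ¬ s < (z j).2.1 := fun h => hj ⟨hju.size_pos, h, hju.birth_le.trans hut.le⟩
  have h1 := hju.2.2.trans_le (hdead j hju.size_pos (not_lt.1 hsj))
  have h2 : u < s := EReal.coe_lt_coe_iff.1 h1
  exact absurd (hi.2.1.trans hiu) (not_lt.2 h2.le)

/-- A system with few links, all with small residual sizes, and without arrivals gets empty. -/
lemma not_alive_of_quiet (hw : Measurable w) (hw1 : ∀ x, w x ≤ 1) (hg : IsRate g)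
    {z : ι → V × ℝ × ℝ} (hz : LocFin z) {t K v : ℝ} (hK : 0 ≤ K) (hv : 0 ≤ v) {M : ℝ≥0∞}
    (hM : count w g z t ≤ M) (hKv : ENNReal.ofReal v ≤ g M * ENNReal.ofReal K)
    (hbirth : ∀ i, 0 < (z i).2.2 → (z i).2.1 ≤ t)
    (hres : ∀ p, ¬ Alive w g (shorten p v z) p t) (p : ι) : ¬ Alive w g z p (t + K) := by
  classical
  intro hp
  have hbp := hbirth p hp.size_pos
  set I : ℝ → ℝ≥0∞ := fun u => interf w z (deaths w g z) (z p).1 u with hI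
  have hdp : ¬ deaths w g z p ≤ ((t + K : ℝ) : EReal) := not_le.2 hp.2.2
  rw [isSol_deaths hw hg z p hp.size_pos, exitTime_le_iff hg.lt_top.ne (fun u => hg.le _)] at hdp
  have h1 : ∫⁻ u in Ioo (z p).2.1 (t + K), g (I u) < ENNReal.ofReal (z p).2.2 := by
    by_contra! h
    exact hdp ⟨by linarith, h⟩
  -- No link is born after `t`, so the links alive during this period are among the at most `M`
  -- links alive at `t`. The rate stays at least `g M`, and `v` bits are sent by time `t + K`.
  have h2 : ∀ u ∈ Ioo t (t + K), g M ≤ g (I u) := by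
    intro u hu
    refine hg.anti (le_trans ?_ hM)
    refine ENNReal.tsum_le_tsum fun j => ?_
    split_ifs with h3 h4
    · exact hw1 _
    · refine absurd ⟨h3.1, hbirth j h3.1, lt_trans (EReal.coe_lt_coe_iff.2 hu.1) h3.2.2⟩ h4
    · exact zero_le
    · exact zero_le
  have h3 : (∫⁻ u in Ioo (z p).2.1 t, g (I u)) + ENNReal.ofReal v ≤
      ∫⁻ u in Ioo (z p).2.1 (t + K), g (I u) := by
    calc (∫⁻ u in Ioo (z p).2.1 t, g (I u)) + ENNReal.ofReal v
        ≤ (∫⁻ u in Ioo (z p).2.1 t, g (I u)) + ∫⁻ u in Ioo t (t + K), g (I u) := by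
          gcongr
          refine hKv.trans (le_trans (le_of_eq ?_) (setLIntegral_mono' measurableSet_Ioo h2))
          simp
      _ = ∫⁻ u in Ioo (z p).2.1 t ∪ Ioo t (t + K), g (I u) := by
          rw [lintegral_union measurableSet_Ioo]
          exact Set.disjoint_left.2 fun u hu hu' => lt_asymm hu.2 hu'.1
      _ ≤ _ := by
          refine lintegral_mono_set (union_subset (Ioo_subset_Ioo_right (by linarith))
            (Ioo_subset_Ioo_left hbp))
  have h4 : ∫⁻ u in Ioo (z p).2.1 t, g (I u) < ENNReal.ofReal ((z p).2.2 - v) := by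
    rw [ENNReal.ofReal_sub _ hv, lt_tsub_iff_right]
    exact h3.trans_lt h1
  have hLv : 0 < (z p).2.2 - v := ENNReal.ofReal_pos.1 (lt_of_le_of_lt zero_le h4)
  have hp' : 0 < (shorten p v z p).2.2 := by simpa using hLv
  refine hres p ⟨hp', by simpa using hbp, ?_⟩
  by_contra! hd
  have hd' := hd
  rw [isSol_deaths hw hg _ p hp'] at hd'
  obtain ⟨σ, hσ⟩ : ∃ σ : ℝ, deaths w g (shorten p v z) p = (σ : EReal) := by
    have h5 : deaths w g (shorten p v z) p ≠ ⊤ := (lt_of_le_of_lt hd (EReal.coe_lt_top t)).ne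
    have h6 : deaths w g (shorten p v z) p ≠ ⊥ := by
      rw [isSol_deaths hw hg _ p hp']
      exact (lt_of_lt_of_le (EReal.bot_lt_coe _) (le_exitTime _ _ _)).ne'
    exact ⟨_, (EReal.coe_toReal h5 h6).symm⟩
  have hσt : σ ≤ t := EReal.coe_le_coe_iff.1 (hσ ▸ hd)
  have hσ' := hσ.le
  rw [isSol_deaths hw hg _ p hp', exitTime_le_iff hg.lt_top.ne (fun u => hg.le _)] at hσ'
  simp only [shorten_same] at hσ'
  -- Before the shortened link leaves at `σ`, shortening it has not removed any interference. So if
  -- it has sent its reduced file by `σ ≤ t`, the original link has sent at least as much by `t`.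
  have h7 : ENNReal.ofReal ((z p).2.2 - v) ≤ ∫⁻ u in Ioo (z p).2.1 t, g (I u) := by
    refine hσ'.2.trans (le_trans ?_ (lintegral_mono_set (Ioo_subset_Ioo_right hσt)))
    refine setLIntegral_mono' measurableSet_Ioo fun u hu => hg.anti ?_
    have h8 := interf_le_of_match (w := w) (z := z) (z' := shorten p v z) (d := deaths w g z)
      (d' := deaths w g (shorten p v z)) (S := {i | 0 < (z i).2.2}) (e := id) (injOn_id _) (y := 0)
      (fun i _ => by simp) (u := u) (fun j hj => ⟨hj.1, ?_⟩) (z p).1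
    · simpa using h8
    · have hpos' : ∀ i, 0 < (z i).2.2 → 0 < (shorten p v z i).2.2 := by
        intro i hi
        by_cases h : i = p
        · subst h; exact hp'
        · rwa [shorten_of_ne h]
      refine alive_of_match hw hg {i | 0 < (z i).2.2} id 0 u (hz u) (injOn_id _)
        (fun _ h => h) hpos' (fun i _ => by simp) (fun i _ => by simp) (fun i hi hiu => ?_)
        (fun _ hj _ _ _ _ _ h => hj h.1) hj.1 le_rfl hj
      -- For `p` itself the size comparison fails, but it is required only if the shortened link has
      -- left by `u`, and `u < σ`.
      by_cases h : i = p
      · subst h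
        rw [id, hσ] at hiu
        exact absurd hu.2 (not_lt.2 (EReal.coe_le_coe_iff.1 hiu))
      · rw [id, shorten_of_ne h]
  exact absurd h4 (not_lt.2 h7)

end Systems

/-! ### Configurations of alive links as measures -/

section Configuration

variable [AddCommGroup V] {w : V → ℝ≥0∞} {g : ℝ≥0∞ → ℝ≥0∞}

open Classical in
/-- The point process of the links of the system `z` alive at time `t`. -/
def configOf [MeasurableSpace V] (w : V → ℝ≥0∞) (g : ℝ≥0∞ → ℝ≥0∞) (z : ι → V × ℝ × ℝ) (t : ℝ) : Measure V :=
  Measure.sum fun i => if Alive w g z i t then Measure.dirac (z i).1 else 0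

lemma lintegral_configOf [MeasurableSpace V] [MeasurableSingletonClass V] (z : ι → V × ℝ × ℝ) (t : ℝ) (f : V → ℝ≥0∞) :
    ∫⁻ x, f x ∂(configOf w g z t) =
      ∑' i, (open Classical in if Alive w g z i t then f (z i).1 else 0) := by
  rw [configOf, lintegral_sum_measure]
  refine tsum_congr fun i => ?_
  split_ifs <;> simp

lemma configOf_univ [MeasurableSpace V] (z : ι → V × ℝ × ℝ) (t : ℝ) : configOf w g z t univ = count w g z t := by
  rw [configOf, Measure.sum_apply _ MeasurableSet.univ]
  refine tsum_congr fun i => ?_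
  split_ifs <;> simp

lemma interf_ne_top (hw1 : ∀ x, w x ≤ 1) {z : ι → V × ℝ × ℝ} (hz : LocFin z) (d : ι → EReal)
    (x : V) (t : ℝ) : interf w z d x t ≠ ∞ := by
  classical
  unfold interf
  rw [tsum_eq_sum (s := (hz t).toFinset)]
  · refine (ENNReal.sum_lt_top.2 fun i _ => ?_).ne
    split_ifs
    · exact (hw1 _).trans_lt ENNReal.one_lt_top
    · simp
  · intro i hi
    exact if_neg fun h => hi (by simpa using ⟨h.1, h.2.1⟩)

lemma count_ne_top {z : ι → V × ℝ × ℝ} (hz : LocFin z) (t : ℝ) : count w g z t ≠ ∞ := by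
  classical
  unfold count
  rw [tsum_eq_sum (s := (hz t).toFinset)]
  · refine (ENNReal.sum_lt_top.2 fun i _ => ?_).ne
    split_ifs <;> simp
  · intro i hi
    exact if_neg fun h => hi (by simpa using ⟨h.1, h.2.1⟩)

end Configuration

/-! ### The network as an abstract system -/

section Network

variable {Q : ℝ}

open Classical in
/-- The contribution of a link to the interference at relative position `v`. -/
def pathLoss (l : ℝ → ℝ) (v : Torus Q) : ℝ≥0∞ :=
  if v = 0 then 0 else ENNReal.ofReal (l (torusNorm v))

/-- The Shannon rate as a function of the interference. -/
def shannon (C N0 : ℝ) (a : ℝ≥0∞) : ℝ≥0∞ :=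
  ENNReal.ofReal (C * Real.logb 2 (1 + ((ENNReal.ofReal N0 + a)⁻¹).toReal))

lemma isRate_shannon {C N0 : ℝ} (hC : 0 < C) (hN0 : 0 < N0) : IsRate (shannon C N0) := by
  have hfin : ∀ a, (ENNReal.ofReal N0 + a)⁻¹ ≠ ∞ := fun a => by
    simp [hN0]
  refine ⟨fun a b hab => ?_, ?_, by simp [shannon], fun a ha => ?_⟩
  · refine ENNReal.ofReal_le_ofReal (mul_le_mul_of_nonneg_left ?_ hC.le)
    refine Real.logb_le_logb_of_le one_lt_two (by positivity) ?_
    gcongr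
    exact hfin a
  · refine ENNReal.continuous_ofReal.comp (continuous_const.mul ?_)
    refine Continuous.logb (continuous_const.add ?_) fun a => by positivity
    refine continuous_iff_continuousAt.2 fun a => ?_
    have h1 : Continuous fun a : ℝ≥0∞ => (ENNReal.ofReal N0 + a)⁻¹ :=
      continuous_inv.comp (by fun_prop)
    exact (ENNReal.tendsto_toReal (hfin a)).comp h1.continuousAt
  · refine ENNReal.ofReal_pos.2 (mul_pos hC (Real.logb_pos one_lt_two ?_))
    have : 0 < ((ENNReal.ofReal N0 + a)⁻¹).toReal :=
      ENNReal.toReal_pos (by simp [ha]) (hfin a)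
    linarith

lemma continuous_torusNorm : Continuous (torusNorm : Torus Q → ℝ) := by
  unfold torusNorm
  fun_prop

lemma torusNorm_nonneg (x : Torus Q) : 0 ≤ torusNorm x := Real.sqrt_nonneg _

lemma measurable_comp_torusNorm {l : ℝ → ℝ} (hl : AntitoneOn l (Ici 0)) :
    Measurable fun v : Torus Q => l (torusNorm v) := by
  have h1 : Antitone fun r : ℝ => l (max r 0) := fun a b hab =>
    hl (mem_Ici.2 (le_max_right _ _)) (mem_Ici.2 (le_max_right _ _)) (max_le_max_right _ hab)
  have h2 := h1.measurable.comp (continuous_torusNorm (Q := Q)).measurable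
  simpa [Function.comp_def, torusNorm_nonneg] using h2

lemma measurable_pathLoss {l : ℝ → ℝ} (hl : AntitoneOn l (Ici 0)) :
    Measurable (pathLoss l : Torus Q → ℝ≥0∞) := by
  classical
  exact Measurable.ite (measurableSet_singleton 0) measurable_const
    (measurable_comp_torusNorm hl).ennreal_ofReal

lemma pathLoss_le_one {l : ℝ → ℝ} (hl : AntitoneOn l (Ici 0)) (hl0 : l 0 = 1) (v : Torus Q) :
    pathLoss l v ≤ 1 := by
  unfold pathLoss
  split_ifs
  · exact zero_le_one
  · rw [← ENNReal.ofReal_one, ← hl0]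
    exact ENNReal.ofReal_le_ofReal (hl self_mem_Ici (torusNorm_nonneg v) (torusNorm_nonneg v))

variable {Ω : Type*} (X : LinkProcess Q Ω)

open Classical in
/-- The system of all links of the network; labels that are not used get size `0`. -/
def fullData (ω : Ω) : ℕ ⊕ ℕ → Torus Q × ℝ × ℝ := fun p =>
  (X.pos p ω, X.birth p ω, if X.Present p ω then X.size p ω else 0)

variable {X}

lemma config_eq_sum {ω : Ω} (hsize : ∀ p, 0 < X.size p ω) (u : ℝ) :
    X.config u ω = Measure.sum fun p => (open Classical in
      if AliveAt (fullData X ω) (fun p => X.death p ω) p u then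
        Measure.dirac (fullData X ω p).1 else 0) := by
  unfold LinkProcess.config
  classical
  congr 1
  ext1 p
  refine if_congr ?_ rfl rfl
  unfold LinkProcess.Alive AliveAt fullData
  by_cases h : X.Present p ω <;> simp [h, hsize p]

/-- Restricting the integral to `{x}ᶜ` discards every link located at `x`, not only the receiver's
own. The convention that `pathLoss` vanishes at `0` reproduces exactly this. -/
lemma interference_config {l : ℝ → ℝ} (hl : AntitoneOn l (Ici 0)) (hl' : ∀ r, 0 ≤ r → 0 ≤ l r)
    {ω : Ω} (hsize : ∀ p, 0 < X.size p ω) (x : Torus Q) (u : ℝ) :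
    interference l x (X.config u ω) =
      (interf (pathLoss l) (fullData X ω) (fun p => X.death p ω) x u).toReal := by
  classical
  have hm : Measurable fun y : Torus Q => l (torusNorm (y - x)) :=
    (measurable_comp_torusNorm hl).comp (measurable_id.sub_const x)
  rw [interference, integral_eq_lintegral_of_nonneg_ae
    (Filter.Eventually.of_forall fun y => hl' _ (torusNorm_nonneg _)) hm.aestronglyMeasurable]
  congr 1
  rw [← lintegral_indicator (measurableSet_singleton x).compl, config_eq_sum hsize,
    lintegral_sum_measure]
  refine tsum_congr fun p => ?_
  split_ifs with h
  · rw [lintegral_dirac]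
    simp only [pathLoss, sub_eq_zero, indicator, mem_compl_iff, mem_singleton_iff]
    split_ifs <;> simp_all
  · simp

lemma rate_config {C N0 : ℝ} (hN0 : 0 < N0) {l : ℝ → ℝ} (hC : 0 < C)
    (hl : AntitoneOn l (Ici 0)) (hl' : ∀ r, 0 ≤ r → 0 ≤ l r) (hl0 : l 0 = 1)
    {ω : Ω} (hsize : ∀ p, 0 < X.size p ω) (hfin : LocFin (fullData X ω)) (x : Torus Q) (u : ℝ) :
    rate C N0 l x (X.config u ω) = (shannon C N0
      (interf (pathLoss l) (fullData X ω) (fun p => X.death p ω) x u)).toReal := by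
  have hI := interf_ne_top (pathLoss_le_one hl hl0) hfin (fun p => X.death p ω) x u
  rw [rate, interference_config hl hl' hsize, shannon, hl0, ENNReal.toReal_ofReal,
    ENNReal.toReal_inv, ENNReal.toReal_add ENNReal.ofReal_ne_top hI,
    ENNReal.toReal_ofReal hN0.le, one_div]
  refine mul_nonneg hC.le (Real.logb_nonneg one_lt_two ?_)
  simp

lemma isSol_fullData {C N0 : ℝ} (hC : 0 < C) (hN0 : 0 < N0) {l : ℝ → ℝ}
    (hl : AntitoneOn l (Ici 0)) (hl' : ∀ r, 0 ≤ r → 0 ≤ l r) (hl0 : l 0 = 1)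
    {ω : Ω} (hsize : ∀ p, 0 < X.size p ω) (hfin : LocFin (fullData X ω))
    (hdeath : ∀ p, X.Present p ω → X.death p ω =
    sInf ((fun t : ℝ => (t : EReal)) '' {t : ℝ | X.birth p ω < t ∧
      X.size p ω ≤ ∫ u in (X.birth p ω)..t, rate C N0 l (X.pos p ω) (X.config u ω)})) :
    IsSol (pathLoss l) (shannon C N0) (fullData X ω) (fun p => X.death p ω) := by
  intro p hp
  have hpres : X.Present p ω := by
    by_contra h
    simp [fullData, h] at hp
  dsimp only
  rw [hdeath p hpres, exitTime]
  congr 2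
  ext t
  simp only [mem_ofPred_eq, fullData, hpres, if_true, and_congr_right_iff]
  intro hbt
  have hg := isRate_shannon hC hN0
  have hm : Measurable fun u => shannon C N0
      (interf (pathLoss l) (fullData X ω) (fun p => X.death p ω) (X.pos p ω) u) :=
    hg.cont.measurable.comp (measurable_interf_time (measurable_pathLoss hl) _ _ _)
  rw [intervalIntegral.integral_of_le hbt.le, ← restrict_Ioo_eq_restrict_Ioc]
  simp only [rate_config hN0 hC hl hl' hl0 hsize hfin]
  rw [integral_toReal hm.aemeasurable
    (Filter.Eventually.of_forall fun u => (hg.le _).trans_lt hg.lt_top),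
    ENNReal.ofReal_le_iff_le_toReal]
  · refine ((lintegral_mono fun u => hg.le _).trans_lt ?_).ne
    simp [ENNReal.mul_lt_top, hg.lt_top]

/-- The given departure times solve the dynamics, hence by uniqueness they are those obtained from
the iteration. -/
lemma config_eq_configOf {C N0 : ℝ} (hC : 0 < C) (hN0 : 0 < N0) {l : ℝ → ℝ}
    (hl : AntitoneOn l (Ici 0)) {ω : Ω} (hsize : ∀ p, 0 < X.size p ω)
    (hfin : LocFin (fullData X ω))
    (hsol : IsSol (pathLoss l) (shannon C N0) (fullData X ω) (fun p => X.death p ω)) (t : ℝ) :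
    X.config t ω = configOf (pathLoss l) (shannon C N0) (fullData X ω) t := by
  rw [config_eq_sum hsize, configOf]
  classical
  congr 1
  ext1 p
  refine if_congr ?_ rfl rfl
  unfold SpatialBD.Alive AliveAt
  refine and_congr_right fun hp => ?_
  have := hsol.eq_deaths (measurable_pathLoss hl) (isRate_shannon hC hN0) hfin hp
  dsimp only at this ⊢
  rw [this]

end Network

/-! ### An approximate Harris inequality -/

section Association

variable {E : Type*} [MeasurableSpace E]

lemma integrable_of_mem_Icc {A : Type*} [MeasurableSpace A] {μ : Measure A} [IsFiniteMeasure μ]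
    {f : A → ℝ} (hf : Measurable f) {a b : ℝ} (h : ∀ x, f x ∈ Icc a b) : Integrable f μ :=
  Integrable.of_mem_Icc a b hf.aemeasurable (Filter.Eventually.of_forall h)

/-- Two functions on a probability space that are minimal at the likely point `o` are almost
positively correlated. -/
lemma integral_mul_ge_of_min [MeasurableSingletonClass E] (μ : Measure E) [IsProbabilityMeasure μ]
    (o : E) {q : ℝ} (hq : μ.real {o}ᶜ ≤ q) {f g : E → ℝ} (hf : Measurable f) (hg : Measurable g)
    (hf01 : ∀ z, f z ∈ Icc (0 : ℝ) 1) (hg01 : ∀ z, g z ∈ Icc (0 : ℝ) 1)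
    (hfo : ∀ z, f o ≤ f z) (hgo : ∀ z, g o ≤ g z) :
    (∫ z, f z ∂μ) * (∫ z, g z ∂μ) - q ^ 2 ≤ ∫ z, f z * g z ∂μ := by
  have hfi := integrable_of_mem_Icc (μ := μ) hf hf01
  have hgi := integrable_of_mem_Icc (μ := μ) hg hg01
  have hfgi : Integrable (fun z => f z * g z) μ := integrable_of_mem_Icc (hf.mul hg) fun z =>
    ⟨mul_nonneg (hf01 z).1 (hg01 z).1, mul_le_one₀ (hf01 z).2 (hg01 z).1 (hg01 z).2⟩
  have hbound : ∀ h : E → ℝ, Measurable h → (∀ z, h z ∈ Icc (0 : ℝ) 1) → (∀ z, h o ≤ h z) →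
      0 ≤ (∫ z, h z ∂μ) - h o ∧ (∫ z, h z ∂μ) - h o ≤ q := by
    intro h hm h01 ho
    have hi := integrable_of_mem_Icc (μ := μ) hm h01
    have h1 : (∫ z, h z ∂μ) - h o = ∫ z, (h z - h o) ∂μ := by
      rw [integral_sub hi (integrable_const _)]; simp
    rw [h1]
    refine ⟨integral_nonneg fun z => sub_nonneg.2 (ho z), le_trans ?_ hq⟩
    rw [← integral_indicator_one (measurableSet_singleton o).compl]
    refine integral_mono (hi.sub (integrable_const _)) ((integrable_const (1 : ℝ)).indicator
      (measurableSet_singleton o).compl) fun z => ?_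
    by_cases hz : z = o
    · simp [hz]
    · have := (h01 z).2
      have := (h01 o).1
      simp only [indicator, mem_compl_iff, mem_singleton_iff, hz, not_false_eq_true, if_true,
        Pi.one_apply]
      linarith
  obtain ⟨hF0, hFq⟩ := hbound f hf hf01 hfo
  obtain ⟨hG0, hGq⟩ := hbound g hg hg01 hgo
  -- Centring at the minimum instead of the mean, the covariance is `𝔼[(f - f o)(g - g o)] - (𝔼 f -
  -- f o)(𝔼 g - g o)`. The first term is non-negative and both factors of the second lie in `[0,
  -- q]`.
  have h2 : 0 ≤ ∫ z, (f z - f o) * (g z - g o) ∂μ :=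
    integral_nonneg fun z => mul_nonneg (sub_nonneg.2 (hfo z)) (sub_nonneg.2 (hgo z))
  have h3 : ∫ z, (f z - f o) * (g z - g o) ∂μ =
      (∫ z, f z * g z ∂μ) - g o * (∫ z, f z ∂μ) - f o * (∫ z, g z ∂μ) + f o * g o := by
    have : ∀ z, (f z - f o) * (g z - g o) = f z * g z - g o * f z - f o * g z + f o * g o :=
      fun z => by ring
    simp only [this]
    have h5 : Integrable (fun z => f z * g z - g o * f z) μ := hfgi.sub (hfi.const_mul _)
    have h6 : Integrable (fun z => f z * g z - g o * f z - f o * g z) μ :=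
      h5.sub (hgi.const_mul _)
    rw [integral_add h6 (integrable_const _), integral_sub h5 (hgi.const_mul _),
      integral_sub hfgi (hfi.const_mul _), integral_const_mul, integral_const_mul]
    simp
  have h4 := mul_le_mul hFq hGq hG0 (hF0.trans hFq)
  nlinarith

/-- Approximate Harris inequality for independent slots that are likely to be empty. -/
theorem integral_mul_ge_pi [MeasurableSingletonClass E] (o : E) {q : ℝ} : ∀ (m : ℕ)
    (μ : Fin m → Measure E) [∀ k, IsProbabilityMeasure (μ k)], (∀ k, (μ k).real {o}ᶜ ≤ q) →
    ∀ f g : (Fin m → E) → ℝ, Measurable f → Measurable g →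
    (∀ z, f z ∈ Icc (0 : ℝ) 1) → (∀ z, g z ∈ Icc (0 : ℝ) 1) →
    (∀ z k, f (Function.update z k o) ≤ f z) → (∀ z k, g (Function.update z k o) ≤ g z) →
    (∫ z, f z ∂(Measure.pi μ)) * (∫ z, g z ∂(Measure.pi μ)) - m * q ^ 2 ≤
      ∫ z, f z * g z ∂(Measure.pi μ) := by
  intro m
  induction m with
  | zero =>
    intro μ _ _ f g _ _ _ _ _ _
    rw [Measure.pi_of_empty μ isEmptyElim, integral_dirac, integral_dirac, integral_dirac]
    simp
  | succ m ih =>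
    intro μ _ hq f g hf hg hf01 hg01 hfo hgo
    let μ' : Fin m → Measure E := fun k => μ k.succ
    have hmp : MeasurePreserving (MeasurableEquiv.piFinSuccAbove (fun _ => E) 0).symm
        ((μ 0).prod (Measure.pi μ')) (Measure.pi μ) := by
      have := (measurePreserving_piFinSuccAbove μ 0).symm
      simpa [μ', Fin.succAbove_zero] using this
    have hcons : ∀ p : E × (Fin m → E),
        (MeasurableEquiv.piFinSuccAbove (fun _ => E) 0).symm p = Fin.cons p.1 p.2 := by
      intro p
      simp [MeasurableEquiv.piFinSuccAbove]
      rfl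
    have hmeas : Measurable fun p : E × (Fin m → E) => (Fin.cons p.1 p.2 : Fin (m + 1) → E) := by
      have := hmp.measurable
      simpa only [hcons, funext hcons] using this
    have hint : ∀ h : (Fin (m + 1) → E) → ℝ, Measurable h → (∀ z, h z ∈ Icc (0 : ℝ) 1) →
        ∫ z, h z ∂(Measure.pi μ) = ∫ a, ∫ b, h (Fin.cons a b) ∂(Measure.pi μ') ∂(μ 0) := by
      intro h hm h01
      rw [← hmp.integral_comp']
      simp only [hcons]
      exact integral_prod _ (integrable_of_mem_Icc (hm.comp hmeas) fun p => h01 _)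
    have hsec : ∀ h : (Fin (m + 1) → E) → ℝ, Measurable h → (∀ z, h z ∈ Icc (0 : ℝ) 1) →
        Measurable (fun a => ∫ b, h (Fin.cons a b) ∂(Measure.pi μ')) ∧
        ∀ a, ∫ b, h (Fin.cons a b) ∂(Measure.pi μ') ∈ Icc (0 : ℝ) 1 := by
      intro h hm h01
      refine ⟨((hm.comp hmeas).stronglyMeasurable.integral_prod_right').measurable, fun a => ?_⟩
      have hma : Measurable fun b : Fin m → E => h (Fin.cons a b) :=
        (hm.comp hmeas).comp measurable_prodMk_left
      refine ⟨integral_nonneg fun b => (h01 _).1, ?_⟩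
      calc ∫ b, h (Fin.cons a b) ∂(Measure.pi μ') ≤ ∫ b, (1 : ℝ) ∂(Measure.pi μ') :=
            integral_mono (integrable_of_mem_Icc hma fun b => h01 _) (integrable_const _)
              fun b => (h01 _).2
        _ = 1 := by simp
    have hmono : ∀ h : (Fin (m + 1) → E) → ℝ, Measurable h → (∀ z, h z ∈ Icc (0 : ℝ) 1) →
        (∀ z k, h (Function.update z k o) ≤ h z) → ∀ a,
        ∫ b, h (Fin.cons o b) ∂(Measure.pi μ') ≤ ∫ b, h (Fin.cons a b) ∂(Measure.pi μ') := by
      intro h hm h01 ho a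
      have hma : ∀ a, Integrable (fun b : Fin m → E => h (Fin.cons a b)) (Measure.pi μ') :=
        fun a => integrable_of_mem_Icc ((hm.comp hmeas).comp measurable_prodMk_left) fun b => h01 _
      refine integral_mono (hma o) (hma a) fun b => ?_
      have := ho (Fin.cons a b) 0
      rwa [Fin.update_cons_zero] at this
    have hfg01 : ∀ z, f z * g z ∈ Icc (0 : ℝ) 1 := fun z =>
      ⟨mul_nonneg (hf01 z).1 (hg01 z).1, mul_le_one₀ (hf01 z).2 (hg01 z).1 (hg01 z).2⟩
    have hfg : Measurable fun z => f z * g z := hf.mul hg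
    have hF := hsec f hf hf01
    have hG := hsec g hg hg01
    have hFG := hsec _ hfg hfg01
    rw [hint f hf hf01, hint g hg hg01, hint _ hfg hfg01]
    -- The averages over the remaining slots are again minimal at `o` as functions of the first
    -- slot, which costs `q ^ 2`; the induction hypothesis on each section costs `m * q ^ 2`.
    have h1 := integral_mul_ge_of_min (μ 0) o (hq 0) hF.1 hG.1 hF.2 hG.2
      (hmono f hf hf01 hfo) (hmono g hg hg01 hgo)
    have h2 : ∀ a, (∫ b, f (Fin.cons a b) ∂(Measure.pi μ')) * (∫ b, g (Fin.cons a b)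
        ∂(Measure.pi μ')) - m * q ^ 2 ≤ ∫ b, f (Fin.cons a b) * g (Fin.cons a b)
        ∂(Measure.pi μ') := by
      intro a
      refine ih μ' (fun k => hq k.succ) _ _ ((hf.comp hmeas).comp measurable_prodMk_left)
        ((hg.comp hmeas).comp measurable_prodMk_left) (fun z => hf01 _) (fun z => hg01 _) ?_ ?_
      · intro z k
        have := hfo (Fin.cons a z) k.succ
        rwa [← Fin.cons_update] at this
      · intro z k
        have := hgo (Fin.cons a z) k.succ
        rwa [← Fin.cons_update] at this
    have h3 : Integrable (fun a => (∫ b, f (Fin.cons a b) ∂(Measure.pi μ')) *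
        (∫ b, g (Fin.cons a b) ∂(Measure.pi μ'))) (μ 0) :=
      integrable_of_mem_Icc (hF.1.mul hG.1) fun a => ⟨mul_nonneg (hF.2 a).1 (hG.2 a).1,
        mul_le_one₀ (hF.2 a).2 (hG.2 a).1 (hG.2 a).2⟩
    have h4 := integral_mono (h3.sub (integrable_const (m * q ^ 2)))
      (integrable_of_mem_Icc (μ := μ 0) hFG.1 hFG.2) h2
    simp only [Pi.sub_apply] at h4
    rw [integral_sub h3 (integrable_const _)] at h4
    simp only [integral_const, probReal_univ, smul_eq_mul, one_mul] at h4
    push_cast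
    linarith

/-- Resampling one coordinate leaves a product law unchanged. This gives a disintegration over slot
`k` in which the other slots still live on the full product space. -/
lemma measurePreserving_update_pi {m : ℕ} (μ : Fin m → Measure E)
    [∀ k, IsProbabilityMeasure (μ k)] (k : Fin m) :
    MeasurePreserving (fun p : (Fin m → E) × E => Function.update p.1 k p.2)
      ((Measure.pi μ).prod (μ k)) (Measure.pi μ) := by
  have hm : Measurable fun p : (Fin m → E) × E => Function.update p.1 k p.2 := by
    refine measurable_pi_lambda _ fun i => ?_
    by_cases h : i = k
    · subst h; simpa using measurable_snd
    · simpa [h, Function.comp_def] using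
        (measurable_pi_apply i).comp (measurable_fst (α := Fin m → E) (β := E))
  refine ⟨hm, (Measure.pi_eq fun s hs => ?_).symm⟩
  rw [Measure.map_apply hm (MeasurableSet.univ_pi hs)]
  have : (fun p : (Fin m → E) × E => Function.update p.1 k p.2) ⁻¹' (univ.pi s) =
      (univ.pi (Function.update s k univ)) ×ˢ s k := by
    ext p
    simp only [mem_preimage, mem_univ_pi, mem_prod]
    constructor
    · intro h
      refine ⟨fun i => ?_, by simpa using h k⟩
      by_cases hi : i = k
      · subst hi; simp
      · simpa [hi] using h i
    · rintro ⟨h1, h2⟩ i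
      by_cases hi : i = k
      · subst hi; simpa using h2
      · simpa [hi] using h1 i
  rw [this, Measure.prod_prod, Measure.pi_pi, ← Finset.prod_erase_mul _ _ (Finset.mem_univ k),
    ← Finset.prod_erase_mul _ (fun i => μ i (s i)) (Finset.mem_univ k)]
  simp only [Function.update_self, measure_univ, mul_one]
  congr 1
  refine Finset.prod_congr rfl fun i hi => ?_
  rw [Function.update_of_ne (Finset.ne_of_mem_erase hi)]

end Association

/-! ### Positive correlation of links in independent slots -/

section Slots

variable [AddCommGroup V] {w : V → ℝ≥0∞} {g : ℝ≥0∞ → ℝ≥0∞} {m : ℕ}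

open Classical in
/-- Indicator of the event that slot `k` carries a link alive at time `t`. -/
def aliveInd (w : V → ℝ≥0∞) (g : ℝ≥0∞ → ℝ≥0∞) (t : ℝ) (k : Fin m) (z : Fin m → V × ℝ × ℝ) : ℝ :=
  if Alive w g z k t then 1 else 0

open Classical in
/-- Number of links alive at time `t` with position in `y + B`. -/
def near (w : V → ℝ≥0∞) (g : ℝ≥0∞ → ℝ≥0∞) (t : ℝ) (B : Set V) (y : V)
    (z : Fin m → V × ℝ × ℝ) : ℝ :=
  ∑ j, if (z j).1 - y ∈ B then aliveInd w g t j z else 0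

open Classical in
/-- Number of links alive at time `t` with position in `x + B`, where `x` is the position of
slot `k`, which is not counted. -/
def nearOthers (w : V → ℝ≥0∞) (g : ℝ≥0∞ → ℝ≥0∞) (t : ℝ) (B : Set V) (k : Fin m)
    (z : Fin m → V × ℝ × ℝ) : ℝ :=
  ∑ j ∈ Finset.univ.erase k, if (z j).1 - (z k).1 ∈ B then aliveInd w g t j z else 0

/-- Number of links alive at time `t`. -/
def total (w : V → ℝ≥0∞) (g : ℝ≥0∞ → ℝ≥0∞) (t : ℝ) (z : Fin m → V × ℝ × ℝ) : ℝ :=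
  ∑ k, aliveInd w g t k z

/-- Number of ordered pairs of links alive at time `t` with relative position in `B`. -/
def pairCount (w : V → ℝ≥0∞) (g : ℝ≥0∞ → ℝ≥0∞) (t : ℝ) (B : Set V)
    (z : Fin m → V × ℝ × ℝ) : ℝ :=
  ∑ k, aliveInd w g t k z * nearOthers w g t B k z

open Classical in
/-- Translation of a slot that fixes the empty state `0`. -/
def shiftSlot (y : V) (e : V × ℝ × ℝ) : V × ℝ × ℝ := if e = 0 then 0 else (e.1 + y, e.2)

lemma aliveInd_mem (t : ℝ) (k : Fin m) (z : Fin m → V × ℝ × ℝ) :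
    aliveInd w g t k z ∈ Icc (0 : ℝ) 1 := by
  unfold aliveInd
  split_ifs <;> simp

lemma near_nonneg (t : ℝ) (B : Set V) (y : V) (z : Fin m → V × ℝ × ℝ) : 0 ≤ near w g t B y z := by
  refine Finset.sum_nonneg fun j _ => ?_
  split_ifs
  exacts [(aliveInd_mem t j z).1, le_rfl]

lemma nearOthers_nonneg (t : ℝ) (B : Set V) (k : Fin m) (z : Fin m → V × ℝ × ℝ) :
    0 ≤ nearOthers w g t B k z := by
  refine Finset.sum_nonneg fun j _ => ?_
  split_ifs
  exacts [(aliveInd_mem t j z).1, le_rfl]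

lemma near_le_total (t : ℝ) (B : Set V) (y : V) (z : Fin m → V × ℝ × ℝ) :
    near w g t B y z ≤ total w g t z := by
  refine Finset.sum_le_sum fun j _ => ?_
  split_ifs
  exacts [le_rfl, (aliveInd_mem t j z).1]

lemma total_nonneg (t : ℝ) (z : Fin m → V × ℝ × ℝ) : 0 ≤ total w g t z :=
  Finset.sum_nonneg fun j _ => (aliveInd_mem t j z).1

lemma total_le (t : ℝ) (z : Fin m → V × ℝ × ℝ) : total w g t z ≤ m := by
  refine (Finset.sum_le_sum fun j _ => (aliveInd_mem t j z).2).trans ?_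
  simp

lemma pairCount_nonneg (t : ℝ) (B : Set V) (z : Fin m → V × ℝ × ℝ) : 0 ≤ pairCount w g t B z :=
  Finset.sum_nonneg fun k _ => mul_nonneg (aliveInd_mem t k z).1 (nearOthers_nonneg t B k z)

lemma nearOthers_le (t : ℝ) (B : Set V) (k : Fin m) (z : Fin m → V × ℝ × ℝ) :
    nearOthers w g t B k z ≤ m := by
  unfold nearOthers
  refine (Finset.sum_le_sum (g := fun _ => (1 : ℝ)) fun j _ => ?_).trans ?_
  · split_ifs
    exacts [(aliveInd_mem t j z).2, zero_le_one]
  · simp only [Finset.sum_const, nsmul_eq_mul, mul_one]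
    exact_mod_cast (Finset.card_le_univ _).trans (by simp)

lemma ne_zero_of_size_pos {e : V × ℝ × ℝ} (h : 0 < e.2.2) : e ≠ 0 := by
  rintro rfl
  exact lt_irrefl _ h

lemma embeds_update_zero (z : Fin m → V × ℝ × ℝ) (k : Fin m) :
    Embeds id 0 (Function.update z k 0) z := by
  have hne : ∀ i, 0 < (Function.update z k 0 i).2.2 → i ≠ k := by
    rintro i hi rfl
    simp at hi
  refine ⟨injOn_id _, fun i hi => ?_, fun i hi => ?_, fun i hi => ?_⟩ <;> simp [hne i hi]

lemma aliveInd_eq_zero {t : ℝ} {k : Fin m} {z : Fin m → V × ℝ × ℝ} (h : z k = 0) :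
    aliveInd w g t k z = 0 :=
  if_neg fun hk => ne_zero_of_size_pos hk.size_pos h

variable [MeasurableSpace V] [MeasurableSub₂ V]

lemma aliveInd_le_of_embeds (hw : Measurable w) (hg : IsRate g) {z z' : Fin m → V × ℝ × ℝ} {y : V}
    (h : Embeds id y z z') (t : ℝ) (k : Fin m) : aliveInd w g t k z ≤ aliveInd w g t k z' := by
  unfold aliveInd
  split_ifs with h1 h2
  exacts [le_rfl, absurd (h.alive hw hg (locFin_fin z) h1) h2, zero_le_one, le_rfl]

lemma aliveInd_update_le (hw : Measurable w) (hg : IsRate g) (t : ℝ) (k i : Fin m)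
    (z : Fin m → V × ℝ × ℝ) :
    aliveInd w g t k (Function.update z i 0) ≤ aliveInd w g t k z :=
  aliveInd_le_of_embeds hw hg (embeds_update_zero z i) t k

/-- Slot `k` must be kept, because it defines the reference point around which the others are
counted. -/
lemma nearOthers_update_le (hw : Measurable w) (hg : IsRate g) (t : ℝ) (B : Set V) {k i : Fin m}
    (hik : i ≠ k) (z : Fin m → V × ℝ × ℝ) :
    nearOthers w g t B k (Function.update z i 0) ≤ nearOthers w g t B k z := by
  refine Finset.sum_le_sum fun j _ => ?_
  by_cases hj : j = i
  · subst hj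
    rw [aliveInd_eq_zero (Function.update_self _ _ _), ite_self]
    split_ifs
    exacts [(aliveInd_mem t j z).1, le_rfl]
  · rw [Function.update_of_ne hj, Function.update_of_ne hik.symm]
    split_ifs
    exacts [aliveInd_update_le hw hg t j i z, le_rfl]

/-- Putting a link into an empty slot only prolongs the lives of the others, so the count around its
position cannot drop. -/
lemma near_le_nearOthers (hw : Measurable w) (hg : IsRate g) (t : ℝ) (B : Set V) {k : Fin m}
    {z : Fin m → V × ℝ × ℝ} (hk : z k = 0) (c : V × ℝ × ℝ) :
    near w g t B c.1 z ≤ nearOthers w g t B k (Function.update z k c) := by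
  have hz : z = Function.update (Function.update z k c) k 0 := by
    rw [Function.update_idem, ← hk, Function.update_eq_self]
  unfold near nearOthers
  rw [← Finset.sum_erase_add _ _ (Finset.mem_univ k), aliveInd_eq_zero hk, ite_self, add_zero]
  refine Finset.sum_le_sum fun j hj => ?_
  have hjk := Finset.ne_of_mem_erase hj
  rw [Function.update_self, Function.update_of_ne hjk]
  split_ifs
  · conv_lhs => rw [hz]
    exact aliveInd_update_le hw hg t j k _
  · exact le_rfl

lemma measurable_aliveInd (hw : Measurable w) (hg : IsRate g) (t : ℝ) (k : Fin m) :
    Measurable (aliveInd w g t k) := by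
  classical
  exact Measurable.ite (measurableSet_alive hw hg k t) measurable_const measurable_const

lemma measurable_total (hw : Measurable w) (hg : IsRate g) (t : ℝ) :
    Measurable (total w g t : (Fin m → V × ℝ × ℝ) → ℝ) :=
  Finset.measurable_sum _ fun k _ => measurable_aliveInd hw hg t k

lemma measurable_near (hw : Measurable w) (hg : IsRate g) (t : ℝ) {B : Set V}
    (hB : MeasurableSet B) :
    Measurable fun p : V × (Fin m → V × ℝ × ℝ) => near w g t B p.1 p.2 := by
  classical
  refine Finset.measurable_sum _ fun j _ => Measurable.ite ?_
    ((measurable_aliveInd hw hg t j).comp measurable_snd) measurable_const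
  exact (((measurable_pi_apply j).comp measurable_snd).fst.sub measurable_fst) hB

lemma measurable_nearOthers (hw : Measurable w) (hg : IsRate g) (t : ℝ) {B : Set V}
    (hB : MeasurableSet B) (k : Fin m) :
    Measurable (nearOthers w g t B k : (Fin m → V × ℝ × ℝ) → ℝ) := by
  classical
  refine Finset.measurable_sum _ fun j _ => Measurable.ite ?_
    (measurable_aliveInd hw hg t j) measurable_const
  exact ((measurable_pi_apply j).fst.sub (measurable_pi_apply k).fst) hB

lemma measurable_pairCount (hw : Measurable w) (hg : IsRate g) (t : ℝ) {B : Set V}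
    (hB : MeasurableSet B) :
    Measurable (pairCount w g t B : (Fin m → V × ℝ × ℝ) → ℝ) :=
  Finset.measurable_sum _ fun k _ =>
    (measurable_aliveInd hw hg t k).mul (measurable_nearOthers hw hg t hB k)

variable [MeasurableSingletonClass V]

/-- Freeze slot `k` at a state `e`. Its survival and the number of its neighbours are both
increasing in the other slots, so the Harris inequality decouples them. The mean number of
neighbours is then bounded by its value without the link, namely `c`, up to `M * q` for the event
that the resampled slot `k` was occupied. -/
lemma integral_slot_ge (hw : Measurable w) (hg : IsRate g) (t : ℝ) {B : Set V}
    (hB : MeasurableSet B) (μ : Fin m → Measure (V × ℝ × ℝ)) [∀ k, IsProbabilityMeasure (μ k)]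
    {q : ℝ} (hq : ∀ k, (μ k).real {0}ᶜ ≤ q) {M c : ℝ} (hM : 0 < M)
    (hc : ∀ y, c ≤ ∫ z, min (near w g t B y z) M ∂(Measure.pi μ)) (k : Fin m) :
    (∫ z, aliveInd w g t k z ∂(Measure.pi μ)) * (c - M * q) - M * m * q ^ 3 ≤
      ∫ z, aliveInd w g t k z * min (nearOthers w g t B k z) M ∂(Measure.pi μ) := by
  set π := Measure.pi μ
  have hmp := measurePreserving_update_pi μ k
  have ha := measurable_aliveInd (m := m) hw hg t k
  have hh : Measurable fun z : Fin m → V × ℝ × ℝ => min (nearOthers w g t B k z) M :=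
    (measurable_nearOthers hw hg t hB k).min measurable_const
  have hh0 : ∀ z : Fin m → V × ℝ × ℝ, min (nearOthers w g t B k z) M ∈ Icc 0 M := fun z =>
    ⟨le_min (nearOthers_nonneg t B k z) hM.le, min_le_right _ _⟩
  have hah : Measurable fun z : Fin m → V × ℝ × ℝ =>
      aliveInd w g t k z * min (nearOthers w g t B k z) M := ha.mul hh
  have hah0 : ∀ z : Fin m → V × ℝ × ℝ,
      aliveInd w g t k z * min (nearOthers w g t B k z) M ∈ Icc 0 M := fun z =>
    ⟨mul_nonneg (aliveInd_mem t k z).1 (hh0 z).1, by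
      have := mul_le_mul (aliveInd_mem (w := w) (g := g) t k z).2 (hh0 z).2 (hh0 z).1 zero_le_one
      simpa using this⟩
  have hq0 : 0 ≤ q := measureReal_nonneg.trans (hq k)
  -- disintegration with respect to the slot `k`
  have hdis : ∀ (φ : (Fin m → V × ℝ × ℝ) → ℝ) (b : ℝ), Measurable φ → (∀ z, φ z ∈ Icc 0 b) →
      ∫ z, φ z ∂π = ∫ c, ∫ z, φ (Function.update z k c) ∂π ∂(μ k) ∧
      Integrable (fun c => ∫ z, φ (Function.update z k c) ∂π) (μ k) := by
    intro φ b hφ hφb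
    have hi : Integrable (fun p : (Fin m → V × ℝ × ℝ) × (V × ℝ × ℝ) =>
        φ (Function.update p.1 k p.2)) (π.prod (μ k)) :=
      integrable_of_mem_Icc (hφ.comp hmp.measurable) fun p => hφb _
    refine ⟨?_, hi.integral_prod_right⟩
    rw [← integral_prod_symm _ hi, ← integral_map hmp.aemeasurable hφ.aestronglyMeasurable,
      hmp.map_eq]
  have hupd : ∀ c : V × ℝ × ℝ, Measurable fun z : Fin m → V × ℝ × ℝ => Function.update z k c :=
    fun c => hmp.measurable.comp measurable_prodMk_right
  have hk : π.real {z | z k ≠ 0} ≤ q := by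
    have h1 := (measurePreserving_eval μ k).measureReal_preimage
      (measurableSet_singleton 0).compl.nullMeasurableSet
    exact (le_of_eq h1).trans (hq k)
  -- For `e = 0` both sides vanish, so the Harris error is paid only when the slot is occupied.
  -- Integrating the indicator turns `q ^ 2` into `q ^ 3`, which is what survives summation over `m`
  -- slots: `m ^ 2 * q ^ 3` tends to `0` for `q` of order `1 / m`, while `m ^ 2 * q ^ 2` would not.
  have hinner : ∀ e : V × ℝ × ℝ,
      (∫ z, aliveInd w g t k (Function.update z k e) ∂π) * (c - M * q) -
        M * m * q ^ 2 * ({0}ᶜ : Set (V × ℝ × ℝ)).indicator 1 e ≤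
      ∫ z, aliveInd w g t k (Function.update z k e) *
        min (nearOthers w g t B k (Function.update z k e)) M ∂π := by
    intro e
    by_cases he : e = 0
    · subst he
      have : ∀ z : Fin m → V × ℝ × ℝ, aliveInd w g t k (Function.update z k 0) = 0 := fun z =>
        aliveInd_eq_zero (Function.update_self _ _ _)
      simp [this]
    · have hcomm : ∀ (z : Fin m → V × ℝ × ℝ) (i : Fin m), i ≠ k →
          Function.update (Function.update z i 0) k e =
            Function.update (Function.update z k e) i 0 := fun z i hi =>
        Function.update_comm hi _ _ _
      have h1 := integral_mul_ge_pi 0 m μ hq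
        (fun z => aliveInd w g t k (Function.update z k e))
        (fun z => min (nearOthers w g t B k (Function.update z k e)) M / M)
        (ha.comp (hupd e)) ((hh.comp (hupd e)).div_const M) (fun z => aliveInd_mem _ _ _)
        (fun z => ⟨div_nonneg (hh0 _).1 hM.le, (div_le_one hM).2 (hh0 _).2⟩)
        (fun z i => by
          by_cases hi : i = k
          · subst hi; rw [Function.update_idem]
          · rw [hcomm z i hi]
            exact aliveInd_update_le hw hg t k i _)
        (fun z i => by
          by_cases hi : i = k
          · subst hi; rw [Function.update_idem]
          · rw [hcomm z i hi]
            gcongr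
            exact nearOthers_update_le hw hg t B hi _)
      simp only [← mul_div_assoc] at h1
      rw [integral_div, integral_div] at h1
      -- On `z k = 0` inserting `e` can only increase the count; elsewhere the truncated count is
      -- off by at most `M`.
      have h2 : c - M * q ≤ ∫ z, min (nearOthers w g t B k (Function.update z k e)) M ∂π := by
        have hmin : Measurable fun z : Fin m → V × ℝ × ℝ => min (near w g t B e.1 z) M :=
          ((measurable_near hw hg t hB).comp measurable_prodMk_left).min measurable_const
        have hset : MeasurableSet {z : Fin m → V × ℝ × ℝ | z k ≠ 0} :=
          (measurable_pi_apply k) (measurableSet_singleton 0).compl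
        have hi1 : Integrable (fun z => min (near w g t B e.1 z) M) π :=
          integrable_of_mem_Icc (b := M) hmin fun z =>
            ⟨le_min (near_nonneg t B _ z) hM.le, min_le_right _ _⟩
        have hi2 : Integrable ({z : Fin m → V × ℝ × ℝ | z k ≠ 0}.indicator fun _ => M) π :=
          (integrable_const M).indicator hset
        have h3 : ∫ z, (min (near w g t B e.1 z) M -
            {z : Fin m → V × ℝ × ℝ | z k ≠ 0}.indicator (fun _ => M) z) ∂π ≤
            ∫ z, min (nearOthers w g t B k (Function.update z k e)) M ∂π := by
          refine integral_mono (hi1.sub hi2)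
            (integrable_of_mem_Icc (hh.comp (hupd e)) fun z => hh0 _) fun z => ?_
          by_cases hz : z k = 0
          · simp only [indicator, mem_ofPred_eq, hz, ne_eq, not_true_eq_false, if_false, sub_zero]
            exact min_le_min_right _ (near_le_nearOthers hw hg t B hz e)
          · simp only [indicator, mem_ofPred_eq, hz, ne_eq, not_false_eq_true, if_true]
            have := min_le_right (near w g t B e.1 z) M
            have := (hh0 (Function.update z k e)).1
            linarith
        rw [integral_sub hi1 hi2, integral_indicator_const _ hset, smul_eq_mul] at h3
        have h4 := hc e.1
        nlinarith [mul_le_mul_of_nonneg_left hk hM.le]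
      have h5 : 0 ≤ ∫ z, aliveInd w g t k (Function.update z k e) ∂π :=
        integral_nonneg fun z => (aliveInd_mem _ _ _).1
      have h6 := mul_le_mul_of_nonneg_left h2 h5
      have h7 := mul_le_mul_of_nonneg_right h1 hM.le
      rw [sub_mul, div_mul_cancel₀ _ hM.ne', mul_div_assoc', div_mul_cancel₀ _ hM.ne'] at h7
      have h8 : ({0}ᶜ : Set (V × ℝ × ℝ)).indicator (1 : V × ℝ × ℝ → ℝ) e = 1 := by simp [he]
      rw [h8]
      linarith
  obtain ⟨hd1, hd2⟩ := hdis _ 1 ha (fun z => aliveInd_mem t k z)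
  obtain ⟨hd3, hd4⟩ := hdis _ M hah hah0
  rw [hd1, hd3]
  have hi3 : Integrable (fun e => M * m * q ^ 2 *
      ({0}ᶜ : Set (V × ℝ × ℝ)).indicator (1 : V × ℝ × ℝ → ℝ) e) (μ k) :=
    ((integrable_const (1 : ℝ)).indicator (measurableSet_singleton 0).compl).const_mul _
  have h9 := integral_mono ((hd2.mul_const _).sub hi3) hd4 hinner
  simp only [Pi.sub_apply] at h9
  rw [integral_sub (hd2.mul_const _) hi3, integral_mul_const, integral_const_mul,
    integral_indicator_one (measurableSet_singleton 0).compl] at h9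
  have h10 : M * m * q ^ 2 * (μ k).real {0}ᶜ ≤ M * m * q ^ 2 * q :=
    mul_le_mul_of_nonneg_left (hq k) (by positivity)
  nlinarith

end Slots

/-! ### Translation invariance and the mean number of close pairs -/

section Slots

variable [AddCommGroup V] {w : V → ℝ≥0∞} {g : ℝ≥0∞ → ℝ≥0∞} {m : ℕ}

lemma shiftSlot_of_size_pos {y : V} {e : V × ℝ × ℝ} (h : 0 < e.2.2) :
    shiftSlot y e = (e.1 + y, e.2) := if_neg (ne_zero_of_size_pos h)

lemma shiftSlot_size (y : V) (e : V × ℝ × ℝ) : (shiftSlot y e).2.2 = e.2.2 := by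
  unfold shiftSlot
  split_ifs with h <;> simp [h]

lemma measurable_shiftSlot [MeasurableSpace V] [MeasurableSingletonClass V] [MeasurableAdd V]
    (y : V) : Measurable (shiftSlot y : V × ℝ × ℝ → V × ℝ × ℝ) := by
  classical
  exact Measurable.ite (measurableSet_singleton 0) measurable_const
    ((measurable_fst.add_const y).prodMk measurable_snd)

variable [MeasurableSpace V] [MeasurableSub₂ V]

/-- The shift by `y` is an embedding, and so is its inverse. -/
lemma alive_shiftSlot (hw : Measurable w) (hg : IsRate g) (t : ℝ) (y : V) (j : Fin m)
    (z : Fin m → V × ℝ × ℝ) :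
    Alive w g (fun k => shiftSlot y (z k)) j t ↔ Alive w g z j t := by
  have hsz : ∀ i, 0 < (shiftSlot y (z i)).2.2 → shiftSlot y (z i) = ((z i).1 + y, (z i).2) :=
    fun i hi => shiftSlot_of_size_pos (by rwa [shiftSlot_size] at hi)
  constructor
  · refine Embeds.alive hw hg (locFin_fin _) (e := id) (y := -y)
      ⟨injOn_id _, fun i hi => ?_, fun i hi => ?_, fun i hi => ?_⟩
    · simp [hsz i hi]
    · simp [hsz i hi]
    · simp [hsz i hi]
  · refine Embeds.alive hw hg (locFin_fin _) (e := id) (y := y)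
      ⟨injOn_id _, fun i hi => ?_, fun i hi => ?_, fun i hi => ?_⟩ <;>
    simp [shiftSlot_of_size_pos hi]

lemma near_shiftSlot (hw : Measurable w) (hg : IsRate g) (t : ℝ) (B : Set V) (y : V)
    (z : Fin m → V × ℝ × ℝ) :
    near w g t B y (fun k => shiftSlot y (z k)) = near w g t B 0 z := by
  classical
  refine Finset.sum_congr rfl fun j _ => ?_
  have h1 : aliveInd w g t j (fun k => shiftSlot y (z k)) = aliveInd w g t j z :=
    if_congr (alive_shiftSlot hw hg t y j z) rfl rfl
  rw [h1]
  by_cases hj : Alive w g z j t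
  · dsimp only
    simp only [shiftSlot_of_size_pos hj.size_pos, add_sub_cancel_right, sub_zero]
  · have : aliveInd w g t j z = 0 := if_neg hj
    simp [this]

variable [MeasurableSingletonClass V] [MeasurableAdd V]

lemma integral_near_eq (hw : Measurable w) (hg : IsRate g) (t : ℝ) {B : Set V}
    (hB : MeasurableSet B) (μ : Fin m → Measure (V × ℝ × ℝ)) [∀ k, IsProbabilityMeasure (μ k)]
    (hshift : ∀ k y, (μ k).map (shiftSlot y) = μ k) (M : ℝ) (y : V) :
    ∫ z, min (near w g t B y z) M ∂(Measure.pi μ) =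
      ∫ z, min (near w g t B 0 z) M ∂(Measure.pi μ) := by
  have hmp : MeasurePreserving (fun z : Fin m → V × ℝ × ℝ => fun k => shiftSlot y (z k))
      (Measure.pi μ) (Measure.pi μ) :=
    measurePreserving_pi μ μ fun k => ⟨measurable_shiftSlot y, hshift k y⟩
  have hm : Measurable fun z : Fin m → V × ℝ × ℝ => min (near w g t B y z) M :=
    ((measurable_near hw hg t hB).comp measurable_prodMk_left).min measurable_const
  conv_lhs => rw [← hmp.map_eq]
  rw [integral_map hmp.aemeasurable hm.aestronglyMeasurable]
  simp only [near_shiftSlot hw hg]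

/-- Average over the centre `y`: each alive link lies in `y + B` for a set of centres of volume `b`,
and by translation invariance every centre contributes the same mean. When the total is at most `M`
the truncation has no effect. -/
lemma integral_near_ge (hw : Measurable w) (hg : IsRate g) (t : ℝ) {B : Set V}
    (hB : MeasurableSet B) (μ : Fin m → Measure (V × ℝ × ℝ)) [∀ k, IsProbabilityMeasure (μ k)]
    (hshift : ∀ k y, (μ k).map (shiftSlot y) = μ k) {M : ℝ} (hM : 0 < M)
    (vol : Measure V) [IsFiniteMeasure vol] {b : ℝ} (hb : ∀ x, vol.real {y | x - y ∈ B} = b) :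
    b * ∫ z, {z | total w g t z ≤ M}.indicator (total w g t) z ∂(Measure.pi μ) ≤
      vol.real univ * ∫ z, min (near w g t B 0 z) M ∂(Measure.pi μ) := by
  have hm : Measurable fun p : V × (Fin m → V × ℝ × ℝ) => min (near w g t B p.1 p.2) M :=
    (measurable_near hw hg t hB).min measurable_const
  have h0 : ∀ p : V × (Fin m → V × ℝ × ℝ), min (near w g t B p.1 p.2) M ∈ Icc 0 M := fun p =>
    ⟨le_min (near_nonneg _ _ _ _) hM.le, min_le_right _ _⟩
  have hi : Integrable (fun p : V × (Fin m → V × ℝ × ℝ) => min (near w g t B p.1 p.2) M)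
      (vol.prod (Measure.pi μ)) := integrable_of_mem_Icc hm h0
  have h1 : vol.real univ * ∫ z, min (near w g t B 0 z) M ∂(Measure.pi μ) =
      ∫ z, ∫ y, min (near w g t B y z) M ∂vol ∂(Measure.pi μ) := by
    rw [← integral_prod_symm _ hi, integral_prod _ hi]
    simp only [integral_near_eq hw hg t hB μ hshift M]
    simp
  have hset : MeasurableSet {z : Fin m → V × ℝ × ℝ | total w g t z ≤ M} :=
    measurableSet_le (measurable_total hw hg t) measurable_const
  have hti : Integrable (total w g t) (Measure.pi μ) :=
    integrable_of_mem_Icc (measurable_total hw hg t) fun z => ⟨total_nonneg t z, total_le t z⟩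
  rw [h1, ← integral_const_mul]
  refine integral_mono ((hti.indicator hset).const_mul b) hi.integral_prod_right fun z => ?_
  by_cases hz : total w g t z ≤ M
  · have hmin : ∀ y, min (near w g t B y z) M = near w g t B y z := fun y =>
      min_eq_left ((near_le_total t B y z).trans hz)
    have hBj : ∀ j, MeasurableSet {y | (z j).1 - y ∈ B} := fun j =>
      (measurable_id.const_sub (z j).1) hB
    have hint : ∫ y, near w g t B y z ∂vol = b * total w g t z := by
      classical
      have h2 : ∀ j y, (if (z j).1 - y ∈ B then aliveInd w g t j z else 0) =
          {y | (z j).1 - y ∈ B}.indicator (fun _ => aliveInd w g t j z) y := fun j y => rfl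
      unfold near total
      simp only [h2]
      rw [integral_finsetSum _ fun j _ => (integrable_const _).indicator (hBj j), Finset.mul_sum]
      refine Finset.sum_congr rfl fun j _ => ?_
      rw [integral_indicator_const _ (hBj j), hb, smul_eq_mul]
    simp only [hmin, hint, indicator, mem_ofPred_eq, hz, if_true]
    exact le_rfl
  · simp only [indicator, mem_ofPred_eq, hz, if_false, mul_zero]
    exact integral_nonneg fun y => (h0 (y, z)).1

/-- The mean number of close pairs in the slot model. -/
theorem integral_pairCount_ge (hw : Measurable w) (hg : IsRate g) (t : ℝ) {B : Set V}
    (hB : MeasurableSet B) (μ : Fin m → Measure (V × ℝ × ℝ)) [∀ k, IsProbabilityMeasure (μ k)]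
    (hshift : ∀ k y, (μ k).map (shiftSlot y) = μ k) {q : ℝ} (hq : ∀ k, (μ k).real {0}ᶜ ≤ q)
    {M : ℝ} (hM : 0 < M) (vol : Measure V) [IsFiniteMeasure vol] (hvol : 0 < vol.real univ)
    {b : ℝ} (hb : ∀ x, vol.real {y | x - y ∈ B} = b) :
    (∫ z, total w g t z ∂(Measure.pi μ)) * (b / vol.real univ *
      (∫ z, {z | total w g t z ≤ M}.indicator (total w g t) z ∂(Measure.pi μ)) - M * q) -
        M * m ^ 2 * q ^ 3 ≤ ∫ z, pairCount w g t B z ∂(Measure.pi μ) := by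
  set c := b / vol.real univ *
      (∫ z, {z | total w g t z ≤ M}.indicator (total w g t) z ∂(Measure.pi μ)) with hc
  have hc' : ∀ y, c ≤ ∫ z, min (near w g t B y z) M ∂(Measure.pi μ) := fun y => by
    rw [integral_near_eq hw hg t hB μ hshift, hc, div_mul_eq_mul_div, div_le_iff₀ hvol, mul_comm _
      (vol.real univ)]
    exact integral_near_ge hw hg t hB μ hshift hM vol hb
  have hai : ∀ k, Integrable (aliveInd (m := m) w g t k) (Measure.pi μ) := fun k =>
    integrable_of_mem_Icc (measurable_aliveInd hw hg t k) (aliveInd_mem t k)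
  have hpm : ∀ k, Measurable fun z : Fin m → V × ℝ × ℝ =>
      aliveInd w g t k z * nearOthers w g t B k z := fun k =>
    (measurable_aliveInd hw hg t k).mul (measurable_nearOthers hw hg t hB k)
  have hpi : ∀ k, Integrable (fun z => aliveInd w g t k z * nearOthers w g t B k z)
      (Measure.pi μ) := fun k => integrable_of_mem_Icc (b := m) (hpm k) fun z =>
    ⟨mul_nonneg (aliveInd_mem t k z).1 (nearOthers_nonneg t B k z), by
      have := mul_le_mul (aliveInd_mem (w := w) (g := g) t k z).2
        (nearOthers_le (w := w) (g := g) t B k z) (nearOthers_nonneg t B k z) zero_le_one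
      simpa using this⟩
  have hmi : ∀ k, Integrable (fun z => aliveInd w g t k z * min (nearOthers w g t B k z) M)
      (Measure.pi μ) := fun k => (hpi k).mono ((measurable_aliveInd hw hg t k).mul
        ((measurable_nearOthers hw hg t hB k).min measurable_const)).aestronglyMeasurable
      (Filter.Eventually.of_forall fun z => by
        have h1 := (aliveInd_mem (w := w) (g := g) t k z).1
        have h2 := nearOthers_nonneg (w := w) (g := g) t B k z
        rw [Real.norm_of_nonneg (mul_nonneg h1 (le_min h2 hM.le)),
          Real.norm_of_nonneg (mul_nonneg h1 h2)]
        exact mul_le_mul_of_nonneg_left (min_le_left _ _) h1)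
  unfold pairCount total
  rw [integral_finsetSum _ fun k _ => hai k, integral_finsetSum _ fun k _ => hpi k,
    Finset.sum_mul]
  have hsum : ∑ k : Fin m, ((∫ z, aliveInd w g t k z ∂(Measure.pi μ)) * (c - M * q) -
      M * m * q ^ 3) ≤
      ∑ k : Fin m, ∫ z, aliveInd w g t k z * nearOthers w g t B k z ∂(Measure.pi μ) :=
    Finset.sum_le_sum fun k _ => (integral_slot_ge hw hg t hB μ hq hM hc' k).trans
      (integral_mono (hmi k) (hpi k) fun z =>
        mul_le_mul_of_nonneg_left (min_le_left _ _) (aliveInd_mem t k z).1)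
  rw [Finset.sum_sub_distrib] at hsum
  simp only [Finset.sum_const, Finset.card_univ, Fintype.card_fin, nsmul_eq_mul] at hsum
  linarith

end Slots

/-! ### Moments and independence of Poisson counts -/

section Poisson

lemma lintegral_poissonMeasure (r : ℝ≥0) (f : ℕ → ℝ≥0∞) :
    ∫⁻ n, f n ∂(poissonMeasure r) =
      ∑' n : ℕ, ENNReal.ofReal (Real.exp (-r) * r ^ n / n.factorial) * f n := by
  rw [poissonMeasure, lintegral_sum_measure]
  refine tsum_congr fun n => ?_
  rw [lintegral_smul_measure, lintegral_dirac, smul_eq_mul]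

/-- The terms with `n < k` vanish; after shifting the index by `k`, a factor `r ^ k` comes out of
the total mass. -/
lemma lintegral_descFactorial_poissonMeasure (r : ℝ≥0) (k : ℕ) :
    ∫⁻ n, (n.descFactorial k : ℝ≥0∞) ∂(poissonMeasure r) = (r : ℝ≥0∞) ^ k := by
  have h1 : ∫⁻ _n, (1 : ℝ≥0∞) ∂(poissonMeasure r) = 1 := by simp
  rw [lintegral_poissonMeasure] at h1 ⊢
  rw [← (add_left_injective k).tsum_eq]
  · rw [← mul_one ((r : ℝ≥0∞) ^ k), ← h1, ← ENNReal.tsum_mul_left]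
    refine tsum_congr fun n => ?_
    have h2 : ((r : ℝ≥0∞) ^ k) = ENNReal.ofReal ((r : ℝ) ^ k) := by
      rw [ENNReal.ofReal_pow r.coe_nonneg, ENNReal.ofReal_coe_nnreal]
    have h3 : (((n + k).descFactorial k : ℕ) : ℝ≥0∞) =
        ENNReal.ofReal ((n + k).descFactorial k : ℕ) := by simp
    rw [h2, h3, mul_one, ← ENNReal.ofReal_mul (by positivity), ← ENNReal.ofReal_mul (by positivity)]
    congr 1
    have h4 := Nat.factorial_mul_descFactorial (Nat.le_add_left k n)
    rw [Nat.add_sub_cancel] at h4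
    have h5 : ((n + k).factorial : ℝ) = n.factorial * (n + k).descFactorial k := by
      exact_mod_cast h4.symm
    have h6 : (n.factorial : ℝ) ≠ 0 := by positivity
    have h7 : ((n + k).descFactorial k : ℝ) ≠ 0 := by
      have : 0 < (n + k).descFactorial k := Nat.descFactorial_pos.2 (Nat.le_add_left k n)
      positivity
    rw [h5, pow_add]
    field_simp
  · intro n hn
    by_cases h : k ≤ n
    · exact ⟨n - k, Nat.sub_add_cancel h⟩
    · exact absurd (by simp [Nat.descFactorial_of_lt (not_le.1 h)]) hn

variable {E Ω : Type*} [MeasurableSpace E] [MeasurableSpace Ω] {ν : Measure E} {Ψ : Ω → Measure E}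
  {P : Measure Ω}

lemma measurable_eval (h : IsPoissonPointProcess ν Ψ P) {B : Set E} (hB : MeasurableSet B) :
    Measurable fun ω => Ψ ω B := (Measure.measurable_coe hB).comp h.measurable

lemma measure_eval_mem (h : IsPoissonPointProcess ν Ψ P) {B : Set E} (hB : MeasurableSet B)
    (hν : ν B ≠ ∞) {S : Set ℝ≥0∞} (hS : MeasurableSet S) :
    P {ω | Ψ ω B ∈ S} = poissonMeasure (ν B).toNNReal {n : ℕ | (n : ℝ≥0∞) ∈ S} := by
  have h1 := (h.law B hB hν).measure_eq (p := fun x => x ∈ S) hS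
  rw [h1]
  exact Measure.map_apply measurable_from_top hS

lemma lintegral_eval (h : IsPoissonPointProcess ν Ψ P) {B : Set E} (hB : MeasurableSet B)
    (hν : ν B ≠ ∞) {f : ℝ≥0∞ → ℝ≥0∞} (hf : Measurable f) :
    ∫⁻ ω, f (Ψ ω B) ∂P = ∫⁻ n : ℕ, f n ∂(poissonMeasure (ν B).toNNReal) := by
  rw [(h.law B hB hν).lintegral_comp hf.aemeasurable, lintegral_map hf measurable_from_top]

lemma lintegral_count (h : IsPoissonPointProcess ν Ψ P) {B : Set E} (hB : MeasurableSet B)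
    (hν : ν B ≠ ∞) : ∫⁻ ω, Ψ ω B ∂P = ν B := by
  have := lintegral_descFactorial_poissonMeasure (ν B).toNNReal 1
  simp only [Nat.descFactorial_one, pow_one, ENNReal.coe_toNNReal hν] at this
  rw [← this]
  exact lintegral_eval h hB hν measurable_id

lemma lintegral_factorial_count (h : IsPoissonPointProcess ν Ψ P) {B : Set E}
    (hB : MeasurableSet B) (hν : ν B ≠ ∞) :
    ∫⁻ ω, Ψ ω B * (Ψ ω B - 1) ∂P = ν B ^ 2 := by
  have := lintegral_descFactorial_poissonMeasure (ν B).toNNReal 2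
  rw [ENNReal.coe_toNNReal hν] at this
  rw [← this, lintegral_eval h hB hν (f := fun x => x * (x - 1))
    (measurable_id.mul (measurable_id.sub_const 1))]
  refine lintegral_congr fun n => ?_
  rw [Nat.descFactorial_succ, Nat.descFactorial_one, mul_comm]
  push_cast
  rfl

lemma ae_eval_mem_range (h : IsPoissonPointProcess ν Ψ P) {B : Set E} (hB : MeasurableSet B)
    (hν : ν B ≠ ∞) : ∀ᵐ ω ∂P, ∃ n : ℕ, Ψ ω B = n := by
  have hS : MeasurableSet (range fun n : ℕ => (n : ℝ≥0∞))ᶜ := (countable_range _).measurableSet.compl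
  have h1 := measure_eval_mem h hB hν hS
  have h2 : {n : ℕ | (n : ℝ≥0∞) ∈ (range fun n : ℕ => (n : ℝ≥0∞))ᶜ} = ∅ := by
    ext n; simp
  rw [h2, measure_empty] at h1
  filter_upwards [measure_eq_zero_iff_ae_notMem.1 h1] with ω hω
  have : Ψ ω B ∈ range fun n : ℕ => (n : ℝ≥0∞) := by simpa using hω
  obtain ⟨n, hn⟩ := this
  exact ⟨n, hn.symm⟩

lemma measure_ne_zero_le (h : IsPoissonPointProcess ν Ψ P) {B : Set E} (hB : MeasurableSet B)
    (hν : ν B ≠ ∞) : P {ω | Ψ ω B ≠ 0} ≤ ν B := by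
  have h1 := measure_eval_mem h hB hν (S := {0}ᶜ) (measurableSet_singleton 0).compl
  have h3 := lintegral_descFactorial_poissonMeasure (ν B).toNNReal 1
  rw [pow_one, ENNReal.coe_toNNReal hν] at h3
  refine (le_of_eq h1).trans (le_trans ?_ h3.le)
  rw [← lintegral_indicator_one MeasurableSet.of_discrete]
  refine lintegral_mono fun n => ?_
  by_cases hn : n = 0
  · simp [hn]
  · have : (1 : ℝ≥0∞) ≤ n := by exact_mod_cast Nat.one_le_iff_ne_zero.2 hn
    simpa [indicator, hn] using this

/-- The indicator of `1 < n` is dominated by `n (n - 1)`, whose Poisson mean is the square of the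
parameter. -/
lemma measure_one_lt_le (h : IsPoissonPointProcess ν Ψ P) {B : Set E} (hB : MeasurableSet B)
    (hν : ν B ≠ ∞) : P {ω | 1 < Ψ ω B} ≤ ν B ^ 2 := by
  have h1 := measure_eval_mem h hB hν (S := Ioi 1) measurableSet_Ioi
  have h3 := lintegral_descFactorial_poissonMeasure (ν B).toNNReal 2
  rw [ENNReal.coe_toNNReal hν] at h3
  refine (le_of_eq h1).trans (le_trans ?_ h3.le)
  rw [← lintegral_indicator_one MeasurableSet.of_discrete]
  refine lintegral_mono fun n => ?_
  by_cases hn : 1 < n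
  · have : (1 : ℝ≥0∞) ≤ n.descFactorial 2 := by
      exact_mod_cast Nat.one_le_iff_ne_zero.2 (Nat.descFactorial_pos.2 hn).ne'
    simpa [indicator, hn] using this
  · have : ¬ (1 : ℝ≥0∞) < n := by exact_mod_cast hn
    simp [indicator, hn]

lemma measure_eval_eq_of_eq (h : IsPoissonPointProcess ν Ψ P) {B B' : Set E}
    (hB : MeasurableSet B) (hB' : MeasurableSet B') (hν : ν B ≠ ∞) (heq : ν B = ν B')
    {S : Set ℝ≥0∞} (hS : MeasurableSet S) : P {ω | Ψ ω B ∈ S} = P {ω | Ψ ω B' ∈ S} := by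
  rw [measure_eval_mem h hB hν hS, measure_eval_mem h hB' (heq ▸ hν) hS, heq]

lemma iIndepFun_eval (h : IsPoissonPointProcess ν Ψ P) {κ : Type*} [Fintype κ] {B : κ → Set E}
    (hB : ∀ k, MeasurableSet (B k)) (hd : Pairwise fun i j => Disjoint (B i) (B j)) :
    iIndepFun (fun k ω => Ψ ω (B k)) P := by
  have e := Fintype.equivFin κ
  have h1 := h.indep _ (fun i => B (e.symm i)) (fun i => hB _) fun i j hij =>
    hd (e.symm.injective.ne hij)
  have h2 := h1.precomp e.injective
  simpa [Function.comp_def] using h2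

lemma indepFun_eval (h : IsPoissonPointProcess ν Ψ P) {B B' : Set E} (hB : MeasurableSet B)
    (hB' : MeasurableSet B') (hd : Disjoint B B') :
    IndepFun (fun ω => Ψ ω B) (fun ω => Ψ ω B') P := by
  have h1 := iIndepFun_eval h (κ := Bool) (B := fun b => cond b B B')
    (fun b => by cases b <;> assumption) (fun i j hij => by
      cases i <;> cases j <;> simp_all [disjoint_comm])
  exact h1.indepFun (i := true) (j := false) (by simp)

end Poisson

/-! ### Regrouping of independent families -/

section SigmaAlgebras

lemma comap_comp_le_iSup {Ω κ ι₁ : Type*} (f : κ → Ω → ℝ) (e : ι₁ → κ) :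
    MeasurableSpace.comap (fun ω i => f (e i) ω) MeasurableSpace.pi ≤
      ⨆ k ∈ range e, MeasurableSpace.comap (f k) inferInstance := by
  rw [MeasurableSpace.pi, MeasurableSpace.comap_iSup]
  refine iSup_le fun i => ?_
  rw [MeasurableSpace.comap_comp]
  exact le_iSup₂_of_le (e i) (mem_range_self i) le_rfl

lemma indepFun_comp_of_disjoint {Ω κ : Type*} [MeasurableSpace Ω] {P : Measure Ω}
    {f : κ → Ω → ℝ} (hf : ∀ k, Measurable (f k))
    (h : iIndepFun f P) {ι₁ ι₂ : Type*} (e₁ : ι₁ → κ) (e₂ : ι₂ → κ)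
    (hd : Disjoint (range e₁) (range e₂)) :
    IndepFun (fun ω i => f (e₁ i) ω) (fun ω i => f (e₂ i) ω) P := by
  have h1 := indep_iSup_of_disjoint (fun k => (hf k).comap_le) h hd
  exact indep_of_indep_of_le_left (indep_of_indep_of_le_right h1 (comap_comp_le_iSup f e₂))
    (comap_comp_le_iSup f e₁)

end SigmaAlgebras

section Independence

variable {Ω α β γ δ : Type*} [MeasurableSpace Ω] [MeasurableSpace α] [MeasurableSpace β]
  [MeasurableSpace γ] [MeasurableSpace δ] {P : Measure Ω} [IsProbabilityMeasure P]
  {X : Ω → α} {Y : Ω → β} {W : Ω → γ} {U : Ω → δ}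

lemma indepFun_prodMk_of_indepFun (hX : Measurable X) (hY : Measurable Y) (hW : Measurable W)
    (h1 : IndepFun X (fun ω => (Y ω, W ω)) P) (h2 : IndepFun Y W P) :
    IndepFun (fun ω => (X ω, Y ω)) W P := by
  have hXY : IndepFun X Y P := h1.comp measurable_id measurable_fst
  have := Measure.isProbabilityMeasure_map (μ := P) hX.aemeasurable
  have := Measure.isProbabilityMeasure_map (μ := P) hY.aemeasurable
  have := Measure.isProbabilityMeasure_map (μ := P) hW.aemeasurable
  rw [indepFun_iff_map_prod_eq_prod_map_map hX.aemeasurable (hY.prodMk hW).aemeasurable,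
    (indepFun_iff_map_prod_eq_prod_map_map hY.aemeasurable hW.aemeasurable).1 h2] at h1
  rw [indepFun_iff_map_prod_eq_prod_map_map (hX.prodMk hY).aemeasurable hW.aemeasurable,
    (indepFun_iff_map_prod_eq_prod_map_map hX.aemeasurable hY.aemeasurable).1 hXY]
  have h3 := congrArg (Measure.map MeasurableEquiv.prodAssoc.symm) h1
  rw [← Measure.prodAssoc_prod, MeasurableEquiv.map_symm_map,
    Measure.map_map MeasurableEquiv.prodAssoc.symm.measurable (hX.prodMk (hY.prodMk hW))] at h3
  exact h3

/-- The chain of hypotheses makes the four blocks independent, so they may be paired in any way.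
Used with the positions `X` and sizes `Y` of the initial links, and the positions and times `W` and
sizes `U` of the arriving ones. -/
lemma indepFun_prodMk_prodMk_of_indepFun (hX : Measurable X) (hY : Measurable Y)
    (hW : Measurable W) (hU : Measurable U) (h1 : IndepFun X (fun ω => (W ω, Y ω, U ω)) P)
    (h2 : IndepFun W (fun ω => (Y ω, U ω)) P) (h3 : IndepFun Y U P) :
    IndepFun (fun ω => (X ω, Y ω)) (fun ω => (W ω, U ω)) P := by
  have h4 : IndepFun W (fun ω => (U ω, Y ω)) P := h2.comp measurable_id measurable_swap
  have h5 := (indepFun_prodMk_of_indepFun hW hU hY h4 h3.symm).symm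
  refine indepFun_prodMk_of_indepFun hX hY (hW.prodMk hU) ?_ h5
  exact h1.comp (φ := id) (ψ := fun p : γ × β × δ => (p.2.1, (p.1, p.2.2))) measurable_id
    (by fun_prop)

end Independence

/-! ### Discretisation of the arrivals into time slices -/

section SlotData

/-- The `k`-th time slice of length `h`. -/
def slice (h : ℝ) (k : ℕ) : Set ℝ := Ioc (k * h) ((k + 1) * h)

/-- `n` is the only label of the arrival sequence `a` in the `k`-th time slice. -/
def Uniq (h : ℝ) (k : ℕ) (a : ℕ → V × ℝ) (n : ℕ) : Prop :=
  (a n).2 ∈ slice h k ∧ ∀ n', (a n').2 ∈ slice h k → n' = n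

open Classical in
/-- The unique arrival of the `k`-th time slice, `0` if there is none. -/
def slotPoint [Zero V] (h : ℝ) (k : ℕ) (a : ℕ → V × ℝ) : V × ℝ :=
  if H : ∃ n, Uniq h k a n then a H.choose else 0

open Classical in
/-- The unique link arriving in the `k`-th time slice, `0` if there is none. -/
def slotOf [Zero V] (h : ℝ) (k : ℕ) (a : ℕ → V × ℝ) (s : ℕ → ℝ) : V × ℝ × ℝ :=
  if H : ∃ n, Uniq h k a n then ((a H.choose).1, (a H.choose).2, s H.choose) else 0

lemma pairwise_disjoint_slice {h : ℝ} (hh : 0 < h) :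
    Pairwise fun i j => Disjoint (slice h i) (slice h j) := by
  intro i j hij
  refine Set.disjoint_left.2 fun t hi hj => hij ?_
  have h1 : (i : ℝ) < j + 1 := by
    have := hi.1.trans_le hj.2
    exact lt_of_mul_lt_mul_right this hh.le
  have h2 : (j : ℝ) < i + 1 := by
    have := hj.1.trans_le hi.2
    exact lt_of_mul_lt_mul_right this hh.le
  have h3 : i < j + 1 := by exact_mod_cast h1
  have h4 : j < i + 1 := by exact_mod_cast h2
  omega

lemma pos_of_mem_slice {h : ℝ} (hh : 0 < h) {k : ℕ} {t : ℝ} (ht : t ∈ slice h k) : 0 < t :=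
  lt_of_le_of_lt (by positivity) ht.1

lemma exists_mem_slice {h : ℝ} (hh : 0 < h) {m : ℕ} {t : ℝ} (ht : 0 < t) (htm : t ≤ m * h) :
    ∃ k < m, t ∈ slice h k := by
  have h1 : 0 < t / h := div_pos ht hh
  have h2 : 0 < ⌈t / h⌉₊ := Nat.ceil_pos.2 h1
  have h3 : ⌈t / h⌉₊ ≤ m := Nat.ceil_le.2 ((div_le_iff₀ hh).2 htm)
  refine ⟨⌈t / h⌉₊ - 1, by omega, ?_, ?_⟩
  · have h4 : ⌈t / h⌉₊ - 1 < ⌈t / h⌉₊ := by omega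
    exact (lt_div_iff₀ hh).1 (Nat.lt_ceil.1 h4)
  · have h5 : ((⌈t / h⌉₊ - 1 : ℕ) : ℝ) + 1 = ⌈t / h⌉₊ := by
      have : ⌈t / h⌉₊ - 1 + 1 = ⌈t / h⌉₊ := by omega
      exact_mod_cast this
    rw [h5]
    exact (div_le_iff₀ hh).1 (Nat.le_ceil _)

lemma Uniq.eq {h : ℝ} {k : ℕ} {a : ℕ → V × ℝ} {n n' : ℕ} (hn : Uniq h k a n)
    (hn' : Uniq h k a n') : n = n' := hn'.2 n hn.1

lemma Uniq.slotPoint_eq [Zero V] {h : ℝ} {k : ℕ} {a : ℕ → V × ℝ} {n : ℕ} (hn : Uniq h k a n) :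
    slotPoint h k a = a n := by
  have H : ∃ n, Uniq h k a n := ⟨n, hn⟩
  rw [slotPoint, dif_pos H, hn.eq H.choose_spec]

lemma Uniq.slotOf_eq [Zero V] {h : ℝ} {k : ℕ} {a : ℕ → V × ℝ} {n : ℕ} (hn : Uniq h k a n)
    (s : ℕ → ℝ) : slotOf h k a s = ((a n).1, (a n).2, s n) := by
  have H : ∃ n, Uniq h k a n := ⟨n, hn⟩
  rw [slotOf, dif_pos H, hn.eq H.choose_spec]

lemma slotOf_eq_zero [Zero V] {h : ℝ} {k : ℕ} {a : ℕ → V × ℝ} (H : ¬ ∃ n, Uniq h k a n)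
    (s : ℕ → ℝ) : slotOf h k a s = 0 := dif_neg H

lemma slotPoint_eq_zero [Zero V] {h : ℝ} {k : ℕ} {a : ℕ → V × ℝ} (H : ¬ ∃ n, Uniq h k a n) :
    slotPoint h k a = 0 := dif_neg H

lemma sum_dirac_apply {E : Type*} [MeasurableSpace E] (a : ℕ → E) {D : Set E}
    (hD : MeasurableSet D) :
    (Measure.sum fun n => Measure.dirac (a n)) D = ({n | a n ∈ D}.encard : ℝ≥0∞) := by
  rw [Measure.sum_apply _ hD, ← ENNReal.tsum_set_one, tsum_subtype {n | a n ∈ D} (fun _ => 1)]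
  refine tsum_congr fun n => ?_
  rw [Measure.dirac_apply' _ hD]
  rfl

section Measurability

variable [MeasurableSpace V]

lemma measurableSet_slice (h : ℝ) (k : ℕ) : MeasurableSet (slice h k) := measurableSet_Ioc

/-- The labelling of the arrivals is arbitrary and only the counts have a known law. This expresses
the slot through two counts on disjoint sets. -/
lemma slotPoint_mem_iff [Zero V] {h : ℝ} (hh : 0 < h) {k : ℕ} {a : ℕ → V × ℝ} {D : Set (V × ℝ)}
    (hD : MeasurableSet D) (hDs : D ⊆ univ ×ˢ slice h k) :
    slotPoint h k a ∈ D ↔ (Measure.sum fun n => Measure.dirac (a n)) D = 1 ∧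
      (Measure.sum fun n => Measure.dirac (a n)) ((univ ×ˢ slice h k) \ D) = 0 := by
  rw [sum_dirac_apply a hD, sum_dirac_apply a ((MeasurableSet.univ.prod
    (measurableSet_slice h k)).diff hD)]
  have h1 : (({n | a n ∈ D}.encard : ℕ∞) : ℝ≥0∞) = 1 ↔ {n | a n ∈ D}.encard = 1 := by
    rw [← ENat.toENNReal_one, ENat.toENNReal_inj]
  have h2 : (({n | a n ∈ (univ ×ˢ slice h k) \ D}.encard : ℕ∞) : ℝ≥0∞) = 0 ↔
      {n | a n ∈ (univ ×ˢ slice h k) \ D} = ∅ := by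
    rw [← ENat.toENNReal_zero, ENat.toENNReal_inj, encard_eq_zero]
  rw [h1, h2, encard_eq_one]
  constructor
  · intro hmem
    by_cases H : ∃ n, Uniq h k a n
    · obtain ⟨n, hn⟩ := H
      rw [hn.slotPoint_eq] at hmem
      refine ⟨⟨n, Set.ext fun n' => ⟨fun h' => hn.2 n' (hDs h').2, ?_⟩⟩, ?_⟩
      · rintro rfl; exact hmem
      · refine Set.eq_empty_iff_forall_notMem.2 fun n' h' => h'.2 ?_
        rw [hn.2 n' h'.1.2]
        exact hmem
    · rw [slotPoint_eq_zero H] at hmem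
      exact absurd (pos_of_mem_slice hh (hDs hmem).2) (lt_irrefl _)
  · rintro ⟨⟨n, hn⟩, hempty⟩
    have hnD : a n ∈ D := by
      have : n ∈ {n | a n ∈ D} := hn ▸ mem_singleton n
      exact this
    have hU : Uniq h k a n := by
      refine ⟨(hDs hnD).2, fun n' h' => ?_⟩
      by_cases hn' : a n' ∈ D
      · have : n' ∈ {n | a n ∈ D} := hn'
        rw [hn] at this
        exact this
      · have : n' ∈ {n | a n ∈ (univ ×ˢ slice h k) \ D} := ⟨⟨mem_univ _, h'⟩, hn'⟩
        rw [hempty] at this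
        exact absurd this (notMem_empty _)
    rw [hU.slotPoint_eq]
    exact hnD

lemma measurableSet_uniq (h : ℝ) (k n : ℕ) : MeasurableSet {a : ℕ → V × ℝ | Uniq h k a n} := by
  have h1 : ∀ n, MeasurableSet {a : ℕ → V × ℝ | (a n).2 ∈ slice h k} := fun n =>
    (measurable_pi_apply n).snd (measurableSet_slice h k)
  have h2 : {a : ℕ → V × ℝ | Uniq h k a n} =
      {a | (a n).2 ∈ slice h k} ∩ ⋂ n', {a | (a n').2 ∈ slice h k → n' = n} := by
    ext a; simp [Uniq]
  rw [h2]
  refine (h1 n).inter (MeasurableSet.iInter fun n' => ?_)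
  by_cases hn : n' = n
  · simp [hn]
  · simp only [hn, imp_false]
    exact (h1 n').compl

lemma measurable_of_iUnion {A B : Type*} [MeasurableSpace A] [MeasurableSpace B] {f : A → B}
    {U : ℕ → Set A} (hU : ∀ n, MeasurableSet (U n)) {F : ℕ → A → B} (hF : ∀ n, Measurable (F n))
    (h : ∀ n, ∀ a ∈ U n, f a = F n a) {c : B} (hc : ∀ a ∉ ⋃ n, U n, f a = c) : Measurable f := by
  intro S hS
  have : f ⁻¹' S = (⋃ n, U n ∩ F n ⁻¹' S) ∪ ((⋃ n, U n)ᶜ ∩ {_a | c ∈ S}) := by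
    ext a
    by_cases ha : a ∈ ⋃ n, U n
    · obtain ⟨n, hn⟩ := mem_iUnion.1 ha
      simp only [mem_preimage, mem_union, mem_iUnion, mem_inter_iff, mem_compl_iff, ha,
        not_true_eq_false, false_and, or_false]
      constructor
      · exact fun hS => ⟨n, hn, by rwa [← h n a hn]⟩
      · rintro ⟨n', hn', hS⟩
        rwa [h n' a hn']
    · simp only [mem_preimage, mem_union, mem_inter_iff, mem_compl_iff, ha, hc a ha,
        not_false_eq_true, true_and, mem_ofPred_eq]
      refine ⟨Or.inr, ?_⟩
      rintro (h' | h')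
      · obtain ⟨n, hn, _⟩ := mem_iUnion.1 h'
        exact absurd (mem_iUnion.2 ⟨n, hn⟩) ha
      · exact h'
  rw [this]
  exact (MeasurableSet.iUnion fun n => (hU n).inter (hF n hS)).union
    ((MeasurableSet.iUnion hU).compl.inter (MeasurableSet.const _))

lemma measurable_slotPoint [Zero V] (h : ℝ) (k : ℕ) :
    Measurable (slotPoint h k : (ℕ → V × ℝ) → V × ℝ) := by
  refine measurable_of_iUnion (measurableSet_uniq h k) (F := fun n a => a n)
    (fun n => measurable_pi_apply n) (fun n a hn => Uniq.slotPoint_eq hn) (c := 0) fun a ha => ?_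
  exact slotPoint_eq_zero fun ⟨n, hn⟩ => ha (mem_iUnion.2 ⟨n, hn⟩)

lemma measurable_slotOf [Zero V] (h : ℝ) (k : ℕ) :
    Measurable fun p : (ℕ → V × ℝ) × (ℕ → ℝ) => slotOf h k p.1 p.2 := by
  refine measurable_of_iUnion (fun n => measurable_fst (measurableSet_uniq h k n))
    (F := fun n p => ((p.1 n).1, (p.1 n).2, p.2 n)) (fun n => ?_)
    (fun n a hn => Uniq.slotOf_eq hn _) (c := 0) fun a ha => ?_
  · have h1 : Measurable fun p : (ℕ → V × ℝ) × (ℕ → ℝ) => p.1 n :=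
      (measurable_pi_apply n).comp measurable_fst
    exact h1.fst.prodMk (h1.snd.prodMk ((measurable_pi_apply n).comp measurable_snd))
  · exact slotOf_eq_zero (fun ⟨n, hn⟩ => ha (mem_iUnion.2 ⟨n, hn⟩)) _

open Classical in
/-- Law of a slot given its arrival. -/
def slotKernel [Zero V] (ρ : Measure ℝ) (y : V × ℝ) : Measure (V × ℝ × ℝ) :=
  if 0 < y.2 then ρ.map (fun ℓ => (y.1, y.2, ℓ)) else Measure.dirac 0

/-- For fixed arrivals, different occupied slots read the marks of different labels, and these are
independent. -/
lemma map_slotOf [Zero V] {h : ℝ} (hh : 0 < h) {m : ℕ} (ρ : Measure ℝ) [IsProbabilityMeasure ρ]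
    (a : ℕ → V × ℝ) :
    (Measure.infinitePi fun _ : ℕ => ρ).map (fun s => fun k : Fin m => slotOf h k a s) =
      Measure.pi fun k : Fin m => slotKernel ρ (slotPoint h k a) := by
  classical
  let lab : ℕ → ℕ := fun k => if H : ∃ n, Uniq h k a n then H.choose else 0
  let b : ℕ := (Finset.range m).sup lab + 1
  -- Slots without a unique arrival read no mark. They get fresh labels above all those in use, so
  -- that `e` is injective.
  let e : Fin m → ℕ := fun k => if ∃ n, Uniq h k a n then lab k else b + k
  have hlab : ∀ k, (∃ n, Uniq h k a n) → Uniq h k a (lab k) := fun k H => by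
    simp only [lab, dif_pos H]
    exact H.choose_spec
  have hb : ∀ k : Fin m, lab k < b := fun k =>
    Nat.lt_succ_of_le (Finset.le_sup (f := lab) (Finset.mem_range.2 k.2))
  have he : Function.Injective e := by
    intro k k' hkk'
    by_cases H : ∃ n, Uniq h k a n <;> by_cases H' : ∃ n, Uniq h k' a n
    · simp only [e, if_pos H, if_pos H'] at hkk'
      by_contra hne
      have h1 := (hlab k H).1
      rw [hkk'] at h1
      exact Set.disjoint_left.1 (pairwise_disjoint_slice hh fun h => hne (Fin.ext h)) h1
        (hlab k' H').1
    · simp only [e, if_pos H, if_neg H'] at hkk'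
      have := hb k
      omega
    · simp only [e, if_neg H, if_pos H'] at hkk'
      have := hb k'
      omega
    · simp only [e, if_neg H, if_neg H'] at hkk'
      exact Fin.ext (by omega)
  let φ : Fin m → ℝ → V × ℝ × ℝ := fun k ℓ =>
    if ∃ n, Uniq h k a n then ((a (lab k)).1, (a (lab k)).2, ℓ) else 0
  have hφ : ∀ k, Measurable (φ k) := by
    intro k
    by_cases H : ∃ n, Uniq h k a n
    · simp only [φ, if_pos H]; fun_prop
    · simp only [φ, if_neg H]; fun_prop
  have hslot : (fun s => fun k : Fin m => slotOf h k a s) =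
      (fun x k => φ k (x k)) ∘ (fun (s : ℕ → ℝ) (k : Fin m) => s (e k)) := by
    ext1 s
    funext k
    by_cases H : ∃ n, Uniq h k a n
    · simp only [Function.comp, φ, e, if_pos H]
      exact (hlab k H).slotOf_eq s
    · simp only [Function.comp, φ, if_neg H]
      exact slotOf_eq_zero H s
  rw [hslot, ← Measure.map_map (by fun_prop) (by fun_prop),
    Measure.map_infinitePi_infinitePi_of_inj (P := fun _ => ρ) he, Measure.infinitePi_eq_pi,
    Measure.pi_map_pi (fun k => (hφ k).aemeasurable)]
  congr 1
  funext k
  by_cases H : ∃ n, Uniq h k a n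
  · have hpos : 0 < (a (lab k)).2 := pos_of_mem_slice hh (hlab k H).1
    rw [(hlab k H).slotPoint_eq, slotKernel, if_pos hpos]
    simp only [φ, if_pos H]
  · rw [slotPoint_eq_zero H, slotKernel, if_neg (by simp)]
    simp only [φ, if_neg H, Measure.map_const, measure_univ, one_smul]

instance [Zero V] (ρ : Measure ℝ) [IsProbabilityMeasure ρ] (y : V × ℝ) :
    IsProbabilityMeasure (slotKernel ρ y) := by
  unfold slotKernel
  split_ifs
  · exact Measure.isProbabilityMeasure_map (by fun_prop)
  · infer_instance

lemma measurable_slotKernel [Zero V] (ρ : Measure ℝ) [SFinite ρ] {S : Set (V × ℝ × ℝ)}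
    (hS : MeasurableSet S) : Measurable fun y : V × ℝ => slotKernel ρ y S := by
  classical
  have : (fun y : V × ℝ => slotKernel ρ y S) = fun y => if 0 < y.2 then
      ρ (Prod.mk y ⁻¹' (MeasurableEquiv.prodAssoc ⁻¹' S)) else Measure.dirac 0 S := by
    funext y
    unfold slotKernel
    split_ifs
    · rw [Measure.map_apply (by fun_prop) hS]
      rfl
    · rfl
  rw [this]
  exact Measurable.ite (measurableSet_lt measurable_const measurable_snd)
    (measurable_measure_prodMk_left (MeasurableEquiv.prodAssoc.measurable hS)) measurable_const

end Measurability

end SlotData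

/-! ### Independence of the slots -/

section MarkedPoisson

variable {Ω : Type*} [MeasurableSpace Ω] [MeasurableSpace V]

/-- The arrivals `A` form a Poisson process with intensity `ν` and carry independent marks `R` with
law `ρ`. -/
structure MarkedPoisson (ν : Measure (V × ℝ)) (ρ : Measure ℝ) (A : Ω → ℕ → V × ℝ)
    (R : Ω → ℕ → ℝ) (P : Measure Ω) : Prop where
  measurable_arrivals : Measurable A
  measurable_marks : Measurable R
  poisson : IsPoissonPointProcess ν (fun ω => Measure.sum fun n => Measure.dirac (A ω n)) P
  indep : IndepFun A R P
  law_marks : P.map R = Measure.infinitePi fun _ => ρ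

variable [Zero V] {ν : Measure (V × ℝ)} {ρ : Measure ℝ} {A : Ω → ℕ → V × ℝ} {R : Ω → ℕ → ℝ}
  {P : Measure Ω} [IsProbabilityMeasure P]

lemma measurableSet_univ_prod_slice (h : ℝ) (k : ℕ) :
    MeasurableSet ((univ : Set V) ×ˢ slice h k) :=
  MeasurableSet.univ.prod (measurableSet_slice h k)

lemma slotPoint_mem_or_eq_zero {h : ℝ} {k : ℕ} (a : ℕ → V × ℝ) :
    slotPoint h k a ∈ (univ : Set V) ×ˢ slice h k ∨ slotPoint h k a = 0 := by
  by_cases H : ∃ n, Uniq h k a n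
  · obtain ⟨n, hn⟩ := H
    rw [hn.slotPoint_eq]
    exact Or.inl ⟨mem_univ _, hn.1⟩
  · exact Or.inr (slotPoint_eq_zero H)

/-- The empty state `0` lies outside every slice, since slices contain only positive times. So all
events of a slot are determined by those with `S` inside the slice. -/
lemma preimage_slotPoint {h : ℝ} (hh : 0 < h) (k : ℕ) (A : Ω → ℕ → V × ℝ) (S : Set (V × ℝ)) :
    (fun ω => slotPoint h k (A ω)) ⁻¹' S =
      ((fun ω => slotPoint h k (A ω)) ⁻¹' (S ∩ univ ×ˢ slice h k)) ∪
      (((fun ω => slotPoint h k (A ω)) ⁻¹' (univ ×ˢ slice h k))ᶜ ∩ {_ω | (0 : V × ℝ) ∈ S}) := by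
  ext ω
  have h0 : (0 : V × ℝ) ∉ (univ : Set V) ×ˢ slice h k := fun h' =>
    absurd (pos_of_mem_slice hh h'.2) (lt_irrefl _)
  rcases slotPoint_mem_or_eq_zero (h := h) (k := k) (A ω) with h1 | h1
  · simp only [mem_preimage, mem_union, mem_inter_iff, h1, and_true, mem_compl_iff,
      not_true_eq_false, false_and, or_false]
  · simp only [mem_preimage, mem_union, mem_inter_iff, h1, h0, and_false, mem_compl_iff,
      not_false_eq_true, true_and, false_or, mem_ofPred_eq]

namespace MarkedPoisson

lemma measurable_slotPoint (hA : MarkedPoisson ν ρ A R P) (h : ℝ) (k : ℕ) :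
    Measurable fun ω => slotPoint h k (A ω) :=
  (SpatialBD.measurable_slotPoint h k).comp hA.measurable_arrivals

lemma measurable_slotOf (hA : MarkedPoisson ν ρ A R P) (h : ℝ) (k : ℕ) :
    Measurable fun ω => slotOf h k (A ω) (R ω) :=
  (SpatialBD.measurable_slotOf h k).comp (hA.measurable_arrivals.prodMk hA.measurable_marks)

lemma measure_slotPoint_mem (hA : MarkedPoisson ν ρ A R P) {h : ℝ} (hh : 0 < h) (k : ℕ)
    {D : Set (V × ℝ)} (hD : MeasurableSet D) (hDs : D ⊆ univ ×ˢ slice h k) :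
    P {ω | slotPoint h k (A ω) ∈ D} =
      P {ω | (Measure.sum fun n => Measure.dirac (A ω n)) D ∈ ({1} : Set ℝ≥0∞)} *
      P {ω | (Measure.sum fun n => Measure.dirac (A ω n)) ((univ ×ˢ slice h k) \ D) ∈
        ({0} : Set ℝ≥0∞)} := by
  have h1 := (indepFun_eval hA.poisson hD ((measurableSet_univ_prod_slice h k).diff hD)
    disjoint_sdiff_right).measure_inter_preimage_eq_mul _ _ (measurableSet_singleton (1 : ℝ≥0∞))
    (measurableSet_singleton (0 : ℝ≥0∞))
  refine Eq.trans (congrArg P ?_) h1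
  ext ω
  exact slotPoint_mem_iff hh hD hDs

/-- Events with values inside the slice form a π-system that generates everything the slot reveals,
and on it independence is independence of Poisson counts on disjoint sets. -/
lemma iIndepFun_slotPoint (hA : MarkedPoisson ν ρ A R P) {h : ℝ} (hh : 0 < h) (m : ℕ) :
    iIndepFun (fun (k : Fin m) ω => slotPoint h k (A ω)) P := by
  classical
  let Y : Fin m → Ω → V × ℝ := fun k ω => slotPoint h k (A ω)
  let C : Fin m → Set (Set (V × ℝ)) := fun k =>
    {D | MeasurableSet D ∧ D ⊆ univ ×ˢ slice h k}
  refine iIndepSets.iIndep (m := fun k => MeasurableSpace.comap (Y k) inferInstance)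
    (fun k => (hA.measurable_slotPoint h k).comap_le) (fun k => preimage (Y k) '' C k) ?_ ?_ ?_
  · rintro k _ ⟨D, hD, rfl⟩ _ ⟨D', hD', rfl⟩ -
    exact ⟨D ∩ D', ⟨hD.1.inter hD'.1, inter_subset_left.trans hD.2⟩, rfl⟩
  · intro k
    refine le_antisymm ?_ (MeasurableSpace.generateFrom_le ?_)
    · rintro _ ⟨S, hS, rfl⟩
      rw [preimage_slotPoint hh k A S]
      refine @MeasurableSet.union _ (MeasurableSpace.generateFrom _) _ _ ?_
        (@MeasurableSet.inter _ (MeasurableSpace.generateFrom _) _ _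
        (@MeasurableSet.compl _ _ (MeasurableSpace.generateFrom _) ?_)
        (@MeasurableSet.const _ (MeasurableSpace.generateFrom _) _))
      · exact MeasurableSpace.measurableSet_generateFrom
          ⟨_, ⟨hS.inter (measurableSet_univ_prod_slice h k), inter_subset_right⟩, rfl⟩
      · exact MeasurableSpace.measurableSet_generateFrom
          ⟨_, ⟨measurableSet_univ_prod_slice h k, Subset.rfl⟩, rfl⟩
    · rintro _ ⟨D, hD, rfl⟩
      exact ⟨D, hD.1, rfl⟩
  · rw [iIndepSets_iff]
    intro s f hf
    choose! D0 hD0 using hf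
    let D : Fin m → Set (V × ℝ) := fun k => if k ∈ s then D0 k else ∅
    have hD : ∀ k, D k ∈ C k := by
      intro k
      by_cases hk : k ∈ s
      · simp only [D, if_pos hk]; exact (hD0 k hk).1
      · simp only [D, if_neg hk]; exact ⟨MeasurableSet.empty, empty_subset _⟩
    have hf' : ∀ k ∈ s, f k = {ω | slotPoint h k (A ω) ∈ D k} := by
      intro k hk
      simp only [D, if_pos hk]
      exact (hD0 k hk).2.symm
    -- Two sets per slice: exactly one point in `D k`, and none in the rest of the slice. All `2m`
    -- sets are disjoint.
    let B : Fin m × Bool → Set (V × ℝ) := fun p =>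
      cond p.2 (D p.1) ((univ ×ˢ slice h p.1) \ D p.1)
    have hBm : ∀ p, MeasurableSet (B p) := by
      rintro ⟨k, _ | _⟩
      · exact (measurableSet_univ_prod_slice h k).diff (hD k).1
      · exact (hD k).1
    have hBs : ∀ p, B p ⊆ univ ×ˢ slice h p.1 := by
      rintro ⟨k, _ | _⟩
      · exact sdiff_subset
      · exact (hD k).2
    have hBd : Pairwise fun p p' => Disjoint (B p) (B p') := by
      rintro ⟨k, b⟩ ⟨k', b'⟩ hne
      by_cases hk : k = k'
      · subst hk
        cases b <;> cases b'
        · exact absurd rfl hne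
        · exact disjoint_sdiff_left
        · exact disjoint_sdiff_right
        · exact absurd rfl hne
      · refine Set.disjoint_left.2 fun x hx hx' => ?_
        exact Set.disjoint_left.1 (pairwise_disjoint_slice hh fun h => hk (Fin.ext h))
          (hBs _ hx).2 (hBs _ hx').2
    let T : Bool → Set ℝ≥0∞ := fun b => cond b {1} {0}
    have hT : ∀ b, MeasurableSet (T b) := by
      rintro (_ | _) <;> exact measurableSet_singleton _
    have hind := (iIndepFun_eval hA.poisson hBm hBd).meas_biInter (S := s ×ˢ Finset.univ)
      (s := fun p => {ω | (Measure.sum fun n => Measure.dirac (A ω n)) (B p) ∈ T p.2})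
      (fun p _ => ⟨T p.2, hT p.2, rfl⟩)
    rw [Finset.prod_product] at hind
    have h1 : ⋂ k ∈ s, f k = ⋂ p ∈ s ×ˢ (Finset.univ : Finset Bool),
        {ω | (Measure.sum fun n => Measure.dirac (A ω n)) (B p) ∈ T p.2} := by
      ext ω
      simp only [mem_iInter, Finset.mem_product, Finset.mem_univ, and_true, Prod.forall,
        Bool.forall_bool, mem_ofPred_eq]
      refine forall_congr' fun k => ?_
      constructor
      · intro h'
        have h2 : k ∈ s → _ := fun hk => by
          have := h' hk
          rw [hf' k hk] at this
          exact (slotPoint_mem_iff hh (hD k).1 (hD k).2).1 this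
        exact ⟨fun hk => (h2 hk).2, fun hk => (h2 hk).1⟩
      · rintro ⟨h2, h3⟩ hk
        rw [hf' k hk]
        exact (slotPoint_mem_iff hh (hD k).1 (hD k).2).2 ⟨h3 hk, h2 hk⟩
    rw [h1, hind]
    refine Finset.prod_congr rfl fun k hk => ?_
    rw [hf' k hk, hA.measure_slotPoint_mem hh k (hD k).1 (hD k).2, Fintype.prod_bool]
    rfl

variable [IsProbabilityMeasure ρ]

/-- Integrate out the marks for fixed arrivals, which gives a product of kernels, and then use
independence of the slot points. -/
lemma measure_slots_mem_pi (hA : MarkedPoisson ν ρ A R P) {h : ℝ} (hh : 0 < h) {m : ℕ}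
    {S : Fin m → Set (V × ℝ × ℝ)} (hS : ∀ k, MeasurableSet (S k)) :
    P.map (fun ω => fun k : Fin m => slotOf h k (A ω) (R ω)) (univ.pi S) =
      ∏ k : Fin m, ∫⁻ ω, slotKernel ρ (slotPoint h k (A ω)) (S k) ∂P := by
  have hZ : Measurable fun p : (ℕ → V × ℝ) × (ℕ → ℝ) => fun k : Fin m => slotOf h k p.1 p.2 :=
    measurable_pi_lambda _ fun k => SpatialBD.measurable_slotOf h k
  have hAR : Measurable fun ω => (A ω, R ω) := hA.measurable_arrivals.prodMk hA.measurable_marks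
  have hSm : MeasurableSet (univ.pi S) := MeasurableSet.univ_pi hS
  have h1 : P.map (fun ω => fun k : Fin m => slotOf h k (A ω) (R ω)) =
      (P.map fun ω => (A ω, R ω)).map
        (fun p : (ℕ → V × ℝ) × (ℕ → ℝ) => fun k : Fin m => slotOf h k p.1 p.2) := by
    rw [Measure.map_map hZ hAR]; rfl
  rw [h1, (indepFun_iff_map_prod_eq_prod_map_map hA.measurable_arrivals.aemeasurable
    hA.measurable_marks.aemeasurable).1 hA.indep, hA.law_marks, Measure.map_apply hZ hSm,
    Measure.prod_apply (hZ hSm), lintegral_map (measurable_measure_prodMk_left (hZ hSm))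
    hA.measurable_arrivals]
  have h2 : ∀ ω, (Measure.infinitePi fun _ : ℕ => ρ) (Prod.mk (A ω) ⁻¹'
      ((fun p : (ℕ → V × ℝ) × (ℕ → ℝ) => fun k : Fin m => slotOf h k p.1 p.2) ⁻¹' univ.pi S)) =
      ∏ k : Fin m, slotKernel ρ (slotPoint h k (A ω)) (S k) := by
    intro ω
    have hZω : Measurable fun (s : ℕ → ℝ) (k : Fin m) => slotOf h k (A ω) s :=
      hZ.comp measurable_prodMk_left
    rw [← Measure.pi_pi, ← map_slotOf hh ρ (A ω), Measure.map_apply hZω hSm]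
    rfl
  simp only [h2]
  refine lintegral_prod_eq_prod_lintegral_of_indepFun Finset.univ
    (fun (k : Fin m) ω => slotKernel ρ (slotPoint h k (A ω)) (S k)) ?_
    (fun k => (measurable_slotKernel ρ (hS k)).comp (hA.measurable_slotPoint h k))
  exact (hA.iIndepFun_slotPoint hh m).comp _ fun k => measurable_slotKernel ρ (hS k)

lemma map_slotOf_apply (hA : MarkedPoisson ν ρ A R P) {h : ℝ} (hh : 0 < h) (k : ℕ)
    {S : Set (V × ℝ × ℝ)} (hS : MeasurableSet S) :
    P.map (fun ω => slotOf h k (A ω) (R ω)) S =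
      ∫⁻ ω, slotKernel ρ (slotPoint h k (A ω)) S ∂P := by
  classical
  let j : Fin (k + 1) := Fin.last k
  have h1 := hA.measure_slots_mem_pi hh (m := k + 1) (S := Function.update (fun _ => univ) j S)
    (fun i => by
      by_cases hi : i = j
      · subst hi; simpa using hS
      · simp [hi])
  rw [← Finset.prod_erase_mul _ _ (Finset.mem_univ j), Finset.prod_eq_one, one_mul,
    Function.update_self] at h1
  · refine Eq.trans ?_ h1
    have hm : Measurable fun ω => fun i : Fin (k + 1) => slotOf h i (A ω) (R ω) :=
      measurable_pi_lambda _ fun i => hA.measurable_slotOf h i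
    rw [Measure.map_apply (hA.measurable_slotOf h k) hS, Measure.map_apply hm]
    · congr 1
      ext ω
      simp only [mem_preimage, mem_univ_pi]
      constructor
      · intro hω i
        by_cases hi : i = j
        · subst hi; simpa [j] using hω
        · simp [hi]
      · intro hω
        simpa [j] using hω j
    · refine MeasurableSet.univ_pi fun i => ?_
      by_cases hi : i = j
      · subst hi; simpa using hS
      · simp [hi]
  · intro i hi
    simp [Function.update_of_ne (Finset.ne_of_mem_erase hi)]

/-- The slots are independent. -/
theorem map_slots_eq_pi (hA : MarkedPoisson ν ρ A R P) {h : ℝ} (hh : 0 < h) (m : ℕ) :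
    P.map (fun ω => fun k : Fin m => slotOf h k (A ω) (R ω)) =
      Measure.pi fun k : Fin m => P.map fun ω => slotOf h k (A ω) (R ω) := by
  have : ∀ k : Fin m, IsProbabilityMeasure (P.map fun ω => slotOf h k (A ω) (R ω)) := fun k =>
    Measure.isProbabilityMeasure_map (hA.measurable_slotOf h k).aemeasurable
  refine (Measure.pi_eq fun S hS => ?_).symm
  rw [hA.measure_slots_mem_pi hh hS]
  exact Finset.prod_congr rfl fun k _ => (hA.map_slotOf_apply hh k (hS k)).symm

lemma measure_slotOf_ne_zero_le (hA : MarkedPoisson ν ρ A R P) {h : ℝ} (k : ℕ)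
    (hν : ν (univ ×ˢ slice h k) ≠ ∞) :
    P {ω | slotOf h k (A ω) (R ω) ≠ 0} ≤ ν (univ ×ˢ slice h k) := by
  refine le_trans (measure_mono fun ω hω => ?_)
    (measure_ne_zero_le hA.poisson (measurableSet_univ_prod_slice h k) hν)
  by_contra h0
  refine hω (slotOf_eq_zero ?_ _)
  rintro ⟨n, hn⟩
  have h1 : (Measure.sum fun n => Measure.dirac (A ω n)) (univ ×ˢ slice h k) = 0 := by
    by_contra h2
    exact h0 h2
  rw [sum_dirac_apply _ (measurableSet_univ_prod_slice h k), ← ENat.toENNReal_zero,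
    ENat.toENNReal_inj, encard_eq_zero] at h1
  have : n ∈ {n | A ω n ∈ (univ : Set V) ×ˢ slice h k} := ⟨mem_univ _, hn.1⟩
  rw [h1] at this
  exact notMem_empty _ this

end MarkedPoisson

end MarkedPoisson

/-- No two of the arrivals `a` share one of the first `m` time slices. -/
def Separated (h : ℝ) (m : ℕ) (a : ℕ → V × ℝ) : Prop :=
  ∀ k < m, ∀ n n', (a n).2 ∈ slice h k → (a n').2 ∈ slice h k → n' = n

lemma Separated.uniq {h : ℝ} {m : ℕ} {a : ℕ → V × ℝ} (ha : Separated h m a) {k n : ℕ} (hk : k < m)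
    (hn : (a n).2 ∈ slice h k) : Uniq h k a n := ⟨hn, fun n' hn' => ha k hk n n' hn hn'⟩

lemma Separated.mono {h : ℝ} {m m' : ℕ} {a : ℕ → V × ℝ} (ha : Separated h m a) (hm : m' ≤ m) :
    Separated h m' a := fun k hk => ha k (hk.trans_le hm)

/-! ### Translation invariance of a slot and the probability of collisions -/

section MarkedPoisson

variable {Ω : Type*} [MeasurableSpace Ω] [MeasurableSpace V]

section Shift

variable [AddCommGroup V] {ν : Measure (V × ℝ)} {ρ : Measure ℝ} {A : Ω → ℕ → V × ℝ}
  {R : Ω → ℕ → ℝ} {P : Measure Ω} [IsProbabilityMeasure P]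

namespace MarkedPoisson

lemma measure_slotPoint_mem_eq (hA : MarkedPoisson ν ρ A R P) {h : ℝ} (hh : 0 < h) (k : ℕ)
    (S : Set (V × ℝ)) :
    P {ω | slotPoint h k (A ω) ∈ S} = P {ω | slotPoint h k (A ω) ∈ S ∩ univ ×ˢ slice h k} +
      P ({ω | slotPoint h k (A ω) ∈ (univ : Set V) ×ˢ slice h k}ᶜ ∩ {_ω | (0 : V × ℝ) ∈ S}) := by
  have hU := measurableSet_univ_prod_slice (V := V) h k
  have h1 := preimage_slotPoint hh k A S
  change P ((fun ω => slotPoint h k (A ω)) ⁻¹' S) = _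
  rw [h1]
  refine measure_union ?_ (((hA.measurable_slotPoint h k) hU).compl.inter (MeasurableSet.const _))
  refine Set.disjoint_left.2 fun ω h2 h3 => h3.1 ?_
  exact h2.2

/-- The probability depends on `D` only through the `ν`-masses of `D` and of its complement in the
slice, and `τ` preserves both. -/
lemma measure_slotPoint_shift (hA : MarkedPoisson ν ρ A R P) {h : ℝ} (hh : 0 < h) (k : ℕ)
    (hν : ν (univ ×ˢ slice h k) ≠ ∞) {τ : V × ℝ → V × ℝ} (hτ : MeasurePreserving τ ν ν)
    (hτ2 : ∀ p, (τ p).2 = p.2) {D : Set (V × ℝ)} (hD : MeasurableSet D)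
    (hDs : D ⊆ univ ×ˢ slice h k) :
    P {ω | slotPoint h k (A ω) ∈ τ ⁻¹' D} = P {ω | slotPoint h k (A ω) ∈ D} := by
  have hU := measurableSet_univ_prod_slice (V := V) h k
  have hDs' : τ ⁻¹' D ⊆ univ ×ˢ slice h k := fun p hp => by
    have := (hDs hp).2
    rw [hτ2] at this
    exact ⟨mem_univ _, this⟩
  have hm := hτ.measurable hD
  rw [hA.measure_slotPoint_mem hh k hD hDs, hA.measure_slotPoint_mem hh k hm hDs']
  have e1 : ν (τ ⁻¹' D) = ν D := hτ.measure_preimage hD.nullMeasurableSet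
  have f1 : ν D ≠ ∞ := ne_top_of_le_ne_top hν (measure_mono hDs)
  congr 1
  · exact measure_eval_eq_of_eq hA.poisson hm hD (e1 ▸ f1) e1 (measurableSet_singleton _)
  · refine measure_eval_eq_of_eq hA.poisson (hU.diff hm) (hU.diff hD)
      (ne_top_of_le_ne_top hν (measure_mono sdiff_subset)) ?_ (measurableSet_singleton _)
    rw [measure_sdiff hDs' hm.nullMeasurableSet (e1 ▸ f1), measure_sdiff hDs hD.nullMeasurableSet f1,
      e1]

variable [IsProbabilityMeasure ρ] [MeasurableSingletonClass V] [MeasurableAdd V]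

/-- The law of a slot is invariant under translations. -/
theorem map_slotOf_shift (hA : MarkedPoisson ν ρ A R P) {h : ℝ} (hh : 0 < h) (k : ℕ)
    (hν : ν (univ ×ˢ slice h k) ≠ ∞) (y : V)
    (hτ : MeasurePreserving (fun p : V × ℝ => (p.1 + y, p.2)) ν ν) :
    (P.map fun ω => slotOf h k (A ω) (R ω)).map (shiftSlot y) =
      P.map fun ω => slotOf h k (A ω) (R ω) := by
  classical
  set τ : V × ℝ → V × ℝ := fun p => (p.1 + y, p.2) with hτ_def
  -- Unlike `τ`, which would move the empty state to `(y, 0)`, the map `σ` fixes `0`, in accordance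
  -- with `shiftSlot` and `slotKernel`.
  let σ : V × ℝ → V × ℝ := fun p => if 0 < p.2 then τ p else 0
  have hσ : Measurable σ := Measurable.ite (measurableSet_lt measurable_const measurable_snd)
    hτ.measurable measurable_const
  have hker : ∀ (p : V × ℝ) {S : Set (V × ℝ × ℝ)}, MeasurableSet S →
      slotKernel ρ p (shiftSlot y ⁻¹' S) = slotKernel ρ (σ p) S := by
    intro p S hS
    by_cases hp : 0 < p.2
    · have h1 : σ p = τ p := if_pos hp
      have h2 : 0 < (τ p).2 := hp
      have h3 : Measurable fun ℓ : ℝ => (p.1, p.2, ℓ) := by fun_prop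
      have h4 : Measurable fun ℓ : ℝ => ((τ p).1, (τ p).2, ℓ) := by fun_prop
      rw [h1, slotKernel, slotKernel, if_pos hp, if_pos h2, Measure.map_apply h4 hS,
        Measure.map_apply h3 (measurable_shiftSlot y hS)]
      congr 1
      ext ℓ
      have hne : ((p.1, p.2, ℓ) : V × ℝ × ℝ) ≠ 0 := by
        intro h5
        have := congrArg (fun e : V × ℝ × ℝ => e.2.1) h5
        exact hp.ne' this
      simp only [mem_preimage, shiftSlot, if_neg hne]
      rfl
    · have h1 : σ p = 0 := if_neg hp
      have h2 : ¬ 0 < (0 : V × ℝ).2 := lt_irrefl _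
      rw [h1, slotKernel, slotKernel, if_neg hp, if_neg h2,
        Measure.dirac_apply' _ (measurable_shiftSlot y hS), Measure.dirac_apply' _ hS]
      simp [indicator, shiftSlot]
  have hsp := hA.measurable_slotPoint h k
  have hσsp : Measurable fun ω => σ (slotPoint h k (A ω)) := hσ.comp hsp
  have hmap : P.map (fun ω => σ (slotPoint h k (A ω))) = P.map fun ω => slotPoint h k (A ω) := by
    ext S hS
    rw [Measure.map_apply hσsp hS, Measure.map_apply hsp hS]
    have h1 := hA.measure_slotPoint_mem_eq hh k S
    have h2 := hA.measure_slotPoint_mem_eq hh k (σ ⁻¹' S)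
    refine h2.trans (Eq.trans ?_ h1.symm)
    have h3 : σ 0 = 0 := if_neg (lt_irrefl _)
    have h4 : ((0 : V × ℝ) ∈ σ ⁻¹' S) = (0 ∈ S) := by rw [mem_preimage, h3]
    have h5 : σ ⁻¹' S ∩ univ ×ˢ slice h k = τ ⁻¹' (S ∩ univ ×ˢ slice h k) := by
      ext p
      refine ⟨fun hp => ?_, fun hp => ?_⟩
      · have : σ p = τ p := if_pos (pos_of_mem_slice hh hp.2.2)
        exact ⟨by rw [← this]; exact hp.1, mem_univ _, hp.2.2⟩
      · have : σ p = τ p := if_pos (pos_of_mem_slice hh hp.2.2)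
        exact ⟨by rw [mem_preimage, this]; exact hp.1, mem_univ _, hp.2.2⟩
    rw [h4, h5, hA.measure_slotPoint_shift hh k hν hτ (fun _ => rfl)
      (hS.inter (measurableSet_univ_prod_slice h k)) inter_subset_right]
  ext S hS
  rw [Measure.map_apply (measurable_shiftSlot y) hS,
    hA.map_slotOf_apply hh k (measurable_shiftSlot y hS), hA.map_slotOf_apply hh k hS]
  simp only [hker _ hS]
  have h6 := measurable_slotKernel ρ hS
  rw [← lintegral_map h6 hσsp, hmap, lintegral_map h6 hsp]

end MarkedPoisson

end Shift

/-- A union bound: two arrivals in one slice have probability at most the square of its intensity.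
This is negligible for fine slices. -/
lemma MarkedPoisson.measure_not_separated_le [Zero V] {ν : Measure (V × ℝ)} {ρ : Measure ℝ}
    {A : Ω → ℕ → V × ℝ} {R : Ω → ℕ → ℝ} {P : Measure Ω} (hA : MarkedPoisson ν ρ A R P) {h : ℝ}
    {q : ℝ≥0∞} (hq : q ≠ ∞) (m : ℕ) (hν : ∀ k, ν (univ ×ˢ slice h k) ≤ q) :
    P {ω | ¬ Separated h m (A ω)} ≤ m * q ^ 2 := by
  have h1 : {ω | ¬ Separated h m (A ω)} ⊆ ⋃ k : Fin m,
      {ω | 1 < (Measure.sum fun n => Measure.dirac (A ω n)) (univ ×ˢ slice h k)} := by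
    intro ω hω
    simp only [Separated, mem_ofPred_eq, not_forall] at hω
    obtain ⟨k, hk, n, n', hn, hn', hne⟩ := hω
    refine mem_iUnion.2 ⟨⟨k, hk⟩, ?_⟩
    change 1 < (Measure.sum fun n => Measure.dirac (A ω n)) (univ ×ˢ slice h k)
    rw [sum_dirac_apply _ (measurableSet_univ_prod_slice h k), ← ENat.toENNReal_one,
      ENat.toENNReal_lt, one_lt_encard_iff]
    exact ⟨n, n', ⟨mem_univ _, hn⟩, ⟨mem_univ _, hn'⟩, fun h => hne h.symm⟩
  refine (measure_mono h1).trans ((measure_iUnion_le _).trans ?_)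
  rw [tsum_fintype]
  have h2 : ∀ k : Fin m, P {ω | 1 < (Measure.sum fun n => Measure.dirac (A ω n))
      (univ ×ˢ slice h k)} ≤ q ^ 2 := fun k =>
    (measure_one_lt_le hA.poisson (measurableSet_univ_prod_slice h k)
      (ne_top_of_le_ne_top hq (hν k))).trans (pow_le_pow_left' (hν k) 2)
  refine (Finset.sum_le_sum fun k _ => h2 k).trans ?_
  simp

end MarkedPoisson

/-! ### The full system against its slots -/

section Join

/-- The system with initial links `i` and arrivals `a` with file sizes `r`. -/
def joinData (i : ℕ → V × ℝ × ℝ) (a : ℕ → V × ℝ) (r : ℕ → ℝ) : ℕ ⊕ ℕ → V × ℝ × ℝ :=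
  Sum.elim i fun n => ((a n).1, (a n).2, r n)

/-- The links that arrive alone in one of the first `m` time slices. -/
def slots [Zero V] (h : ℝ) (m : ℕ) (a : ℕ → V × ℝ) (r : ℕ → ℝ) : Fin m → V × ℝ × ℝ :=
  fun k => slotOf h k a r

variable [AddCommGroup V] {h : ℝ} {m : ℕ} {i : ℕ → V × ℝ × ℝ} {a : ℕ → V × ℝ} {r : ℕ → ℝ}

/-- Passing to slots only discards links, those colliding or arriving late, so this direction needs
no separation. -/
lemma exists_embeds_slots (hh : 0 < h) (m : ℕ) (a : ℕ → V × ℝ) (r : ℕ → ℝ) :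
    ∃ e : Fin m → ℕ, ∀ i, Embeds (Sum.map id e) 0 (Sum.elim i (slots h m a r)) (joinData i a r) := by
  classical
  let e : Fin m → ℕ := fun k => if H : ∃ n, Uniq h k a n then H.choose else 0
  have he : ∀ k, 0 < (slots h m a r k).2.2 → Uniq h k a (e k) ∧
      slots h m a r k = ((a (e k)).1, (a (e k)).2, r (e k)) := by
    intro k hk
    have H : ∃ n, Uniq h k a n := by
      by_contra H
      rw [slots, slotOf_eq_zero H] at hk
      exact lt_irrefl _ hk
    have h1 : e k = H.choose := dif_pos H
    rw [h1]
    exact ⟨H.choose_spec, H.choose_spec.slotOf_eq r⟩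
  refine ⟨e, fun i => ⟨?_, ?_, ?_, ?_⟩⟩
  · rintro (j | k) hj (j' | k') hj' hjj'
    · exact congrArg _ (Sum.inl.inj hjj')
    · exact absurd hjj' (by simp)
    · exact absurd hjj' (by simp)
    · have h1 : e k = e k' := Sum.inr.inj hjj'
      have h2 := (he k hj).1.1
      have h3 := (he k' hj').1.1
      rw [← h1] at h3
      have h4 : (k : ℕ) = k' := by
        by_contra hne
        exact Set.disjoint_left.1 (pairwise_disjoint_slice hh hne) h2 h3
      exact congrArg _ (Fin.ext h4)
  · rintro (j | k) hj
    · simp [joinData]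
    · have := (he k hj).2
      simp [joinData, this]
  · rintro (j | k) hj
    · simp [joinData]
    · have := (he k hj).2
      simp [joinData, this]
  · rintro (j | k) hj
    · simp [joinData]
    · have := (he k hj).2
      simp [joinData, this]

lemma exists_slot (hh : 0 < h) (ha : Separated h m a) (hpos : ∀ n, 0 < (a n).2) (r : ℕ → ℝ) {n : ℕ}
    (hn : (a n).2 ≤ m * h) :
    ∃ k : Fin m, (a n).2 ∈ slice h k ∧ slots h m a r k = ((a n).1, (a n).2, r n) := by
  obtain ⟨k, hk, hmem⟩ := exists_mem_slice hh (hpos n) hn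
  exact ⟨⟨k, hk⟩, hmem, (ha.uniq hk hmem).slotOf_eq r⟩

/-- Without collisions no arrival up to time `m * h` is lost. -/
lemma exists_embeds_trunc (hh : 0 < h) (ha : Separated h m a) (hpos : ∀ n, 0 < (a n).2)
    (i : ℕ → V × ℝ × ℝ) (r : ℕ → ℝ) :
    ∃ e, Embeds e 0 (trunc (m * h) (joinData i a r)) (Sum.elim i (slots h m a r)) := by
  classical
  have H : ∀ n, ∃ k : ℕ ⊕ Fin m, (a n).2 ≤ m * h → ∃ k', k = Sum.inr k' ∧
      (a n).2 ∈ slice h k' ∧ slots h m a r k' = ((a n).1, (a n).2, r n) := by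
    intro n
    by_cases hn : (a n).2 ≤ m * h
    · obtain ⟨k, hk⟩ := exists_slot hh ha hpos r hn
      exact ⟨Sum.inr k, fun _ => ⟨k, rfl, hk⟩⟩
    · exact ⟨Sum.inl 0, fun h' => absurd h' hn⟩
  choose e he using H
  refine ⟨Sum.elim Sum.inl e, ?_, ?_, ?_, ?_⟩
  · rintro (j | n) hj (j' | n') hj' hjj'
    · exact congrArg _ (Sum.inl.inj hjj')
    · obtain ⟨k, hk, -⟩ := he n' (trunc_size_pos_iff.1 hj').2
      simp [hk] at hjj'
    · obtain ⟨k, hk, -⟩ := he n (trunc_size_pos_iff.1 hj).2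
      simp [hk] at hjj'
    · obtain ⟨k, hk, h1, -⟩ := he n (trunc_size_pos_iff.1 hj).2
      obtain ⟨k', hk', h1', -⟩ := he n' (trunc_size_pos_iff.1 hj').2
      simp only [Sum.elim_inr, hk, hk', Sum.inr.injEq] at hjj'
      subst hjj'
      exact congrArg _ (ha k k.2 n' n h1' h1)
  all_goals
    rintro (j | n) hj
    · have := (trunc_size_pos_iff.1 hj).2
      rw [trunc_of_le this]
      simp [joinData]
    · have h2 := (trunc_size_pos_iff.1 hj).2
      obtain ⟨k, hk, h1, h3⟩ := he n h2
      rw [trunc_of_le h2]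
      simp [joinData, hk, h3]

end Join

/-! ### The memoryless property of file sizes -/

section Memoryless

/-- Translate by `v`: the density picks up the factor `exp (-(r * v))`, and since `f` vanishes for
`ℓ ≤ 0` nothing is lost at the boundary. -/
lemma lintegral_expMeasure_sub {r : ℝ} {v : ℝ} (hv : 0 ≤ v) {f : ℝ → ℝ≥0∞}
    (hf : Measurable f) (h0 : ∀ ℓ ≤ 0, f ℓ = 0) :
    ∫⁻ ℓ, f (ℓ - v) ∂(expMeasure r) =
      ENNReal.ofReal (Real.exp (-(r * v))) * ∫⁻ ℓ, f ℓ ∂(expMeasure r) := by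
  have hpdf : Measurable (exponentialPDF r) := (measurable_exponentialPDFReal r).ennreal_ofReal
  have hfv : Measurable fun ℓ => f (ℓ - v) := hf.comp (measurable_id.sub_const v)
  have hd : expMeasure r = volume.withDensity (exponentialPDF r) := rfl
  rw [hd, lintegral_withDensity_eq_lintegral_mul _ hpdf hfv,
    lintegral_withDensity_eq_lintegral_mul _ hpdf hf, ← lintegral_const_mul _ (hpdf.mul hf),
    ← lintegral_add_right_eq_self _ v]
  refine lintegral_congr fun ℓ => ?_
  simp only [Pi.mul_apply, add_sub_cancel_right]
  rcases le_or_gt ℓ 0 with h | h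
  · simp [h0 ℓ h]
  · rw [exponentialPDF_of_nonneg h.le, exponentialPDF_of_nonneg (add_nonneg h.le hv), ← mul_assoc,
      ← ENNReal.ofReal_mul (Real.exp_nonneg _)]
    congr 2
    have : -(r * (ℓ + v)) = -(r * v) + -(r * ℓ) := by ring
    rw [this, Real.exp_add]
    ring

variable {Ω α : Type*} [MeasurableSpace Ω] [MeasurableSpace α] {P : Measure Ω}
  [IsProbabilityMeasure P]

/-- The memoryless property. -/
lemma measure_sub_mem_eq {O : Ω → α} {S : Ω → ℝ} {r v : ℝ} (hr : 0 < r) (hO : Measurable O)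
    (hS : Measurable S) (hind : IndepFun O S P) (hlaw : P.map S = expMeasure r) (hv : 0 ≤ v)
    {D : Set (α × ℝ)} (hD : MeasurableSet D) (h0 : ∀ o ℓ, (o, ℓ) ∈ D → 0 < ℓ) :
    P {ω | (O ω, S ω - v) ∈ D} = ENNReal.ofReal (Real.exp (-(r * v))) * P {ω | (O ω, S ω) ∈ D} := by
  have := isProbabilityMeasure_expMeasure hr
  have h1 : P.map (fun ω => (O ω, S ω)) = (P.map O).prod (expMeasure r) := by
    rw [← hlaw]
    exact (indepFun_iff_map_prod_eq_prod_map_map hO.aemeasurable hS.aemeasurable).1 hind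
  have hsub : Measurable fun p : α × ℝ => (p.1, p.2 - v) :=
    measurable_fst.prodMk (measurable_snd.sub_const v)
  have e1 : P {ω | (O ω, S ω) ∈ D} = P.map (fun ω => (O ω, S ω)) D :=
    (Measure.map_apply (hO.prodMk hS) hD).symm
  have e2 : P {ω | (O ω, S ω - v) ∈ D} =
      P.map (fun ω => (O ω, S ω)) ((fun p : α × ℝ => (p.1, p.2 - v)) ⁻¹' D) :=
    (Measure.map_apply (hO.prodMk hS) (hsub hD)).symm
  rw [e1, e2, h1, Measure.prod_apply hD, Measure.prod_apply (hsub hD),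
    ← lintegral_const_mul _ (measurable_measure_prodMk_left hD)]
  refine lintegral_congr fun o => ?_
  have hDo : MeasurableSet (Prod.mk o ⁻¹' D) := measurable_prodMk_left hD
  have h2 := lintegral_expMeasure_sub (r := r) hv (f := (Prod.mk o ⁻¹' D).indicator 1)
    (measurable_one.indicator hDo) (fun ℓ hℓ => indicator_of_notMem
      (s := Prod.mk o ⁻¹' D) (fun h => absurd (h0 o ℓ h) (not_lt.2 hℓ)) _)
  rw [lintegral_indicator_one hDo] at h2
  rw [← h2, ← lintegral_indicator_one (measurable_prodMk_left (hsub hD))]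
  rfl

end Memoryless

/-! ### Quiet and busy systems as events of the past -/

section Matched

variable [AddCommGroup V] {w : V → ℝ≥0∞} {g : ℝ≥0∞ → ℝ≥0∞}

lemma trunc_trunc (s : ℝ) (z : ι → V × ℝ × ℝ) : trunc s (trunc s z) = trunc s z := by
  funext i
  by_cases h : (z i).2.1 ≤ s <;> simp [trunc, h]

lemma Embeds.trunc {z : ι → V × ℝ × ℝ} {z' : κ → V × ℝ × ℝ} {e : ι → κ} {y : V}
    (he : Embeds e y z z') (s : ℝ) : Embeds e y (trunc s z) (trunc s z') := by
  refine ⟨he.inj.mono fun i hi => (trunc_size_pos_iff.1 hi).1, fun i hi => ?_, fun i hi => ?_,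
    fun i hi => ?_⟩
  · simpa using he.pos i (trunc_size_pos_iff.1 hi).1
  · simpa using he.birth i (trunc_size_pos_iff.1 hi).1
  · obtain ⟨h1, h2⟩ := trunc_size_pos_iff.1 hi
    rw [trunc_of_le h2, trunc_of_le ((he.birth i h1).le.trans h2)]
    exact he.size i h1

/-- The systems `z` and `z'` agree up to time `s` up to relabelling. -/
structure Matched (s : ℝ) (z : ι → V × ℝ × ℝ) (z' : κ → V × ℝ × ℝ) : Prop where
  right : ∃ e, Embeds e 0 (trunc s z) (trunc s z')
  left : ∃ e, Embeds e 0 (trunc s z') (trunc s z)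

lemma Matched.symm {s : ℝ} {z : ι → V × ℝ × ℝ} {z' : κ → V × ℝ × ℝ} (h : Matched s z z') :
    Matched s z' z := ⟨h.left, h.right⟩

/-- At time `s` there are at most `M` links, none of which has more than `v` bits left. -/
def Quiet (w : V → ℝ≥0∞) (g : ℝ≥0∞ → ℝ≥0∞) (v s : ℝ) (M : ℝ≥0∞) (z : ι → V × ℝ × ℝ) : Prop :=
  count w g z s ≤ M ∧ ∀ p, ¬ Alive w g (shorten p v (trunc s z)) p s

/-- There are links at all the times `0, K, …, n K`. -/
def Busy (w : V → ℝ≥0∞) (g : ℝ≥0∞ → ℝ≥0∞) (K : ℝ) (n : ℕ) (z : ι → V × ℝ × ℝ) : Prop :=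
  ∀ j ≤ n, count w g z (j * K) ≠ 0

variable [Countable ι] [Countable κ] [MeasurableSpace V] [MeasurableSub₂ V]

lemma Matched.count_eq (hw : Measurable w) (hg : IsRate g) {s : ℝ} {z : ι → V × ℝ × ℝ}
    {z' : κ → V × ℝ × ℝ} (h : Matched s z z') (hz : LocFin z) (hz' : LocFin z') {t : ℝ}
    (ht : t ≤ s) : count w g z t = count w g z' t := by
  obtain ⟨e, he⟩ := h.right
  obtain ⟨e', he'⟩ := h.left
  rw [← count_trunc hw hg hz ht, ← count_trunc hw hg hz' ht]
  exact le_antisymm (he.count_le hw hg (hz.trunc s) t) (he'.count_le hw hg (hz'.trunc s) t)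

lemma LocFin.shorten {z : ι → V × ℝ × ℝ} (hz : LocFin z) (p : ι) {v : ℝ} (hv : 0 ≤ v) :
    LocFin (shorten p v z) := fun t => (hz t).subset fun i hi =>
  ⟨hi.1.trans_le (shorten_size_le hv z), by simpa using hi.2⟩

/-- A long residual in `z'` would be carried by the reverse embedding, which is compatible with
shortening, to one in `z`. The truncation in `Quiet` makes only the data up to time `s` matter. -/
lemma Matched.quiet (hw : Measurable w) (hg : IsRate g) {s v : ℝ} (hv : 0 ≤ v) {M : ℝ≥0∞}
    {z : ι → V × ℝ × ℝ} {z' : κ → V × ℝ × ℝ} (h : Matched s z z') (hz : LocFin z)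
    (hz' : LocFin z') (hq : Quiet w g v s M z) : Quiet w g v s M z' := by
  refine ⟨(h.count_eq hw hg hz hz' le_rfl).symm.trans_le hq.1, fun p hp => ?_⟩
  obtain ⟨e', he'⟩ := h.left
  have h1 : 0 < (SpatialBD.trunc s z' p).2.2 := by
    have := hp.size_pos
    simp only [shorten_same] at this
    linarith
  exact hq.2 (e' p) ((he'.shorten h1 hv).alive hw hg ((hz'.trunc s).shorten p hv) hp)

lemma Matched.busy (hw : Measurable w) (hg : IsRate g) {K : ℝ} (hK : 0 ≤ K) {n : ℕ}
    {z : ι → V × ℝ × ℝ} {z' : κ → V × ℝ × ℝ} (h : Matched (n * K) z z') (hz : LocFin z)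
    (hz' : LocFin z') (hb : Busy w g K n z) : Busy w g K n z' := fun j hj => by
  rw [← h.count_eq hw hg hz hz' (by gcongr)]
  exact hb j hj

lemma measurableSet_quiet (hw : Measurable w) (hg : IsRate g) (v s : ℝ) (M : ℝ≥0∞) :
    MeasurableSet {z : ι → V × ℝ × ℝ | Quiet w g v s M z} := by
  refine (measurableSet_le (measurable_count hw hg s) measurable_const).inter ?_
  have : {z : ι → V × ℝ × ℝ | ∀ p, ¬ Alive w g (shorten p v (trunc s z)) p s} =
      ⋂ p, {z | Alive w g (shorten p v (trunc s z)) p s}ᶜ := by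
    ext z; simp
  change MeasurableSet {z : ι → V × ℝ × ℝ | ∀ p, ¬ Alive w g (shorten p v (trunc s z)) p s}
  rw [this]
  exact MeasurableSet.iInter fun p => (((measurable_shorten p v).comp (measurable_trunc s))
    (measurableSet_alive hw hg p s)).compl

lemma measurableSet_busy (hw : Measurable w) (hg : IsRate g) (K : ℝ) (n : ℕ) :
    MeasurableSet {z : ι → V × ℝ × ℝ | Busy w g K n z} := by
  have : {z : ι → V × ℝ × ℝ | Busy w g K n z} =
      ⋂ j : ℕ, ⋂ _ : j ≤ n, {z | count w g z (j * K) = 0}ᶜ := by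
    ext z; simp [Busy]
  rw [this]
  exact MeasurableSet.iInter fun j => MeasurableSet.iInter fun _ =>
    ((measurable_count hw hg _) (measurableSet_singleton 0)).compl

lemma matched_joinData {h : ℝ} {m : ℕ} {i : ℕ → V × ℝ × ℝ} {a : ℕ → V × ℝ} (hh : 0 < h)
    (ha : Separated h m a) (hpos : ∀ n, 0 < (a n).2) (r : ℕ → ℝ) :
    Matched (m * h) (joinData i a r) (Sum.elim i (slots h m a r)) := by
  obtain ⟨e, he⟩ := exists_embeds_trunc hh ha hpos i r
  obtain ⟨e', he'⟩ := exists_embeds_slots hh m a r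
  refine ⟨⟨e, ?_⟩, ⟨Sum.map id e', (he' i).trunc _⟩⟩
  have := he.trunc (m * h)
  rwa [trunc_trunc] at this

/-- A quiet system without arrivals gets empty. -/
lemma not_busy_of_quiet (hw : Measurable w) (hw1 : ∀ x, w x ≤ 1) (hg : IsRate g)
    {i : ℕ → V × ℝ × ℝ} {a : ℕ → V × ℝ} {r : ℕ → ℝ} (hz : LocFin (joinData i a r))
    (hi : ∀ j, (i j).2.1 = 0) {K v : ℝ} (hK : 0 ≤ K) (hv : 0 ≤ v) {M : ℝ≥0∞}
    (hKv : ENNReal.ofReal v ≤ g M * ENNReal.ofReal K) {n : ℕ}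
    (hq : Quiet w g v (n * K) M (joinData i a r)) (ha : ∀ k, (a k).2 ∉ slice K n) :
    ¬ Busy w g K (n + 1) (joinData i a r) := by
  intro hb
  refine hb (n + 1) le_rfl (count_eq_zero_iff.2 fun p hp => ?_)
  have hs : ((n + 1 : ℕ) : ℝ) * K = n * K + K := by push_cast; ring
  rw [hs] at hp
  have h1 := (alive_trunc_iff hw hg hz le_rfl).2 hp
  -- Without arrivals in the slice the two truncations coincide, so the system at the later time
  -- contains no link born after `n * K`.
  have h2 : trunc (n * K + K) (joinData i a r) = trunc (n * K) (joinData i a r) := by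
    funext p
    have hnK : 0 ≤ (n : ℝ) * K := by positivity
    rcases p with j | k
    · rw [trunc_of_le, trunc_of_le] <;> simp only [joinData, Sum.elim_inl, hi j] <;> linarith
    · have h3 : (a k).2 ≤ n * K + K ↔ (a k).2 ≤ n * K := by
        refine ⟨fun h4 => ?_, fun h4 => by linarith⟩
        by_contra! h5
        exact ha k ⟨h5, h4.trans (by linarith)⟩
      by_cases h6 : (a k).2 ≤ n * K
      · rw [trunc_of_le (h3.2 h6), trunc_of_le h6]
      · have h7 : ¬ (a k).2 ≤ n * K + K := fun h => h6 (h3.1 h)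
        exact (if_neg h7).trans (if_neg h6).symm
  rw [h2] at h1
  refine not_alive_of_quiet hw hw1 hg (hz.trunc _) hK hv (M := M) ?_ hKv
    (fun p hp => ?_) hq.2 p h1
  · rw [count_trunc hw hg hz le_rfl]
    exact hq.1
  · rw [trunc_birth]
    exact (trunc_size_pos_iff.1 hp).2

end Matched

/-! ### The probability of never having been empty -/

section Driven

variable {Ω : Type*} [MeasurableSpace Ω] [MeasurableSpace V] [AddCommGroup V]

/-- The random system with initial links `I` and marked Poisson arrivals of total rate `θ`. -/
structure Driven (ν : Measure (V × ℝ)) (ρ : Measure ℝ) (θ : ℝ) (I : Ω → ℕ → V × ℝ × ℝ)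
    (A : Ω → ℕ → V × ℝ) (R : Ω → ℕ → ℝ) (P : Measure Ω) : Prop where
  marked : MarkedPoisson ν ρ A R P
  measurable_init : Measurable I
  indep_init : IndepFun I (fun ω => (A ω, R ω)) P
  init_birth : ∀ ω i, (I ω i).2.1 = 0
  rate_nonneg : 0 ≤ θ
  measure_slab : ∀ a b, 0 ≤ a → a ≤ b → ν (univ ×ˢ Ioc a b) = ENNReal.ofReal (θ * (b - a))
  arrival_pos : ∀ᵐ ω ∂P, ∀ n, 0 < (A ω n).2
  locFin : ∀ᵐ ω ∂P, LocFin (joinData (I ω) (A ω) (R ω))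

variable {ν : Measure (V × ℝ)} {ρ : Measure ℝ} {θ : ℝ} {I : Ω → ℕ → V × ℝ × ℝ}
  {A : Ω → ℕ → V × ℝ} {R : Ω → ℕ → ℝ} {P : Measure Ω} [IsProbabilityMeasure P]
  [IsProbabilityMeasure ρ]

lemma measurable_joinData : Measurable fun p : (ℕ → V × ℝ × ℝ) × (ℕ → V × ℝ) × (ℕ → ℝ) =>
    joinData p.1 p.2.1 p.2.2 := by
  refine measurable_pi_lambda _ ?_
  rintro (j | n)
  · exact (measurable_pi_apply j).comp measurable_fst
  · have h1 : Measurable fun p : (ℕ → V × ℝ × ℝ) × (ℕ → V × ℝ) × (ℕ → ℝ) => p.2.1 n :=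
      (measurable_pi_apply n).comp (measurable_fst.comp measurable_snd)
    have h2 : Measurable fun p : (ℕ → V × ℝ × ℝ) × (ℕ → V × ℝ) × (ℕ → ℝ) => p.2.2 n :=
      (measurable_pi_apply n).comp (measurable_snd.comp measurable_snd)
    exact h1.fst.prodMk (h1.snd.prodMk h2)

lemma measurable_elim_fin {m : ℕ} : Measurable
    fun p : (ℕ → V × ℝ × ℝ) × (Fin m → V × ℝ × ℝ) => (Sum.elim p.1 p.2 : ℕ ⊕ Fin m → _) := by
  refine measurable_pi_lambda _ ?_
  rintro (j | n)
  · exact (measurable_pi_apply j).comp measurable_fst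
  · exact (measurable_pi_apply n).comp measurable_snd

namespace Driven

lemma measurable_full (D : Driven ν ρ θ I A R P) :
    Measurable fun ω => joinData (I ω) (A ω) (R ω) :=
  measurable_joinData.comp (D.measurable_init.prodMk
    (D.marked.measurable_arrivals.prodMk D.marked.measurable_marks))

lemma measure_slice (D : Driven ν ρ θ I A R P) {h : ℝ} (hh : 0 ≤ h) (k : ℕ) :
    ν (univ ×ˢ slice h k) = ENNReal.ofReal (θ * h) := by
  rw [slice, D.measure_slab _ _ (by positivity) (by nlinarith)]
  congr 2
  ring

lemma measurable_slots (D : Driven ν ρ θ I A R P) (h : ℝ) (m : ℕ) :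
    Measurable fun ω => slots h m (A ω) (R ω) :=
  measurable_pi_lambda _ fun k => D.marked.measurable_slotOf h k

lemma measure_not_separated_le (D : Driven ν ρ θ I A R P) {h : ℝ} (hh : 0 ≤ h) (m : ℕ) :
    P.real {ω | ¬ Separated h m (A ω)} ≤ m * (θ * h) ^ 2 := by
  have h0 : 0 ≤ θ * h := mul_nonneg D.rate_nonneg hh
  have h1 := D.marked.measure_not_separated_le (h := h) (q := ENNReal.ofReal (θ * h))
    ENNReal.ofReal_ne_top m fun k => (D.measure_slice hh k).le
  refine ENNReal.toReal_le_of_le_ofReal (by positivity) (h1.trans (le_of_eq ?_))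
  rw [ENNReal.ofReal_mul (p := (m : ℝ)) (Nat.cast_nonneg m), ENNReal.ofReal_natCast,
    ENNReal.ofReal_pow h0]

/-- The slots of two disjoint ranges and the initial links are independent. -/
lemma indepFun_slots (D : Driven ν ρ θ I A R P) {h : ℝ} (hh : 0 < h) (m m' : ℕ) :
    IndepFun (fun ω => (I ω, slots h m (A ω) (R ω)))
      (fun ω => fun k : Fin m' => slotOf h (m + k) (A ω) (R ω)) P := by
  have hind : iIndepFun (fun (k : Fin (m + m')) ω => slotOf h k (A ω) (R ω)) P :=
    (iIndepFun_iff_map_fun_eq_pi_map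
      fun k : Fin (m + m') => (D.marked.measurable_slotOf h k).aemeasurable).2 (D.marked.map_slots_eq_pi hh _)
  have h1 := hind.indepFun_finset (Finset.univ.filter fun k : Fin (m + m') => (k : ℕ) < m)
    (Finset.univ.filter fun k : Fin (m + m') => m ≤ (k : ℕ))
    (Finset.disjoint_filter.2 fun k _ h1 h2 => absurd h1 (not_lt.2 h2))
    (fun k : Fin (m + m') => D.marked.measurable_slotOf h k)
  have h2 : IndepFun (fun ω => slots h m (A ω) (R ω))
      (fun ω => fun k : Fin m' => slotOf h (m + k) (A ω) (R ω)) P := by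
    refine h1.comp
      (φ := fun f k => f ⟨Fin.castAdd m' k, by simp⟩)
      (ψ := fun f k => f ⟨Fin.natAdd m k, by simp⟩) ?_ ?_
    · exact measurable_pi_lambda _ fun k => measurable_pi_apply _
    · exact measurable_pi_lambda _ fun k => measurable_pi_apply _
  refine indepFun_prodMk_of_indepFun D.measurable_init (D.measurable_slots h m)
    (measurable_pi_lambda _ fun k => D.marked.measurable_slotOf h _) ?_ h2
  refine D.indep_init.comp (φ := id) (ψ := fun p : (ℕ → V × ℝ) × (ℕ → ℝ) =>
    (slots h m p.1 p.2, fun k : Fin m' => slotOf h (m + k) p.1 p.2)) measurable_id ?_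
  refine Measurable.prodMk ?_ ?_
  · exact measurable_pi_lambda _ fun k => SpatialBD.measurable_slotOf h k
  · exact measurable_pi_lambda _ fun k => SpatialBD.measurable_slotOf h (m + k)

variable {w : V → ℝ≥0∞} {g : ℝ≥0∞ → ℝ≥0∞} [MeasurableSub₂ V] [MeasurableSingletonClass V]

lemma prob_noArrival (D : Driven ν ρ θ I A R P) {K : ℝ} (hK : 0 ≤ K) (n : ℕ) :
    P.real {ω | ∀ k, (A ω k).2 ∉ slice K n} = Real.exp (-(θ * K)) := by
  have hU := measurableSet_univ_prod_slice (V := V) K n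
  have hν := D.measure_slice hK n
  have h1 := measure_eval_mem D.marked.poisson hU (hν ▸ ENNReal.ofReal_ne_top)
    (measurableSet_singleton 0)
  have h2 : {ω | ∀ k, (A ω k).2 ∉ slice K n} =
      {ω | (Measure.sum fun n => Measure.dirac (A ω n)) (univ ×ˢ slice K n) ∈ ({0} : Set ℝ≥0∞)} := by
    ext ω
    rw [mem_ofPred_eq, mem_ofPred_eq, sum_dirac_apply _ hU, mem_singleton_iff,
      ← ENat.toENNReal_zero, ENat.toENNReal_inj, encard_eq_zero, eq_empty_iff_forall_notMem]
    simp
  have h3 : {n : ℕ | (n : ℝ≥0∞) ∈ ({0} : Set ℝ≥0∞)} = {0} := by ext; simp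
  have h4 : (((ENNReal.ofReal (θ * K)).toNNReal : ℝ≥0) : ℝ) = θ * K :=
    ENNReal.toReal_ofReal (mul_nonneg D.rate_nonneg hK)
  rw [measureReal_def, h2, h1, h3, hν, ← lintegral_indicator_one (measurableSet_singleton 0),
    lintegral_poissonMeasure, tsum_eq_single 0]
  · rw [h4]
    simp [Real.exp_nonneg]
  · intro n hn
    simp [hn]

/-- Having no arrivals in a time slice is nearly independent of the past. -/
lemma prob_noArrival_inter_ge_aux (D : Driven ν ρ θ I A R P) (hw : Measurable w) (hg : IsRate g)
    {K v : ℝ} (hK : 0 < K) (hv : 0 ≤ v) (M : ℝ≥0∞) (n m : ℕ) (hm : 0 < m) :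
    Real.exp (-(θ * K)) * (P.real {ω | Busy w g K n (joinData (I ω) (A ω) (R ω)) ∧
        Quiet w g v (n * K) M (joinData (I ω) (A ω) (R ω))} -
        ((n + 1) * m : ℕ) * (θ * (K / m)) ^ 2) - ((n + 1) * m : ℕ) * (θ * (K / m)) ^ 2 ≤
      P.real {ω | (Busy w g K n (joinData (I ω) (A ω) (R ω)) ∧
        Quiet w g v (n * K) M (joinData (I ω) (A ω) (R ω))) ∧ ∀ k, (A ω k).2 ∉ slice K n} := by
  set h := K / m with hh_def
  have hm' : (0 : ℝ) < m := by exact_mod_cast hm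
  have hh : 0 < h := div_pos hK hm'
  have hmh : (m : ℝ) * h = K := by rw [hh_def]; field_simp
  have hnh : ((n * m : ℕ) : ℝ) * h = n * K := by push_cast; rw [mul_assoc, hmh]
  have hnh' : (((n + 1) * m : ℕ) : ℝ) * h = (n + 1) * K := by push_cast; rw [mul_assoc, hmh]
  set b : ℝ := ((n + 1) * m : ℕ) * (θ * h) ^ 2
  set S : Set (ℕ ⊕ Fin (n * m) → V × ℝ × ℝ) := {z | Busy w g K n z ∧ Quiet w g v (n * K) M z}
  have hS : MeasurableSet S := (measurableSet_busy hw hg K n).inter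
    (measurableSet_quiet hw hg v (n * K) M)
  set H : Set Ω := {ω | Busy w g K n (joinData (I ω) (A ω) (R ω)) ∧
        Quiet w g v (n * K) M (joinData (I ω) (A ω) (R ω))}
  set H' : Set Ω := {ω | (Sum.elim (I ω) (slots h (n * m) (A ω) (R ω)) : ℕ ⊕ Fin (n * m) → _) ∈ S}
  set F : Set Ω := {ω | ∀ k : Fin m, slotOf h (n * m + k) (A ω) (R ω) = 0}
  set E : Set Ω := {ω | ∀ k, (A ω k).2 ∉ slice K n}
  set G : Set Ω := {ω | ¬ Separated h ((n + 1) * m) (A ω)}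
  have hG : P.real G ≤ b := D.measure_not_separated_le hh.le _
  -- `H'` is determined by the initial links and the first `n * m` slots, `F` by the `m` slots after
  -- them.
  have hind : P.real (H' ∩ F) = P.real H' * P.real F := by
    have h1 := (D.indepFun_slots hh (n * m) m).measure_inter_preimage_eq_mul
      ((fun p : (ℕ → V × ℝ × ℝ) × (Fin (n * m) → V × ℝ × ℝ) =>
        (Sum.elim p.1 p.2 : ℕ ⊕ Fin (n * m) → _)) ⁻¹' S) {0} (measurable_elim_fin hS)
      (measurableSet_singleton 0)
    have h2 : F = (fun ω => fun k : Fin m => slotOf h (n * m + k) (A ω) (R ω)) ⁻¹' {0} := by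
      ext ω
      simp [F, funext_iff]
    rw [measureReal_def, measureReal_def, measureReal_def, ← ENNReal.toReal_mul, h2]
    exact congrArg ENNReal.toReal h1
  have hbirth : ∀ ω, Separated h ((n + 1) * m) (A ω) → (∀ k, 0 < (A ω k).2) →
      LocFin (joinData (I ω) (A ω) (R ω)) → (ω ∈ H ↔ ω ∈ H') := by
    intro ω h1 h2 h3
    have h4 : LocFin (Sum.elim (I ω) (slots h (n * m) (A ω) (R ω)) : ℕ ⊕ Fin (n * m) → _) := by
      refine .of_finite ?_
      have h5 : {i | 0 < (I ω i).2.2}.Finite := by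
        refine ((h3 0).preimage (f := Sum.inl) Sum.inl_injective.injOn).subset fun i hi => ?_
        exact ⟨hi, (D.init_birth ω i).le⟩
      refine ((h5.image Sum.inl).union (finite_range Sum.inr)).subset ?_
      rintro (j | k) hj
      · exact Or.inl ⟨j, hj, rfl⟩
      · exact Or.inr ⟨k, rfl⟩
    have h5 := matched_joinData (i := I ω) hh
      (h1.mono (Nat.mul_le_mul_right m (Nat.le_succ n))) h2 (R ω)
    rw [hnh] at h5
    exact ⟨fun h => ⟨h5.busy hw hg hK.le h3 h4 h.1, h5.quiet hw hg hv h3 h4 h.2⟩,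
      fun h => ⟨h5.symm.busy hw hg hK.le h4 h3 h.1, h5.symm.quiet hw hg hv h4 h3 h.2⟩⟩
  -- A slice without arrivals has empty slots in any case; the converse `hFE` needs separation,
  -- since a collision also leaves a slot empty.
  have hEF : E ⊆ F := by
    intro ω hω k
    refine slotOf_eq_zero ?_ _
    rintro ⟨j, hj⟩
    refine hω j ⟨?_, ?_⟩
    · have := hj.1.1
      push_cast at this
      nlinarith [k.2]
    · have h1 := hj.1.2
      have h2 : ((k : ℕ) : ℝ) + 1 ≤ m := by exact_mod_cast k.2
      push_cast at h1
      nlinarith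
  have hFE : ∀ ω, Separated h ((n + 1) * m) (A ω) → (∀ k, 0 < (A ω k).2) → ω ∈ F → ω ∈ E := by
    intro ω h1 h2 h3 j hj
    obtain ⟨k, hk, hjk⟩ := exists_mem_slice hh (h2 j) (hnh' ▸ hj.2)
    have h4 : n * m ≤ k := by
      have h5 : ((n * m : ℕ) : ℝ) * h < (k + 1) * h := hnh ▸ (hj.1.trans_le hjk.2)
      have h6 : ((n * m : ℕ) : ℝ) < k + 1 := lt_of_mul_lt_mul_right h5 hh.le
      have h7 : n * m < k + 1 := by exact_mod_cast h6
      omega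
    have h5 := h3 ⟨k - n * m, by rw [Nat.add_mul, one_mul] at hk; omega⟩
    have h6 : n * m + (k - n * m) = k := by omega
    simp only [h6] at h5
    rw [(h1.uniq hk hjk).slotOf_eq] at h5
    have h7 := congrArg (fun e : V × ℝ × ℝ => e.2.1) h5
    exact (h2 j).ne' h7
  have hae : ∀ᵐ ω ∂P, (∀ k, 0 < (A ω k).2) ∧ LocFin (joinData (I ω) (A ω) (R ω)) :=
    D.arrival_pos.and D.locFin
  have h1 : P.real H ≤ P.real H' + P.real G := by
    refine le_trans (ENNReal.toReal_mono (measure_ne_top _ _) (measure_mono_ae ?_))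
      (measureReal_union_le H' G)
    filter_upwards [hae] with ω hω hH
    by_cases hs : Separated h ((n + 1) * m) (A ω)
    · exact Or.inl ((hbirth ω hs hω.1 hω.2).1 hH)
    · exact Or.inr hs
  have h2 : P.real (H' ∩ F) ≤ P.real (H ∩ E) + P.real G := by
    refine le_trans (ENNReal.toReal_mono (measure_ne_top _ _) (measure_mono_ae ?_))
      (measureReal_union_le (H ∩ E) G)
    filter_upwards [hae] with ω hω hH
    by_cases hs : Separated h ((n + 1) * m) (A ω)
    · exact Or.inl ⟨(hbirth ω hs hω.1 hω.2).2 hH.1, hFE ω hs hω.1 hH.2⟩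
    · exact Or.inr hs
  have h3 : Real.exp (-(θ * K)) ≤ P.real F := by
    rw [← D.prob_noArrival hK.le n]
    exact measureReal_mono hEF
  have h4 : Real.exp (-(θ * K)) * (P.real H - b) ≤ P.real H' * P.real F := by
    rw [mul_comm]
    calc (P.real H - b) * Real.exp (-(θ * K)) ≤ P.real H' * Real.exp (-(θ * K)) := by
          gcongr; linarith
      _ ≤ _ := by gcongr
  change Real.exp (-(θ * K)) * (P.real H - b) - b ≤ P.real (H ∩ E)
  linarith

lemma tendsto_mul_sq_div (c : ℝ) (n : ℕ) : Filter.Tendsto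
    (fun m : ℕ => ((n * m : ℕ) : ℝ) * (c / m) ^ 2) Filter.atTop (nhds 0) := by
  have h1 : Filter.Tendsto (fun m : ℕ => (n * c ^ 2) / (m : ℝ)) Filter.atTop (nhds 0) :=
    tendsto_const_div_atTop_nhds_zero_nat _
  refine h1.congr fun m => ?_
  rcases eq_or_ne m 0 with rfl | hm
  · simp
  · have : (m : ℝ) ≠ 0 := by exact_mod_cast hm
    push_cast
    field_simp

/-- Independence of past and future is exact for slots; the collision errors vanish as the mesh `K /
m` tends to `0`. -/
lemma prob_noArrival_inter_ge (D : Driven ν ρ θ I A R P) (hw : Measurable w) (hg : IsRate g)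
    {K v : ℝ} (hK : 0 < K) (hv : 0 ≤ v) (M : ℝ≥0∞) (n : ℕ) :
    Real.exp (-(θ * K)) * P.real {ω | Busy w g K n (joinData (I ω) (A ω) (R ω)) ∧
        Quiet w g v (n * K) M (joinData (I ω) (A ω) (R ω))} ≤
      P.real {ω | (Busy w g K n (joinData (I ω) (A ω) (R ω)) ∧
        Quiet w g v (n * K) M (joinData (I ω) (A ω) (R ω))) ∧ ∀ k, (A ω k).2 ∉ slice K n} := by
  have h1 := tendsto_mul_sq_div (θ * K) (n + 1)
  simp only [mul_div_assoc] at h1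
  have h2 := (((tendsto_const_nhds (x := P.real {ω | Busy w g K n (joinData (I ω) (A ω) (R ω)) ∧
        Quiet w g v (n * K) M (joinData (I ω) (A ω) (R ω))})).sub h1).const_mul
        (Real.exp (-(θ * K)))).sub h1
  rw [sub_zero, sub_zero] at h2
  refine le_of_tendsto h2 ?_
  filter_upwards [Filter.eventually_gt_atTop 0] with m hm
  exact D.prob_noArrival_inter_ge_aux hw hg hK hv M n m hm

/-- The probability of being busy decreases geometrically, up to the probability of not being
quiet. -/
lemma prob_busy_succ_le (D : Driven ν ρ θ I A R P) (hw : Measurable w) (hw1 : ∀ x, w x ≤ 1)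
    (hg : IsRate g) {K v : ℝ} (hK : 0 < K) (hv : 0 ≤ v) {M : ℝ≥0∞}
    (hKv : ENNReal.ofReal v ≤ g M * ENNReal.ofReal K) {ε : ℝ} (n : ℕ)
    (hε : P.real {ω | ¬ Quiet w g v (n * K) M (joinData (I ω) (A ω) (R ω))} ≤ ε) :
    P.real {ω | Busy w g K (n + 1) (joinData (I ω) (A ω) (R ω))} ≤
      P.real {ω | Busy w g K n (joinData (I ω) (A ω) (R ω))} - Real.exp (-(θ * K)) *
        (P.real {ω | Busy w g K n (joinData (I ω) (A ω) (R ω))} - ε) := by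
  have h1 := D.prob_noArrival_inter_ge hw hg hK hv M n
  set B : Set Ω := {ω | Busy w g K n (joinData (I ω) (A ω) (R ω))}
  set B' : Set Ω := {ω | Busy w g K (n + 1) (joinData (I ω) (A ω) (R ω))}
  set N : Set Ω := {ω | ¬ Quiet w g v (n * K) M (joinData (I ω) (A ω) (R ω))}
  set H : Set Ω := {ω | Busy w g K n (joinData (I ω) (A ω) (R ω)) ∧
        Quiet w g v (n * K) M (joinData (I ω) (A ω) (R ω))}
  set E : Set Ω := {ω | (Busy w g K n (joinData (I ω) (A ω) (R ω)) ∧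
        Quiet w g v (n * K) M (joinData (I ω) (A ω) (R ω))) ∧ ∀ k, (A ω k).2 ∉ slice K n}
  have hB' : MeasurableSet B' := D.measurable_full (measurableSet_busy hw hg K (n + 1))
  have h2 : P.real B ≤ P.real H + P.real N := by
    refine le_trans (measureReal_mono fun ω hω => ?_) (measureReal_union_le H N)
    by_cases hq : Quiet w g v (n * K) M (joinData (I ω) (A ω) (R ω))
    · exact Or.inl ⟨hω, hq⟩
    · exact Or.inr hq
  -- Still busy one period later, and quiet without arrivals during that period, are almost surely
  -- exclusive events, both contained in `B`.
  have h3 : P.real B' + P.real E ≤ P.real B := by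
    have h4 : P (B' ∪ E) = P B' + P E := by
      refine measure_union₀' hB'.nullMeasurableSet ?_
      refine measure_mono_null (t := {ω | ¬ LocFin (joinData (I ω) (A ω) (R ω))}) ?_
        (ae_iff.1 D.locFin)
      rintro ω ⟨hω, hω'⟩ hloc
      exact not_busy_of_quiet hw hw1 hg hloc (D.init_birth ω) hK.le hv hKv hω'.1.2 hω'.2 hω
    rw [measureReal_def, measureReal_def, measureReal_def,
      ← ENNReal.toReal_add (measure_ne_top _ _) (measure_ne_top _ _), ← h4]
    refine ENNReal.toReal_mono (measure_ne_top _ _) (measure_mono ?_)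
    rintro ω (hω | hω)
    · exact fun j hj => hω j (hj.trans (Nat.le_succ n))
    · exact hω.1.1
  have h5 : Real.exp (-(θ * K)) * (P.real B - ε) ≤ Real.exp (-(θ * K)) * P.real H := by
    gcongr
    linarith
  linarith

/-- With `δ = exp (-(θ * K))` the recursion is `p (n + 1) ≤ (1 - δ) * p n + δ * ε`, whose fixed
point is `ε`. -/
lemma prob_busy_le (D : Driven ν ρ θ I A R P) (hw : Measurable w) (hw1 : ∀ x, w x ≤ 1)
    (hg : IsRate g) {K v : ℝ} (hK : 0 < K) (hv : 0 ≤ v) {M : ℝ≥0∞}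
    (hKv : ENNReal.ofReal v ≤ g M * ENNReal.ofReal K) {ε : ℝ}
    (hε : ∀ n : ℕ, P.real {ω | ¬ Quiet w g v (n * K) M (joinData (I ω) (A ω) (R ω))} ≤ ε) (n : ℕ) :
    P.real {ω | Busy w g K n (joinData (I ω) (A ω) (R ω))} ≤
      (1 - Real.exp (-(θ * K))) ^ n + ε := by
  have hδ : Real.exp (-(θ * K)) ≤ 1 :=
    Real.exp_le_one_iff.2 (by have := mul_nonneg D.rate_nonneg hK.le; linarith)
  have hε0 : 0 ≤ ε := measureReal_nonneg.trans (hε 0)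
  induction n with
  | zero =>
    rw [pow_zero]
    exact measureReal_le_one.trans (by linarith)
  | succ n ih =>
    refine (D.prob_busy_succ_le hw hw1 hg hK hv hKv n (hε n)).trans ?_
    rw [pow_succ]
    nlinarith

lemma exists_prob_busy_le (D : Driven ν ρ θ I A R P) (hw : Measurable w) (hw1 : ∀ x, w x ≤ 1)
    (hg : IsRate g) {v : ℝ} (hv : 0 ≤ v) {M : ℝ≥0∞} (hM : M ≠ ∞) {ε : ℝ} (hε0 : 0 < ε)
    (hε : ∀ s : ℝ, 0 ≤ s → P.real {ω | ¬ Quiet w g v s M (joinData (I ω) (A ω) (R ω))} ≤ ε) :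
    ∃ K : ℝ, 0 < K ∧ ∃ n : ℕ, P.real {ω | Busy w g K n (joinData (I ω) (A ω) (R ω))} ≤ 2 * ε := by
  have hgM := hg.pos M hM
  have hgM' : g M ≠ ∞ := ((hg.le M).trans_lt hg.lt_top).ne
  have h0 : 0 < (g M).toReal := ENNReal.toReal_pos hgM.ne' hgM'
  -- Long enough to send `v` bits at rate `g M`; the summand `1` keeps `K` positive when `v = 0`.
  set K := v / (g M).toReal + 1
  have hK : 0 < K := by positivity
  have hKv : ENNReal.ofReal v ≤ g M * ENNReal.ofReal K := by
    rw [← ENNReal.ofReal_toReal hgM', ← ENNReal.ofReal_mul h0.le]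
    refine ENNReal.ofReal_le_ofReal ?_
    rw [mul_add, mul_div_cancel₀ _ h0.ne']
    linarith
  obtain ⟨n, hn⟩ := exists_pow_lt_of_lt_one hε0 (y := 1 - Real.exp (-(θ * K)))
    (by have := Real.exp_pos (-(θ * K)); linarith)
  refine ⟨K, hK, n, ?_⟩
  have := D.prob_busy_le hw hw1 hg hK hv hKv (fun n => hε _ (by positivity)) n
  linarith

end Driven

end Driven

/-! ### Pair counts and their monotonicity -/

section Pairs

variable [AddCommGroup V] {w : V → ℝ≥0∞} {g : ℝ≥0∞ → ℝ≥0∞}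

open Classical in
/-- Number of ordered pairs of links alive at time `t` with relative position in `B`. -/
def pairSum (w : V → ℝ≥0∞) (g : ℝ≥0∞ → ℝ≥0∞) (t : ℝ) (B : Set V) (z : ι → V × ℝ × ℝ) : ℝ≥0∞ :=
  ∑' p, ∑' q, if (p ≠ q ∧ Alive w g z p t) ∧ Alive w g z q t ∧ (z q).1 - (z p).1 ∈ B then 1 else 0

lemma ofReal_total {m : ℕ} (t : ℝ) (z : Fin m → V × ℝ × ℝ) :
    ENNReal.ofReal (total w g t z) = count w g z t := by
  rw [total, count, tsum_fintype, ENNReal.ofReal_sum_of_nonneg fun k _ => (aliveInd_mem t k z).1]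
  refine Finset.sum_congr rfl fun k _ => ?_
  unfold aliveInd
  split_ifs <;> simp

lemma ofReal_pairCount_le {m : ℕ} (t : ℝ) (B : Set V) (z : Fin m → V × ℝ × ℝ) :
    ENNReal.ofReal (pairCount w g t B z) ≤ pairSum w g t B z := by
  classical
  rw [pairCount, pairSum, tsum_fintype, ENNReal.ofReal_sum_of_nonneg fun k _ =>
    mul_nonneg (aliveInd_mem t k z).1 (nearOthers_nonneg t B k z)]
  refine Finset.sum_le_sum fun k _ => ?_
  rw [tsum_fintype, ENNReal.ofReal_mul (aliveInd_mem t k z).1, nearOthers,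
    ENNReal.ofReal_sum_of_nonneg fun j _ => ?_, Finset.mul_sum]
  · refine (Finset.sum_le_sum fun j hj => ?_).trans
      (Finset.sum_le_sum_of_subset (Finset.erase_subset k _))
    have hjk : k ≠ j := (Finset.ne_of_mem_erase hj).symm
    unfold aliveInd
    split_ifs <;> simp_all
  · split_ifs
    exacts [(aliveInd_mem t j z).1, le_rfl]

lemma exists_embeds_slots_joinData {h : ℝ} (hh : 0 < h) (m : ℕ) (i : ℕ → V × ℝ × ℝ)
    (a : ℕ → V × ℝ) (r : ℕ → ℝ) : ∃ e, Embeds e 0 (slots h m a r) (joinData i a r) := by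
  obtain ⟨e, he⟩ := exists_embeds_slots hh m a r
  refine ⟨fun k => Sum.inr (e k), fun k hk k' hk' hkk' => ?_, fun k hk => (he i).pos (Sum.inr k) hk,
    fun k hk => (he i).birth (Sum.inr k) hk, fun k hk => (he i).size (Sum.inr k) hk⟩
  exact Sum.inr.inj ((he i).inj (show Sum.inr k ∈ _ from hk) (show Sum.inr k' ∈ _ from hk') hkk')

variable [Countable ι] [Countable κ] [MeasurableSpace V] [MeasurableSub₂ V]

lemma Embeds.pairSum_le (hw : Measurable w) (hg : IsRate g) {z : ι → V × ℝ × ℝ}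
    {z' : κ → V × ℝ × ℝ} (hz : LocFin z) {e : ι → κ} {y : V} (he : Embeds e y z z') (t : ℝ)
    (B : Set V) : pairSum w g t B z ≤ pairSum w g t B z' := by
  classical
  refine tsum_le_tsum_of_injOn (S := {i | Alive w g z i t}) (he.inj.mono fun i hi => hi.1)
    (fun p hp => ?_) fun p hp => ?_
  · refine ENNReal.tsum_eq_zero.2 fun q => if_neg fun h => hp h.1.2
  · refine tsum_le_tsum_of_injOn (S := {i | Alive w g z i t}) (he.inj.mono fun i hi => hi.1)
      (fun q hq => if_neg fun h => hq h.2.1) fun q hq => ?_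
    by_cases h : (p ≠ q ∧ Alive w g z p t) ∧ Alive w g z q t ∧ (z q).1 - (z p).1 ∈ B
    · rw [if_pos h, if_pos]
      refine ⟨⟨fun h' => h.1.1 (he.inj hp.1 hq.1 h'), he.alive hw hg hz hp⟩,
        he.alive hw hg hz hq, ?_⟩
      rw [he.pos p hp.1, he.pos q hq.1, add_sub_add_right_eq_sub]
      exact h.2.2
    · rw [if_neg h]
      exact zero_le

/-- If the system is empty at some time, the links alive later are those of the slots. -/
lemma count_eq_count_slots (hw : Measurable w) (hg : IsRate g) {i : ℕ → V × ℝ × ℝ}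
    {a : ℕ → V × ℝ} {r : ℕ → ℝ} (hz : LocFin (joinData i a r)) (hi : ∀ j, (i j).2.1 = 0)
    (hpos : ∀ n, 0 < (a n).2) {h : ℝ} (hh : 0 < h) {m : ℕ} (hm : 0 < m) (hsep : Separated h m a)
    {s : ℝ} (hs : 0 ≤ s) (hsm : s ≤ m * h) (hempty : count w g (joinData i a r) s = 0) :
    count w g (joinData i a r) (m * h) = count w g (slots h m a r) (m * h) := by
  refine le_antisymm ?_ ?_
  · have H : ∀ p : ℕ ⊕ ℕ, ∃ k : Fin m, ∀ n, p = Sum.inr n → (a n).2 ≤ m * h →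
        (a n).2 ∈ slice h k ∧ slots h m a r k = ((a n).1, (a n).2, r n) := by
      rintro (j | n)
      -- Slot `0` is a dummy value: initial links are gone at the empty time `s` and never need a
      -- match.
      · exact ⟨⟨0, hm⟩, by simp⟩
      · by_cases hn : (a n).2 ≤ m * h
        · obtain ⟨k, hk⟩ := exists_slot hh hsep hpos r hn
          refine ⟨k, fun n' hn' _ => ?_⟩
          obtain rfl := Sum.inr.inj hn'
          exact hk
        · refine ⟨⟨0, hm⟩, fun n' hn' h' => ?_⟩
          obtain rfl := Sum.inr.inj hn'
          exact absurd h' hn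
    choose e he using H
    have hinr : ∀ p, 0 < (joinData i a r p).2.2 → s < (joinData i a r p).2.1 →
        (joinData i a r p).2.1 ≤ m * h → ∃ n, p = Sum.inr n ∧ (a n).2 ≤ m * h := by
      rintro (j | n) - h2 h3
      · simp only [joinData, Sum.elim_inl, hi j] at h2
        exact absurd h2 (not_lt.2 hs)
      · exact ⟨n, rfl, h3⟩
    have hinj : InjOn e {p | 0 < (joinData i a r p).2.2 ∧ s < (joinData i a r p).2.1 ∧
        (joinData i a r p).2.1 ≤ m * h} := by
      rintro p hp p' hp' hpp'
      obtain ⟨n, rfl, hn⟩ := hinr p hp.1 hp.2.1 hp.2.2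
      obtain ⟨n', rfl, hn'⟩ := hinr p' hp'.1 hp'.2.1 hp'.2.2
      have h1 := (he _ n rfl hn).1
      have h2 := (he _ n' rfl hn').1
      rw [← hpp'] at h2
      exact congrArg _ (hsep _ (e _).2 n' n h2 h1)
    have hmatch : ∀ p, 0 < (joinData i a r p).2.2 → s < (joinData i a r p).2.1 →
        (joinData i a r p).2.1 ≤ m * h → (slots h m a r (e p)).1 = (joinData i a r p).1 + 0 ∧
        (slots h m a r (e p)).2.1 = (joinData i a r p).2.1 ∧
        (joinData i a r p).2.2 ≤ (slots h m a r (e p)).2.2 := by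
      intro p h1 h2 h3
      obtain ⟨n, rfl, hn⟩ := hinr p h1 h2 h3
      rw [(he _ n rfl hn).2]
      simp [joinData]
    have key := fun p => alive_of_empty (i := p) hw hg hz hsm (count_eq_zero_iff.1 hempty)
      (z' := slots h m a r) e 0 hinj hmatch
    refine count_le_count (e := e) (fun p hp p' hp' hpp' => ?_) fun p hp => (key p hp).2
    exact hinj ⟨hp.1, (key p hp).1, hp.2.1⟩ ⟨hp'.1, (key p' hp').1, hp'.2.1⟩ hpp'
  · obtain ⟨e, he⟩ := exists_embeds_slots_joinData hh m i a r
    exact he.count_le hw hg (locFin_fin _) _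

lemma pairSum_slots_le (hw : Measurable w) (hg : IsRate g) {h : ℝ} (hh : 0 < h) (m : ℕ)
    (i : ℕ → V × ℝ × ℝ) (a : ℕ → V × ℝ) (r : ℕ → ℝ) (t : ℝ) (B : Set V) :
    pairSum w g t B (slots h m a r) ≤ pairSum w g t B (joinData i a r) := by
  obtain ⟨e, he⟩ := exists_embeds_slots_joinData hh m i a r
  exact he.pairSum_le hw hg (locFin_fin _) t B

end Pairs

/-! ### Lower bound for the mean number of close pairs -/

section LowerBound

variable {Ω : Type*} [MeasurableSpace Ω] [MeasurableSpace V] [AddCommGroup V]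
  {ν : Measure (V × ℝ)} {ρ : Measure ℝ} {θ : ℝ} {I : Ω → ℕ → V × ℝ × ℝ}
  {A : Ω → ℕ → V × ℝ} {R : Ω → ℕ → ℝ} {P : Measure Ω} [IsProbabilityMeasure P]
  [IsProbabilityMeasure ρ] {w : V → ℝ≥0∞} {g : ℝ≥0∞ → ℝ≥0∞} [MeasurableSub₂ V]
  [MeasurableSingletonClass V] [MeasurableAdd V]

/-- `x` if `x ≤ M`, `0` otherwise. -/
def cutoff (M : ℝ) (x : ℝ≥0∞) : ℝ := if x ≤ ENNReal.ofReal M then x.toReal else 0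

lemma cutoff_mem {M : ℝ} (hM : 0 ≤ M) (x : ℝ≥0∞) : cutoff M x ∈ Icc 0 M := by
  unfold cutoff
  split_ifs with h
  · exact ⟨ENNReal.toReal_nonneg, ENNReal.toReal_le_of_le_ofReal hM h⟩
  · exact ⟨le_rfl, hM⟩

lemma measurable_cutoff (M : ℝ) : Measurable (cutoff M) :=
  Measurable.ite measurableSet_Iic ENNReal.measurable_toReal measurable_const

lemma cutoff_ofReal {M x : ℝ} (hM : 0 ≤ M) (hx : 0 ≤ x) :
    cutoff M (ENNReal.ofReal x) = if x ≤ M then x else 0 := by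
  simp only [cutoff, ENNReal.ofReal_le_ofReal_iff hM, ENNReal.toReal_ofReal hx]

lemma ofReal_integral_le {μ : Measure Ω} {f : Ω → ℝ} (hf : Measurable f) (h0 : ∀ x, 0 ≤ f x) :
    ENNReal.ofReal (∫ x, f x ∂μ) ≤ ∫⁻ x, ENNReal.ofReal (f x) ∂μ := by
  rw [integral_eq_lintegral_of_nonneg_ae (Filter.Eventually.of_forall h0) hf.aestronglyMeasurable]
  exact ENNReal.ofReal_toReal_le

namespace Driven

/-- If the system was empty at one of the times `j * K` and no slots collide, the slot system has
the same number of links at the end. Each of the two exceptional events costs at most `M`. -/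
lemma integral_cutoff_le (D : Driven ν ρ θ I A R P) (hw : Measurable w) (hg : IsRate g)
    {K : ℝ} (hK : 0 < K) {n : ℕ} {h : ℝ} (hh : 0 < h) {m : ℕ} (hm : 0 < m)
    (hmh : m * h = n * K) {M : ℝ} (hM : 0 ≤ M) :
    ∫ ω, cutoff M (count w g (joinData (I ω) (A ω) (R ω)) (n * K)) ∂P -
      M * (P.real {ω | Busy w g K n (joinData (I ω) (A ω) (R ω))} + m * (θ * h) ^ 2) ≤
    ∫ ω, cutoff M (count w g (slots h m (A ω) (R ω)) (n * K)) ∂P := by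
  classical
  set B : Set Ω := {ω | Busy w g K n (joinData (I ω) (A ω) (R ω))}
  have hB : MeasurableSet B := D.measurable_full (measurableSet_busy hw hg K n)
  set G : Set Ω := {ω | ¬ Separated h m (A ω)}
  have hG : P.real G ≤ m * (θ * h) ^ 2 := D.measure_not_separated_le hh.le m
  -- A measurable hull of the same probability, so that its indicator can be integrated.
  set G' := toMeasurable P G
  have hG'm : MeasurableSet G' := measurableSet_toMeasurable _ _
  have hG' : P.real G' = P.real G := by rw [measureReal_def, measure_toMeasurable, measureReal_def]
  set f := fun ω => cutoff M (count w g (joinData (I ω) (A ω) (R ω)) (n * K))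
  set f' := fun ω => cutoff M (count w g (slots h m (A ω) (R ω)) (n * K))
  have hf : Integrable f P := integrable_of_mem_Icc ((measurable_cutoff M).comp
    ((measurable_count hw hg _).comp D.measurable_full)) fun ω => cutoff_mem hM _
  have hf' : Integrable f' P := integrable_of_mem_Icc ((measurable_cutoff M).comp
    ((measurable_count hw hg _).comp (D.measurable_slots h m))) fun ω => cutoff_mem hM _
  have h1 : Integrable (fun ω => f' ω + (B.indicator (fun _ => M) ω + G'.indicator (fun _ => M) ω))
      P := hf'.add (((integrable_const M).indicator hB).add ((integrable_const M).indicator hG'm))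
  have h2 : ∫ ω, f ω ∂P ≤
      ∫ ω, (f' ω + (B.indicator (fun _ => M) ω + G'.indicator (fun _ => M) ω)) ∂P := by
    refine integral_mono_ae hf h1 ?_
    filter_upwards [D.arrival_pos, D.locFin] with ω hpos hloc
    have h3 : 0 ≤ B.indicator (fun _ => M) ω := indicator_nonneg (fun _ _ => hM) _
    have h4 : 0 ≤ G'.indicator (fun _ => M) ω := indicator_nonneg (fun _ _ => hM) _
    have h5 : 0 ≤ f' ω := (cutoff_mem hM _).1
    have h6 : f ω ≤ M := (cutoff_mem hM _).2
    by_cases hb : ω ∈ B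
    · rw [indicator_of_mem hb] at h3 ⊢
      linarith
    by_cases hs : ω ∈ G
    · have hs' : ω ∈ G' := subset_toMeasurable P G hs
      rw [indicator_of_mem hs'] at h4 ⊢
      linarith
    · have hs' : Separated h m (A ω) := not_not.1 hs
      have hb' : ¬ Busy w g K n (joinData (I ω) (A ω) (R ω)) := hb
      unfold Busy at hb'
      push Not at hb'
      obtain ⟨j, hj, hj0⟩ := hb'
      have h7 := count_eq_count_slots hw hg hloc (D.init_birth ω) hpos hh hm hs'
        (s := j * K) (by positivity) (by rw [hmh]; gcongr) hj0
      rw [hmh] at h7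
      have h8 : f ω = f' ω := congrArg (cutoff M) h7
      linarith
  have h9 := integral_add ((integrable_const (μ := P) M).indicator hB)
    ((integrable_const M).indicator hG'm)
  have h10 := integral_add hf' (((integrable_const M).indicator hB).add
    ((integrable_const M).indicator hG'm))
  simp only [Pi.add_apply] at h10
  rw [h10, h9, integral_indicator_const _ hB,
    integral_indicator_const _ hG'm, hG', smul_eq_mul, smul_eq_mul] at h2
  nlinarith

/-- The independent slots satisfy `integral_pairCount_ge`, and dropping the other links only removes
pairs. The mean total and its truncated version are both replaced by the common lower bound `x`. -/
lemma pairSum_ge_aux (D : Driven ν ρ θ I A R P) (hw : Measurable w) (hg : IsRate g)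
    (hτ : ∀ y, MeasurePreserving (fun p : V × ℝ => (p.1 + y, p.2)) ν ν)
    {t h : ℝ} (hh : 0 < h) {m : ℕ} {M : ℝ} (hM : 0 < M) {B : Set V} (hB : MeasurableSet B)
    (vol : Measure V) [IsFiniteMeasure vol] (hvol : 0 < vol.real univ) {b : ℝ}
    (hb : ∀ x, vol.real {y | x - y ∈ B} = b) {x : ℝ} (hx0 : 0 ≤ x)
    (hx : x ≤ ∫ ω, cutoff M (count w g (slots h m (A ω) (R ω)) t) ∂P) :
    ENNReal.ofReal (x * (b / vol.real univ * x - M * (θ * h)) - M * m ^ 2 * (θ * h) ^ 3) ≤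
      ∫⁻ ω, pairSum w g t B (joinData (I ω) (A ω) (R ω)) ∂P := by
  set μ : Fin m → Measure (V × ℝ × ℝ) := fun k => P.map fun ω => slotOf h k (A ω) (R ω)
  have hμ : ∀ k, IsProbabilityMeasure (μ k) := fun k =>
    Measure.isProbabilityMeasure_map (D.marked.measurable_slotOf h k).aemeasurable
  have hZ := D.measurable_slots h m
  have hpi : Measure.pi μ = P.map fun ω => slots h m (A ω) (R ω) :=
    (D.marked.map_slots_eq_pi hh m).symm
  have hθ : 0 ≤ θ * h := mul_nonneg D.rate_nonneg hh.le
  have hνk : ∀ k : ℕ, ν (univ ×ˢ slice h k) ≠ ∞ := fun k => by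
    rw [D.measure_slice hh.le]; exact ENNReal.ofReal_ne_top
  have hq : ∀ k, (μ k).real {0}ᶜ ≤ θ * h := by
    intro k
    refine ENNReal.toReal_le_of_le_ofReal hθ ?_
    rw [Measure.map_apply (D.marked.measurable_slotOf h k) (measurableSet_singleton 0).compl,
      ← D.measure_slice hh.le k]
    exact D.marked.measure_slotOf_ne_zero_le k (hνk k)
  have hmain := integral_pairCount_ge hw hg t hB μ
    (fun k y => D.marked.map_slotOf_shift hh k (hνk k) y (hτ y)) hq hM vol hvol hb
  have hmt := measurable_total (m := m) hw hg t
  have hmi : Measurable ({z : Fin m → V × ℝ × ℝ | total w g t z ≤ M}.indicator (total w g t)) :=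
    hmt.indicator (hmt measurableSet_Iic)
  rw [hpi, integral_map hZ.aemeasurable hmt.aestronglyMeasurable,
    integral_map hZ.aemeasurable hmi.aestronglyMeasurable,
    integral_map hZ.aemeasurable (measurable_pairCount hw hg t hB).aestronglyMeasurable] at hmain
  have hcut : ∀ ω, cutoff M (count w g (slots h m (A ω) (R ω)) t) =
      {z : Fin m → V × ℝ × ℝ | total w g t z ≤ M}.indicator (total w g t)
        (slots h m (A ω) (R ω)) := by
    intro ω
    rw [← ofReal_total, cutoff_ofReal hM.le (total_nonneg _ _)]
    simp only [indicator, mem_ofPred_eq]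
  simp only [hcut] at hx
  set T' := ∫ ω, {z : Fin m → V × ℝ × ℝ | total w g t z ≤ M}.indicator (total w g t)
    (slots h m (A ω) (R ω)) ∂P
  set T := ∫ ω, total w g t (slots h m (A ω) (R ω)) ∂P
  have hT : T' ≤ T := by
    refine integral_mono_of_nonneg (Filter.Eventually.of_forall fun ω =>
      indicator_nonneg (fun _ _ => total_nonneg _ _) _) (integrable_of_mem_Icc (hmt.comp hZ)
      fun ω => ⟨total_nonneg _ _, total_le _ _⟩) (Filter.Eventually.of_forall fun ω => ?_)
    exact indicator_le_self' (fun _ _ => total_nonneg _ _) _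
  have hb0 : 0 ≤ b := by rw [← hb 0]; exact measureReal_nonneg
  have hc : 0 ≤ b / vol.real univ := div_nonneg hb0 hvol.le
  set c := b / vol.real univ
  have hpair : ENNReal.ofReal (∫ ω, pairCount w g t B (slots h m (A ω) (R ω)) ∂P) ≤
      ∫⁻ ω, pairSum w g t B (joinData (I ω) (A ω) (R ω)) ∂P := by
    refine (ofReal_integral_le ((measurable_pairCount hw hg t hB).comp hZ)
      fun ω => pairCount_nonneg _ _ _).trans (lintegral_mono fun ω => ?_)
    exact (ofReal_pairCount_le t B _).trans (pairSum_slots_le hw hg hh m (I ω) (A ω) (R ω) t B)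
  have herr : 0 ≤ M * m ^ 2 * (θ * h) ^ 3 := by positivity
  -- The product is monotone in `x` only while this factor is non-negative; otherwise the left-hand
  -- side is `0`.
  by_cases hneg : c * x - M * (θ * h) ≤ 0
  · rw [ENNReal.ofReal_of_nonpos]
    · exact zero_le
    · have := mul_nonpos_of_nonneg_of_nonpos hx0 hneg
      linarith
  · push Not at hneg
    refine le_trans (ENNReal.ofReal_le_ofReal ?_) hpair
    refine le_trans ?_ hmain
    have h1 : c * x - M * (θ * h) ≤ c * T' - M * (θ * h) := by gcongr
    have h2 : x * (c * x - M * (θ * h)) ≤ T * (c * T' - M * (θ * h)) :=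
      mul_le_mul (hx.trans hT) h1 hneg.le (hx0.trans (hx.trans hT))
    linarith

/-- Lower bound for the mean number of pairs at distance in `B`. -/
theorem pairSum_ge (D : Driven ν ρ θ I A R P) (hw : Measurable w) (hg : IsRate g)
    (hτ : ∀ y, MeasurePreserving (fun p : V × ℝ => (p.1 + y, p.2)) ν ν)
    {K : ℝ} (hK : 0 < K) {n : ℕ} (hn : 0 < n) {M : ℝ} (hM : 0 < M) {B : Set V}
    (hB : MeasurableSet B)
    (vol : Measure V) [IsFiniteMeasure vol] (hvol : 0 < vol.real univ) {b : ℝ}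
    (hb : ∀ x, vol.real {y | x - y ∈ B} = b) {a u : ℝ}
    (ha : a ≤ ∫ ω, cutoff M (count w g (joinData (I ω) (A ω) (R ω)) (n * K)) ∂P)
    (hu : P.real {ω | Busy w g K n (joinData (I ω) (A ω) (R ω))} ≤ u) :
    ENNReal.ofReal (max (a - M * u) 0 * (b / vol.real univ * max (a - M * u) 0)) ≤
      ∫⁻ ω, pairSum w g (n * K) B (joinData (I ω) (A ω) (R ω)) ∂P := by
  obtain ⟨T, hT_def⟩ : ∃ T : ℝ, T = n * K := ⟨_, rfl⟩
  have hT : 0 < T := hT_def ▸ mul_pos (by exact_mod_cast hn) hK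
  have e0 := tendsto_const_div_atTop_nhds_zero_nat (θ * T)
  have e1 : Filter.Tendsto (fun m : ℕ => (m : ℝ) * (θ * (T / m)) ^ 2) Filter.atTop (nhds 0) := by
    have := tendsto_mul_sq_div (θ * T) 1
    simp only [one_mul, mul_div_assoc] at this
    exact this
  -- The summed Harris error, here of order `1 / m`.
  have e2 : Filter.Tendsto (fun m : ℕ => (m : ℝ) ^ 2 * (θ * (T / m)) ^ 3) Filter.atTop
      (nhds 0) := by
    have := e1.mul_const (θ * T)
    rw [zero_mul] at this
    refine this.congr fun m => ?_
    rcases eq_or_ne m 0 with rfl | hm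
    · simp
    · have : (m : ℝ) ≠ 0 := by exact_mod_cast hm
      field_simp
  simp only [mul_div_assoc] at e0
  have e3 : Filter.Tendsto (fun m : ℕ => max (a - M * (u + m * (θ * (T / m)) ^ 2)) 0)
      Filter.atTop (nhds (max (a - M * u) 0)) := by
    have := ((((e1.const_add u).const_mul M).const_sub a).max
      (tendsto_const_nhds (x := (0 : ℝ))))
    rwa [add_zero] at this
  have e4 := (e3.mul ((e3.const_mul (b / vol.real univ)).sub (e0.const_mul M))).sub
    (e2.const_mul M)
  simp only [mul_zero, sub_zero] at e4
  refine le_of_tendsto ((ENNReal.continuous_ofReal.tendsto _).comp e4) ?_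
  filter_upwards [Filter.eventually_gt_atTop 0] with m hm
  have hm' : (0 : ℝ) < m := by exact_mod_cast hm
  have hh : 0 < T / m := div_pos hT hm'
  have hmh : (m : ℝ) * (T / m) = n * K := by rw [← hT_def]; field_simp
  have hcut := D.integral_cutoff_le hw hg hK hh hm hmh hM.le
  have h0 : 0 ≤ ∫ ω, cutoff M (count w g (slots (T / m) m (A ω) (R ω)) (n * K)) ∂P :=
    integral_nonneg fun ω => (cutoff_mem hM.le _).1
  have := D.pairSum_ge_aux hw hg hτ (t := n * K) hh (m := m) hM hB vol hvol hb
    (x := max (a - M * (u + m * (θ * (T / m)) ^ 2)) 0) (le_max_right _ _)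
    (max_le (le_trans ?_ hcut) h0)
  · refine le_trans (le_of_eq ?_) this
    simp only [Function.comp]
    congr 2
    ring
  · have h1 : M * (P.real {ω | Busy w g K n (joinData (I ω) (A ω) (R ω))} +
        m * (θ * (T / m)) ^ 2) ≤ M * (u + m * (θ * (T / m)) ^ 2) := by gcongr
    linarith

end Driven

end LowerBound

/-! ### The network as a driven system -/

section Network

variable {Q lam L C N0 : ℝ} [Fact (0 < 2 * Q)] {l : ℝ → ℝ} {Ω : Type*} [MeasurableSpace Ω]
  {P : Measure Ω} [IsProbabilityMeasure P] {X : LinkProcess Q Ω}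

instance : (volume : Measure (Torus Q)).IsAddHaarMeasure :=
  inferInstanceAs (Measure.prod volume volume).IsAddHaarMeasure

/-- The links present at time `0`. -/
def initialLinks (X : LinkProcess Q Ω) (ω : Ω) : ℕ → Torus Q × ℝ × ℝ :=
  fun i => fullData X ω (Sum.inl i)

/-- The arriving links. -/
def arrivals (X : LinkProcess Q Ω) (ω : Ω) : ℕ → Torus Q × ℝ :=
  fun n => (X.pos (Sum.inr n) ω, X.arrival n ω)

/-- The file sizes of the arriving links. -/
def fileSizes (X : LinkProcess Q Ω) (ω : Ω) : ℕ → ℝ := fun n => X.size (Sum.inr n) ω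

lemma joinData_eq_fullData (X : LinkProcess Q Ω) (ω : Ω) :
    joinData (initialLinks X ω) (arrivals X ω) (fileSizes X ω) = fullData X ω := by
  funext p
  rcases p with i | n
  · rfl
  · simp [joinData, arrivals, fileSizes, fullData, LinkProcess.Present, LinkProcess.birth]

/-- The intensity measure of the arrivals. -/
def arrivalIntensity (Q lam : ℝ) [Fact (0 < 2 * Q)] : Measure (Torus Q × ℝ) :=
  ENNReal.ofReal lam • (volume : Measure (Torus Q)).prod (volume.restrict (Ioi (0 : ℝ)))

lemma arrivalIntensity_prod (s : Set ℝ) (hs : MeasurableSet s) :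
    arrivalIntensity Q lam (univ ×ˢ s) =
      ENNReal.ofReal lam * (volume (univ : Set (Torus Q)) * volume (s ∩ Ioi 0)) := by
  rw [arrivalIntensity, Measure.smul_apply, Measure.prod_prod, Measure.restrict_apply hs,
    smul_eq_mul]

lemma measurePreserving_arrivalIntensity (y : Torus Q) :
    MeasurePreserving (fun p : Torus Q × ℝ => (p.1 + y, p.2)) (arrivalIntensity Q lam)
      (arrivalIntensity Q lam) := by
  have h1 : MeasurePreserving (fun x : Torus Q => x + y) volume volume :=
    measurePreserving_add_right volume y
  exact (h1.prod (MeasurePreserving.id (volume.restrict (Ioi (0 : ℝ))))).smul_measure _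

namespace IsBirthDeath

lemma ae_size_pos (hL : 0 < L) (hX : X.IsBirthDeath lam L C N0 l P) :
    ∀ᵐ ω ∂P, ∀ p, 0 < X.size p ω := by
  have hr : 0 < 1 / L := by positivity
  have := isProbabilityMeasure_expMeasure hr
  refine ae_all_iff.2 fun p => ?_
  have h1 := (hX.size_law p).measure_eq (p := fun x => x ∈ Iic 0) measurableSet_Iic
  have h2 : expMeasure (1 / L) {x | x ∈ Iic 0} = 0 := by
    change expMeasure (1 / L) (Iic 0) = 0
    rw [← ofReal_cdf, cdf_expMeasure_eq hr]
    simp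
  rw [h2] at h1
  filter_upwards [measure_eq_zero_iff_ae_notMem.1 h1] with ω hω
  simpa using hω

lemma ae_arrival_pos (hX : X.IsBirthDeath lam L C N0 l P) :
    ∀ᵐ ω ∂P, ∀ n, 0 < (arrivals X ω n).2 := by
  have hU : MeasurableSet ((univ : Set (Torus Q)) ×ˢ Iic (0 : ℝ)) :=
    MeasurableSet.univ.prod measurableSet_Iic
  have hν : arrivalIntensity Q lam (univ ×ˢ Iic (0 : ℝ)) = 0 := by
    rw [arrivalIntensity_prod _ measurableSet_Iic, inter_comm, Ioi_inter_Iic, Ioc_self]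
    simp
  have h1 := measure_ne_zero_le (ν := arrivalIntensity Q lam) hX.arrivals_poisson hU
    (hν ▸ ENNReal.zero_ne_top)
  rw [hν, nonpos_iff_eq_zero] at h1
  filter_upwards [measure_eq_zero_iff_ae_notMem.1 h1] with ω hω n
  simp only [ne_eq, not_not] at hω
  rw [sum_dirac_apply _ hU, ← ENat.toENNReal_zero, ENat.toENNReal_inj, encard_eq_zero,
    eq_empty_iff_forall_notMem] at hω
  have := hω n
  simpa [arrivals] using this

lemma ae_locFin (hX : X.IsBirthDeath lam L C N0 l P) : ∀ᵐ ω ∂P, LocFin (fullData X ω) := by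
  have h : ∀ T : ℕ, ∀ᵐ ω ∂P, {n | (arrivals X ω n).2 ≤ T}.Finite := by
    intro T
    have hU : MeasurableSet ((univ : Set (Torus Q)) ×ˢ Iic (T : ℝ)) :=
      MeasurableSet.univ.prod measurableSet_Iic
    have hν : arrivalIntensity Q lam (univ ×ˢ Iic (T : ℝ)) ≠ ∞ := by
      rw [arrivalIntensity_prod _ measurableSet_Iic, inter_comm, Ioi_inter_Iic]
      exact ENNReal.mul_ne_top ENNReal.ofReal_ne_top
        (ENNReal.mul_ne_top (measure_ne_top _ _) (by simp))
    filter_upwards [ae_eval_mem_range (ν := arrivalIntensity Q lam) hX.arrivals_poisson hU hν]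
      with ω ⟨k, hk⟩
    rw [sum_dirac_apply _ hU] at hk
    have h2 : {n | (X.pos (Sum.inr n) ω, X.arrival n ω) ∈ (univ : Set (Torus Q)) ×ˢ
        Iic (T : ℝ)}.encard ≠ ⊤ := by
      intro htop
      rw [htop] at hk
      simp at hk
    refine (encard_ne_top_iff.1 h2).subset fun n hn => ⟨mem_univ _, hn⟩
  filter_upwards [ae_all_iff.2 h] with ω hω t
  obtain ⟨T, hT⟩ := exists_nat_ge t
  refine (((finite_Iio (X.initNum ω)).image Sum.inl).union ((hω T).image Sum.inr)).subset ?_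
  rintro (i | n) ⟨h1, h2⟩
  · refine Or.inl ⟨i, ?_, rfl⟩
    by_contra hi
    have : ¬ X.Present (Sum.inl i) ω := hi
    simp [fullData, this] at h1
  · exact Or.inr ⟨n, h2.trans hT, rfl⟩

lemma ae_config_eq (hL : 0 < L) (hC : 0 < C) (hN0 : 0 < N0) (hl : AntitoneOn l (Ici 0))
    (hl' : ∀ r, 0 ≤ r → 0 ≤ l r) (hl0 : l 0 = 1) (hX : X.IsBirthDeath lam L C N0 l P) :
    ∀ᵐ ω ∂P, ∀ t, X.config t ω = configOf (pathLoss l) (shannon C N0) (fullData X ω) t := by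
  filter_upwards [ae_size_pos hL hX, ae_locFin hX, hX.death_eq] with ω h1 h2 h3 t
  exact config_eq_configOf hC hN0 hl h1 h2 (isSol_fullData hC hN0 hl hl' hl0 h1 h2 h3) t

lemma measurable_arrivals (hX : X.IsBirthDeath lam L C N0 l P) : Measurable (arrivals X) :=
  measurable_pi_lambda _ fun n => (hX.measurable_pos _).prodMk (hX.measurable_arrival n)

lemma measurable_fileSizes (hX : X.IsBirthDeath lam L C N0 l P) : Measurable (fileSizes X) :=
  measurable_pi_lambda _ fun _ => hX.measurable_size _

lemma measurable_init (hX : X.IsBirthDeath lam L C N0 l P) :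
    Measurable fun ω => (X.initNum ω, fun i => X.pos (Sum.inl i) ω) :=
  hX.measurable_initNum.prodMk (measurable_pi_lambda _ fun _ => hX.measurable_pos _)

open Classical in
/-- The links at time `0` in terms of their number, positions and residual sizes. -/
def linksOf (N : ℕ) (x : ℕ → Torus Q) (s : ℕ → ℝ) : ℕ → Torus Q × ℝ × ℝ :=
  fun i => (x i, 0, if i < N then s i else 0)

lemma initialLinks_eq (X : LinkProcess Q Ω) (ω : Ω) : initialLinks X ω =
    linksOf (X.initNum ω) (fun i => X.pos (Sum.inl i) ω) (fun i => X.size (Sum.inl i) ω) := by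
  funext i
  refine Prod.ext rfl (Prod.ext rfl ?_)
  by_cases h : i < X.initNum ω
  · exact (if_pos h).trans (if_pos h).symm
  · exact (if_neg h).trans (if_neg h).symm

lemma measurable_linksOf : Measurable fun p : (ℕ × (ℕ → Torus Q)) × (ℕ → ℝ) =>
    linksOf p.1.1 p.1.2 p.2 := by
  classical
  refine measurable_pi_lambda _ fun i => ?_
  have h1 : Measurable fun p : (ℕ × (ℕ → Torus Q)) × (ℕ → ℝ) => p.1.2 i :=
    (measurable_pi_apply i).comp (measurable_snd.comp measurable_fst)
  have h2 : Measurable fun p : (ℕ × (ℕ → Torus Q)) × (ℕ → ℝ) => p.2 i :=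
    (measurable_pi_apply i).comp measurable_snd
  have h3 : MeasurableSet {p : (ℕ × (ℕ → Torus Q)) × (ℕ → ℝ) | i < p.1.1} :=
    measurableSet_lt measurable_const (measurable_fst.comp measurable_fst)
  exact h1.prodMk (measurable_const.prodMk (Measurable.ite h3 h2 measurable_const))

/-- The initial links combine positions, independent of everything else, with their residual sizes,
which come from the same i.i.d. family as the later file sizes; the blocks are regrouped
accordingly. -/
lemma indepFun_init (hX : X.IsBirthDeath lam L C N0 l P) :
    IndepFun (initialLinks X) (fun ω => (arrivals X ω, fileSizes X ω)) P := by
  have hs : Measurable fun ω i => X.size (Sum.inl i) ω :=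
    measurable_pi_lambda _ fun i => hX.measurable_size _
  have hi := hX.init_indep.comp (φ := id) (ψ := fun p : (ℕ → Torus Q × ℝ) × (ℕ ⊕ ℕ → ℝ) =>
    (p.1, (fun i => p.2 (Sum.inl i)), fun n => p.2 (Sum.inr n))) measurable_id (by fun_prop)
  have ha := hX.arrivals_indep_size.comp (φ := id) (ψ := fun p : ℕ ⊕ ℕ → ℝ =>
    ((fun i => p (Sum.inl i)), fun n => p (Sum.inr n))) measurable_id (by fun_prop)
  have h1 := indepFun_prodMk_prodMk_of_indepFun (X := fun ω =>
    (X.initNum ω, fun i => X.pos (Sum.inl i) ω)) (Y := fun ω i => X.size (Sum.inl i) ω)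
    (W := arrivals X) (U := fileSizes X) (P := P) (measurable_init hX) hs
    (measurable_arrivals hX) (measurable_fileSizes hX)
    hi ha
    (indepFun_comp_of_disjoint hX.measurable_size hX.size_indep Sum.inl Sum.inr
      (Set.disjoint_left.2 (by rintro _ ⟨i, rfl⟩ ⟨n, hn⟩; simp at hn)))
  refine (h1.comp measurable_linksOf measurable_id).congr ?_ (Filter.EventuallyEq.refl _ _)
  exact Filter.Eventually.of_forall fun ω => (initialLinks_eq X ω).symm

lemma markedPoisson (hX : X.IsBirthDeath lam L C N0 l P) :
    MarkedPoisson (arrivalIntensity Q lam) (expMeasure (1 / L)) (arrivals X) (fileSizes X) P where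
  measurable_arrivals := measurable_arrivals hX
  measurable_marks := measurable_fileSizes hX
  poisson := hX.arrivals_poisson
  indep := by
    have h := hX.arrivals_indep_size.comp (φ := id) (ψ := fun (p : ℕ ⊕ ℕ → ℝ) (n : ℕ) =>
      p (Sum.inr n)) measurable_id (by fun_prop)
    exact h
  law_marks := by
    have h1 : iIndepFun (fun n : ℕ => X.size (Sum.inr n)) P :=
      hX.size_indep.precomp Sum.inr_injective
    have h2 := (iIndepFun_iff_map_fun_eq_infinitePi_map fun n => hX.measurable_size _).1 h1
    refine h2.trans ?_
    congr 1
    funext n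
    exact (hX.size_law _).map_eq

lemma driven (hlam : 0 < lam) (hX : X.IsBirthDeath lam L C N0 l P) :
    Driven (arrivalIntensity Q lam) (expMeasure (1 / L))
      (lam * (volume : Measure (Torus Q)).real univ) (initialLinks X) (arrivals X) (fileSizes X)
      P where
  marked := markedPoisson hX
  measurable_init := by
    have : initialLinks X = fun ω => linksOf (X.initNum ω) (fun i => X.pos (Sum.inl i) ω)
        (fun i => X.size (Sum.inl i) ω) := funext fun ω => initialLinks_eq X ω
    rw [this]
    exact measurable_linksOf.comp ((measurable_init hX).prodMk
      (measurable_pi_lambda _ fun i => hX.measurable_size (Sum.inl i)))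
  indep_init := indepFun_init hX
  init_birth := fun _ _ => rfl
  rate_nonneg := by positivity
  measure_slab := by
    intro a b ha hab
    have h1 : Ioc a b ∩ Ioi 0 = Ioc a b :=
      inter_eq_left.2 fun x hx => lt_of_le_of_lt ha hx.1
    rw [arrivalIntensity_prod _ measurableSet_Ioc, h1, Real.volume_Ioc,
      ENNReal.ofReal_mul (by positivity), ENNReal.ofReal_mul hlam.le, mul_assoc,
      ofReal_measureReal]
  arrival_pos := ae_arrival_pos hX
  locFin := by
    simp only [joinData_eq_fullData]
    exact ae_locFin hX

/-- The probability that some link has more than `v` bits left is at most `e^{-v/L}` times the mean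
number of links. -/
lemma measure_residual_le (hL : 0 < L) {w : Torus Q → ℝ≥0∞} {g : ℝ≥0∞ → ℝ≥0∞} (hw : Measurable w)
    (hg : IsRate g) (hX : X.IsBirthDeath lam L C N0 l P) {v : ℝ} (hv : 0 ≤ v) (s : ℝ) :
    P {ω | ∃ p, Alive w g (shorten p v (fullData X ω)) p s} ≤
      ENNReal.ofReal (Real.exp (-(1 / L * v))) * ∫⁻ ω, count w g (fullData X ω) s ∂P := by
  classical
  have hfull : Measurable (fullData X) := by
    refine measurable_pi_lambda _ ?_
    rintro (i | n)
    · exact (hX.measurable_pos _).prodMk (measurable_const.prodMk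
        (Measurable.ite (measurableSet_lt measurable_const hX.measurable_initNum)
          (hX.measurable_size _) measurable_const))
    · exact (hX.measurable_pos _).prodMk ((hX.measurable_arrival n).prodMk
        (Measurable.ite (MeasurableSet.const _) (hX.measurable_size _) measurable_const))
  have hsum : ∫⁻ ω, count w g (fullData X ω) s ∂P =
      ∑' p, P {ω | Alive w g (fullData X ω) p s} := by
    unfold count
    have hm : ∀ p, Measurable fun ω => if Alive w g (fullData X ω) p s then (1 : ℝ≥0∞) else 0 :=
      fun p => Measurable.ite (hfull (measurableSet_alive hw hg p s)) measurable_const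
        measurable_const
    rw [lintegral_tsum fun p => (hm p).aemeasurable]
    refine tsum_congr fun p => ?_
    refine Eq.trans (lintegral_congr fun ω => ?_)
      (lintegral_indicator_one (hfull (measurableSet_alive hw hg p s)))
    by_cases h : Alive w g (fullData X ω) p s <;> simp [indicator, h]
  rw [hsum, ← ENNReal.tsum_mul_left]
  have hU : {ω | ∃ p, Alive w g (shorten p v (fullData X ω)) p s} =
      ⋃ p, {ω | Alive w g (shorten p v (fullData X ω)) p s} := by ext; simp
  rw [hU]
  refine (measure_iUnion_le _).trans (ENNReal.tsum_le_tsum fun p => ?_)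
  -- `O` gathers all data except the size of `p`, of which it is independent, so the memoryless
  -- property can be applied to that size alone.
  let S' := {q : ℕ ⊕ ℕ // q ≠ p}
  let α := (ℕ × (ℕ → Torus Q)) × (ℕ → Torus Q × ℝ) × (S' → ℝ)
  let O : Ω → α := fun ω => ((X.initNum ω, fun i => X.pos (Sum.inl i) ω), arrivals X ω,
    fun q : S' => X.size q ω)
  have hO' : Measurable fun ω => fun q : S' => X.size q ω :=
    measurable_pi_lambda _ fun q => hX.measurable_size _
  have hO : Measurable O := (measurable_init hX).prodMk ((measurable_arrivals hX).prodMk hO')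
  have hind : IndepFun O (X.size p) P := by
    have h1 : IndepFun (fun ω => fun q : S' => X.size q ω) (X.size p) P :=
      (indepFun_comp_of_disjoint hX.measurable_size hX.size_indep (fun q : S' => (q : ℕ ⊕ ℕ))
        (fun _ : Unit => p) (Set.disjoint_left.2 (by
          rintro _ ⟨q, rfl⟩ ⟨_, hq⟩
          exact q.2 hq.symm))).comp measurable_id (measurable_pi_apply ())
    have ha := hX.arrivals_indep_size.comp (φ := id) (ψ := fun f : ℕ ⊕ ℕ → ℝ =>
      ((fun q : S' => f q), f p)) measurable_id (by fun_prop)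
    have hi := hX.init_indep.comp (φ := id) (ψ := fun f : (ℕ → Torus Q × ℝ) × (ℕ ⊕ ℕ → ℝ) =>
      ((f.1, fun q : S' => f.2 q), f.2 p)) measurable_id (by fun_prop)
    have h2 := indepFun_prodMk_of_indepFun (measurable_arrivals hX) hO' (hX.measurable_size p)
      ha h1
    exact indepFun_prodMk_of_indepFun (measurable_init hX) ((measurable_arrivals hX).prodMk hO')
      (hX.measurable_size p) hi h2
  let sizes : α → ℝ → ℕ ⊕ ℕ → ℝ := fun o ℓ q => if h : q = p then ℓ else o.2.2 ⟨q, h⟩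
  let J : α × ℝ → ℕ ⊕ ℕ → Torus Q × ℝ × ℝ := fun x => joinData
    (linksOf x.1.1.1 x.1.1.2 fun i => sizes x.1 x.2 (Sum.inl i)) x.1.2.1
    fun n => sizes x.1 x.2 (Sum.inr n)
  have hsizes : ∀ q, Measurable fun x : α × ℝ => sizes x.1 x.2 q := by
    intro q
    by_cases h : q = p
    · simp only [sizes, dif_pos h]
      exact measurable_snd
    · simp only [sizes, dif_neg h]
      exact (measurable_pi_apply _).comp (measurable_snd.comp (measurable_snd.comp measurable_fst))
  have hJ : Measurable J := by
    refine measurable_joinData.comp (Measurable.prodMk ?_ (Measurable.prodMk ?_ ?_))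
    · exact measurable_linksOf.comp ((measurable_fst.comp measurable_fst).prodMk
        (measurable_pi_lambda _ fun i => hsizes _))
    · exact measurable_fst.comp (measurable_snd.comp measurable_fst)
    · exact measurable_pi_lambda _ fun n => hsizes _
  have hfj : ∀ ω, J (O ω, X.size p ω) = fullData X ω := by
    intro ω
    have h1 : ∀ q, sizes (O ω) (X.size p ω) q = X.size q ω := by
      intro q
      by_cases h : q = p
      · rw [h]
        exact dif_pos rfl
      · exact dif_neg h
    rw [← joinData_eq_fullData, initialLinks_eq]
    simp only [J, h1]
    rfl
  have hJp : ∀ o ℓ, 0 < (J (o, ℓ) p).2.2 → (J (o, ℓ) p).2.2 = ℓ := by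
    intro o ℓ h
    rcases p with i | n
    · simp only [J, joinData, Sum.elim_inl, linksOf] at h ⊢
      split_ifs at h ⊢ with hi
      · simp [sizes]
      · exact absurd h (lt_irrefl _)
    · simp [J, joinData, sizes]
  -- Shortening `p` amounts to replacing its size `ℓ` by `ℓ - v`. Positivity excludes unused labels,
  -- whose size is fixed at `0`.
  have hshort : ∀ o ℓ, 0 < (J (o, ℓ) p).2.2 → shorten p v (J (o, ℓ)) = J (o, ℓ - v) := by
    intro o ℓ h
    have hp : ∀ q, q ≠ p → J (o, ℓ) q = J (o, ℓ - v) q := by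
      intro q hq
      rcases q with i | n
      · simp [J, joinData, sizes, linksOf, hq]
      · simp [J, joinData, sizes, hq]
    funext q
    by_cases hq : q = p
    · subst hq
      rw [shorten_same, hJp o ℓ h]
      rcases q with i | n
      · simp only [J, joinData, Sum.elim_inl, linksOf] at h ⊢
        split_ifs at h ⊢ with hi
        · simp [sizes]
        · exact absurd h (lt_irrefl _)
      · simp [J, joinData, sizes]
    · rw [shorten_of_ne hq, hp q hq]
  have hD : MeasurableSet {x : α × ℝ | Alive w g (J x) p s} := hJ (measurableSet_alive hw hg p s)
  have hmem := measure_sub_mem_eq (by positivity : 0 < 1 / L) hO (hX.measurable_size p) hind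
    (hX.size_law p).map_eq hv hD
    (fun o ℓ h => by
      have h1 := Alive.size_pos h
      rwa [hJp o ℓ h1] at h1)
  simp only [mem_ofPred_eq, hfj] at hmem
  rw [← hmem]
  refine measure_mono fun ω hω => ?_
  have h1 : 0 < (J (O ω, X.size p ω) p).2.2 := by
    have := Alive.size_pos hω
    rw [hfj]
    simp only [shorten_same] at this
    linarith
  have h2 : Alive w g (shorten p v (fullData X ω)) p s := hω
  rw [← hfj, hshort _ _ h1] at h2
  exact h2

end IsBirthDeath

end Network

/-! ### The pair functional of a configuration -/

section PairFunctional

variable [AddCommGroup V] [MeasurableSpace V]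

/-- Mean excess number of points in the translates of `B` by the points of `μ`. -/
def pairFunctional (B : Set V) (μ : Measure V) : ℝ≥0∞ :=
  ∫⁻ x, (μ.map (fun y => y - x) B - 1) ∂μ

open Classical in
/-- Finite nonzero measures, normalized. -/
def normalize (V : Type*) [MeasurableSpace V] : Kernel (Measure V) V where
  toFun μ := if μ univ ≠ ∞ then (μ univ)⁻¹ • μ else 0
  measurable' := by
    refine Measure.measurable_of_measurable_coe _ fun s hs => ?_
    have h1 : MeasurableSet {μ : Measure V | μ univ ≠ ∞} :=
      (Measure.measurable_coe MeasurableSet.univ) (measurableSet_singleton ∞).compl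
    have h2 : (fun μ : Measure V => (if μ univ ≠ ∞ then (μ univ)⁻¹ • μ else 0 : Measure V) s) =
        fun μ => if μ univ ≠ ∞ then (μ univ)⁻¹ * μ s else 0 := by
      funext μ
      split_ifs <;> simp
    rw [h2]
    exact Measurable.ite h1 ((Measure.measurable_coe MeasurableSet.univ).inv.mul
      (Measure.measurable_coe hs)) measurable_const

instance : IsFiniteKernel (normalize V) := by
  refine ⟨⟨1, ENNReal.one_lt_top, fun μ => ?_⟩⟩
  change (if μ univ ≠ ∞ then (μ univ)⁻¹ • μ else 0 : Measure V) univ ≤ 1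
  split_ifs
  · rw [Measure.smul_apply, smul_eq_mul]
    exact ENNReal.inv_mul_le_one _
  · simp

lemma smul_normalize {μ : Measure V} (h : μ univ ≠ ∞) : μ univ • normalize V μ = μ := by
  have h1 : normalize V μ = (μ univ)⁻¹ • μ := if_pos h
  rw [h1, smul_smul]
  rcases eq_or_ne (μ univ) 0 with h0 | h0
  · rw [h0, zero_mul, zero_smul, Measure.measure_univ_eq_zero.1 h0]
  · rw [ENNReal.mul_inv_cancel h0 h, one_smul]

variable [MeasurableSub₂ V]

lemma measurable_sub_point (x : V) : Measurable fun y : V => y - x := measurable_id.sub_const x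

/-- A measurable functional which agrees with `pairFunctional` at finite measures. -/
lemma exists_measurable_pairFunctional {B : Set V} (hB : MeasurableSet B) :
    ∃ F : Measure V → ℝ≥0∞, Measurable F ∧ ∀ μ, μ univ ≠ ∞ → F μ = pairFunctional B μ := by
  have hS : MeasurableSet {p : V × V | p.2 - p.1 ∈ B} := (measurable_snd.sub measurable_fst) hB
  have hk : Measurable fun p : Measure V × V => normalize V p.1 {y | y - p.2 ∈ B} := by
    have h2 : MeasurableSet {q : (Measure V × V) × V | q.2 - q.1.2 ∈ B} :=
      (measurable_snd.sub (measurable_snd.comp measurable_fst)) hB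
    exact Kernel.measurable_kernel_prodMk_left
      (κ := (normalize V).comap (Prod.fst : Measure V × V → Measure V) measurable_fst) h2
  have hu : Measurable fun p : Measure V × V => p.1 univ :=
    (Measure.measurable_coe MeasurableSet.univ).comp measurable_fst
  -- A finite measure is its mass times its normalisation, and `normalize` is a finite kernel, so
  -- these integrals depend measurably on `μ`.
  refine ⟨fun μ => μ univ * ∫⁻ x, (μ univ * normalize V μ {y | y - x ∈ B} - 1) ∂(normalize V μ),
    ?_, fun μ hμ => ?_⟩
  · refine (Measure.measurable_coe MeasurableSet.univ).mul ?_
    exact Measurable.lintegral_kernel_prod_right (κ := normalize V)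
      (f := fun μ x => μ univ * normalize V μ {y | y - x ∈ B} - 1) ((hu.mul hk).sub_const 1)
  · have h1 : ∀ s, μ univ * normalize V μ s = μ s := fun s => by
      conv_rhs => rw [← smul_normalize hμ]
      rw [Measure.smul_apply, smul_eq_mul]
    simp only [h1]
    rw [← smul_eq_mul, ← lintegral_smul_measure, smul_normalize hμ]
    refine lintegral_congr fun x => ?_
    rw [Measure.map_apply (measurable_sub_point x) hB]
    rfl

variable [MeasurableSingletonClass V] {w : V → ℝ≥0∞} {g : ℝ≥0∞ → ℝ≥0∞}

/-- Every alive link sees itself at `0 ∈ B`, and this is the point removed by the subtraction of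
`1`. -/
lemma pairSum_le_pairFunctional {B : Set V} (hB : MeasurableSet B) (h0 : (0 : V) ∈ B)
    (z : ι → V × ℝ × ℝ) (t : ℝ) :
    pairSum w g t B z ≤ pairFunctional B (configOf w g z t) := by
  classical
  rw [pairFunctional, lintegral_configOf]
  refine ENNReal.tsum_le_tsum fun p => ?_
  by_cases hp : Alive w g z p t
  · rw [if_pos hp, Measure.map_apply (measurable_sub_point _) hB]
    refine ENNReal.le_sub_of_add_le_right ENNReal.one_ne_top ?_
    have hm : MeasurableSet ((fun y => y - (z p).1) ⁻¹' B) := (measurable_id.sub_const _) hB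
    rw [← lintegral_indicator_one hm, lintegral_configOf]
    refine le_trans (le_of_eq (congrArg (_ + ·) (tsum_ite_eq p fun _ : ι => (1 : ℝ≥0∞)).symm)) ?_
    rw [← ENNReal.tsum_add]
    refine ENNReal.tsum_le_tsum fun q => ?_
    by_cases hqp : q = p
    · subst hqp
      simp [hp, h0, indicator]
    · simp only [if_neg hqp, add_zero]
      split_ifs with h2 h3 h3
      · rw [indicator_of_mem]
        · rfl
        · exact h2.2.2
      · exact absurd h2.2.1 h3
      · exact zero_le
      · exact zero_le
  · rw [if_neg hp, nonpos_iff_eq_zero]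
    exact ENNReal.tsum_eq_zero.2 fun q => if_neg fun h => hp h.1.2

end PairFunctional

/-! ### Upper bound for the pairs of a Poisson process -/

section PoissonPairs

variable {Ω : Type*} [MeasurableSpace Ω] {P : Measure Ω} [IsProbabilityMeasure P]

/-- The subtraction is truncated, but if `C` is empty the product vanishes, and otherwise the `1`
can be taken from the integer `Ψ C`. What remains is a second factorial moment and a product of
independent counts. -/
lemma lintegral_mul_count_sub_one {E : Type*} [MeasurableSpace E] {ν : Measure E}
    {Ψ : Ω → Measure E} (h : IsPoissonPointProcess ν Ψ P) [IsFiniteMeasure ν] {C D : Set E}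
    (hC : MeasurableSet C) (hD : MeasurableSet D) (hCD : C ⊆ D) :
    ∫⁻ ω, Ψ ω C * (Ψ ω D - 1) ∂P = ν C * ν D := by
  have hdiff := hD.diff hC
  have h1 : ∀ᵐ ω ∂P, Ψ ω C * (Ψ ω D - 1) =
      Ψ ω C * (Ψ ω C - 1) + Ψ ω C * Ψ ω (D \ C) := by
    filter_upwards [ae_eval_mem_range h hC (measure_ne_top _ _)] with ω ⟨n, hn⟩
    have h2 : Ψ ω D = Ψ ω C + Ψ ω (D \ C) := by
      rw [← measure_union disjoint_sdiff_right hdiff, union_sdiff_cancel hCD]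
    rw [h2, hn]
    rcases n with _ | n
    · simp
    · rw [← mul_add]
      congr 1
      push_cast
      rw [add_right_comm, ENNReal.add_sub_cancel_right ENNReal.one_ne_top,
        ENNReal.add_sub_cancel_right ENNReal.one_ne_top]
  have hm := measurable_eval h hC
  have hm' : Measurable fun ω => Ψ ω C * (Ψ ω C - 1) := hm.mul (hm.sub_const 1)
  have hmul := lintegral_mul_eq_lintegral_mul_lintegral_of_indepFun hm (measurable_eval h hdiff)
      (indepFun_eval h hC hdiff disjoint_sdiff_right)
  simp only [Pi.mul_apply] at hmul
  rw [lintegral_congr_ae h1, lintegral_add_left hm',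
    lintegral_factorial_count h hC (measure_ne_top _ _),
    hmul, lintegral_count h hC (measure_ne_top _ _), lintegral_count h hdiff (measure_ne_top _ _), sq,
    ← mul_add, ← measure_union disjoint_sdiff_right hdiff, union_sdiff_cancel hCD]

variable [SeminormedAddCommGroup V] [MeasurableSpace V] [BorelSpace V] [SecondCountableTopology V]

/-- Partition the space into cells of radius at most `ε`. For `x` in a cell around `c`, the
translate of `B` by `x` lies in the translate of the `ε`-thickening by `c`, so each cell is covered
by the preceding lemma. Letting `ε` tend to `0`, the thickenings shrink to the closed set `B`. -/
lemma lintegral_pairFunctional_le {vol : Measure V} [IsFiniteMeasure vol]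
    [vol.IsAddRightInvariant] {β : ℝ≥0} {Ψ : Ω → Measure V}
    (h : IsPoissonPointProcess ((β : ℝ≥0∞) • vol) Ψ P) {B : Set V} (hB : IsClosed B)
    (h0 : (0 : V) ∈ B) :
    ∫⁻ ω, pairFunctional B (Ψ ω) ∂P ≤ (β : ℝ≥0∞) * vol univ * (β * vol B) := by
  have key : ∀ ε : ℝ, 0 < ε → ∫⁻ ω, pairFunctional B (Ψ ω) ∂P ≤
      (β : ℝ≥0∞) * vol univ * (β * vol (Metric.cthickening ε B)) := by
    intro ε hε
    set ν : Measure V := (β : ℝ≥0∞) • vol with hν_def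
    have hν : IsFiniteMeasure ν := Measure.smul_finite vol ENNReal.coe_ne_top
    let c : ℕ → V := TopologicalSpace.denseSeq V
    let C : ℕ → Set V := disjointed fun n => Metric.ball (c n) ε
    let D : ℕ → Set V := fun n => {y | y - c n ∈ Metric.cthickening ε B}
    have hC : ∀ n, MeasurableSet (C n) := fun n =>
      MeasurableSet.disjointed (fun _ => Metric.isOpen_ball.measurableSet) n
    have hBt : MeasurableSet (Metric.cthickening ε B) := Metric.isClosed_cthickening.measurableSet
    have hD : ∀ n, MeasurableSet (D n) := fun n => (measurable_id.sub_const (c n)) hBt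
    have hcover : ⋃ n, C n = univ := by
      rw [iUnion_disjointed]
      refine eq_univ_of_forall fun x => ?_
      obtain ⟨n, hn⟩ := (TopologicalSpace.denseRange_denseSeq V).exists_dist_lt x hε
      exact mem_iUnion.2 ⟨n, hn⟩
    have hsub : ∀ n, ∀ x ∈ C n, ∀ y, y - x ∈ B → y ∈ D n := by
      intro n x hx y hy
      have h1 : dist x (c n) < ε := disjointed_subset _ n hx
      refine Metric.mem_cthickening_of_dist_le _ (y - x) _ _ hy ?_
      rw [dist_eq_norm] at h1 ⊢
      rw [sub_sub_sub_cancel_left]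
      exact h1.le
    have hCD : ∀ n, C n ⊆ D n := fun n x hx => hsub n x hx x (by rwa [sub_self])
    have hνD : ∀ n, ν (D n) = β * vol (Metric.cthickening ε B) := by
      intro n
      rw [hν_def, Measure.smul_apply, smul_eq_mul]
      congr 1
      exact (measurePreserving_sub_right vol (c n)).measure_preimage hBt.nullMeasurableSet
    calc ∫⁻ ω, pairFunctional B (Ψ ω) ∂P
        ≤ ∫⁻ ω, ∑' n, Ψ ω (C n) * (Ψ ω (D n) - 1) ∂P := by
          refine lintegral_mono fun ω => ?_
          rw [pairFunctional, ← setLIntegral_univ, ← hcover]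
          refine (lintegral_iUnion_le _ _).trans (ENNReal.tsum_le_tsum fun n => ?_)
          rw [mul_comm, ← setLIntegral_const]
          refine setLIntegral_mono' (hC n) fun x hx => ?_
          refine tsub_le_tsub_right ?_ 1
          rw [Measure.map_apply (measurable_sub_point x) hB.measurableSet]
          exact measure_mono fun y hy => hsub n x hx y hy
      _ = ∑' n, ν (C n) * ν (D n) := by
          have hm : ∀ n, Measurable fun ω => Ψ ω (C n) * (Ψ ω (D n) - 1) := fun n =>
            (measurable_eval h (hC n)).mul ((measurable_eval h (hD n)).sub_const 1)
          rw [lintegral_tsum fun n => (hm n).aemeasurable]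
          exact tsum_congr fun n => lintegral_mul_count_sub_one h (hC n) (hD n) (hCD n)
      _ = ν univ * (β * vol (Metric.cthickening ε B)) := by
          simp only [hνD]
          rw [ENNReal.tsum_mul_right, ← measure_iUnion (disjoint_disjointed _) hC, hcover]
      _ = _ := by rw [hν_def, Measure.smul_apply, smul_eq_mul]
  have hlim := tendsto_measure_cthickening_of_isClosed (μ := vol) ⟨1, one_pos, measure_ne_top _ _⟩ hB
  have hlim' := ENNReal.Tendsto.const_mul (a := (β : ℝ≥0∞) * vol univ)
    (ENNReal.Tendsto.const_mul (a := (β : ℝ≥0∞)) (hlim.mono_left (nhdsWithin_le_nhds (s := Ioi 0)))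
    (Or.inr ENNReal.coe_ne_top))
    (Or.inr (ENNReal.mul_ne_top ENNReal.coe_ne_top (measure_ne_top _ _)))
  exact ge_of_tendsto hlim' (Filter.eventually_of_mem self_mem_nhdsWithin fun ε hε => key ε hε)

end PoissonPairs

/-! ### Consequences of stationarity -/

section SteadyState

variable {Q lam L C N0 : ℝ} [Fact (0 < 2 * Q)] {l : ℝ → ℝ} {Ω : Type*} [MeasurableSpace Ω]
  {P : Measure Ω} [IsProbabilityMeasure P] {X : LinkProcess Q Ω}

lemma volume_torus_pos : 0 < (volume : Measure (Torus Q)).real univ :=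
  ENNReal.toReal_pos (Measure.measure_univ_ne_zero.2 (NeZero.ne _)) (measure_ne_top _ _)

instance : (volume : Measure (Torus Q)).IsNegInvariant :=
  have : (volume : Measure (Torus Q)).Regular := inferInstance
  inferInstance

namespace IsBirthDeath

/-- Markov's inequality bounds the number of links by `x + 1`. The residual size bound `v = L * x`
gives `exp (-x) ≤ 1 / (x + 1)`, so both failures have the same bound. -/
lemma prob_not_quiet_le (hlam : 0 < lam) (hL : 0 < L) {w : Torus Q → ℝ≥0∞} {g : ℝ≥0∞ → ℝ≥0∞}
    (hw : Measurable w) (hg : IsRate g) (hX : X.IsBirthDeath lam L C N0 l P) {s x EN : ℝ}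
    (hx : 0 ≤ x) (hEN0 : 0 ≤ EN)
    (hEN : ∫⁻ ω, count w g (fullData X ω) s ∂P = ENNReal.ofReal EN) :
    P.real {ω | ¬ Quiet w g (L * x) s (ENNReal.ofReal (x + 1)) (fullData X ω)} ≤
      2 * (EN / (x + 1)) := by
  have hρ := isProbabilityMeasure_expMeasure (r := 1 / L) (by positivity)
  have hv : 0 ≤ L * x := by positivity
  have hfull : Measurable (fullData X) := by
    have := (driven hlam hX).measurable_full
    simpa only [joinData_eq_fullData] using this
  have hx1 : 0 < x + 1 := by positivity
  have h1 : P {ω | ENNReal.ofReal (x + 1) ≤ count w g (fullData X ω) s} ≤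
      ENNReal.ofReal (EN / (x + 1)) := by
    refine (meas_ge_le_lintegral_div ((measurable_count hw hg s).comp hfull).aemeasurable
      (by simpa using hx1) ENNReal.ofReal_ne_top).trans (le_of_eq ?_)
    rw [ENNReal.ofReal_div_of_pos hx1, ← hEN]
    rfl
  have h2 : P {ω | ∃ p, Alive w g (shorten p (L * x) (fullData X ω)) p s} ≤
      ENNReal.ofReal (EN / (x + 1)) := by
    refine (measure_residual_le hL hw hg hX hv s).trans ?_
    rw [hEN, ← ENNReal.ofReal_mul (Real.exp_nonneg _)]
    refine ENNReal.ofReal_le_ofReal ?_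
    have h3 : 1 / L * (L * x) = x := by field_simp
    rw [h3, Real.exp_neg, div_eq_inv_mul]
    gcongr
    exact Real.add_one_le_exp x
  have h4 : P {ω | ¬ Quiet w g (L * x) s (ENNReal.ofReal (x + 1)) (fullData X ω)} ≤
      ENNReal.ofReal (EN / (x + 1)) + ENNReal.ofReal (EN / (x + 1)) := by
    refine le_trans (measure_mono_ae ?_) ((measure_union_le _ _).trans (add_le_add h1 h2))
    filter_upwards [ae_locFin hX] with ω hloc hω
    by_cases hc : ENNReal.ofReal (x + 1) ≤ count w g (fullData X ω) s
    · exact Or.inl hc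
    · refine Or.inr ?_
      have h5 : ¬ ∀ p, ¬ Alive w g (shorten p (L * x) (trunc s (fullData X ω))) p s := fun h =>
        hω ⟨(not_le.1 hc).le, h⟩
      push Not at h5
      obtain ⟨p, hp⟩ := h5
      have h6 : 0 < (trunc s (fullData X ω) p).2.2 := by
        have := hp.size_pos
        simp only [shorten_same] at this
        linarith
      exact ⟨p, ((embeds_trunc s (fullData X ω)).shorten h6 hv).alive hw hg
        ((hloc.trunc s).shorten p hv) hp⟩
  have h7 : 0 ≤ EN / (x + 1) := by positivity
  refine ENNReal.toReal_le_of_le_ofReal (by positivity) (h4.trans (le_of_eq ?_))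
  rw [← ENNReal.ofReal_add h7 h7, two_mul]

/-- In steady state, the mean number of pairs of links at distance in `B` is at least what it would
be for independent links. -/
theorem lintegral_pairFunctional_ge (hlam : 0 < lam) (hL : 0 < L) (hC : 0 < C) (hN0 : 0 < N0)
    (hl : AntitoneOn l (Ici 0)) (hl' : ∀ r, 0 ≤ r → 0 ≤ l r) (hl0 : l 0 = 1)
    (hX : X.IsBirthDeath lam L C N0 l P) (hsteady : X.IsSteadyState P) {β : ℝ≥0}
    (hβ : intensity P (X.config 0) = (β : ℝ≥0∞)) {B : Set (Torus Q)} (hB : MeasurableSet B)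
    (h0 : (0 : Torus Q) ∈ B) :
    (β : ℝ≥0∞) * volume (univ : Set (Torus Q)) * (β * volume B) ≤
      ∫⁻ ω, pairFunctional B (X.config 0 ω) ∂P := by
  have hw : Measurable (pathLoss l : Torus Q → ℝ≥0∞) := measurable_pathLoss hl
  have hw1 : ∀ x : Torus Q, pathLoss l x ≤ 1 := pathLoss_le_one hl hl0
  have hg : IsRate (shannon C N0) := isRate_shannon hC hN0
  have hρ := isProbabilityMeasure_expMeasure (r := 1 / L) (by positivity)
  have hD := driven hlam hX
  have hcfg := ae_config_eq hL hC hN0 hl hl' hl0 hX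
  have hS := volume_torus_pos (Q := Q)
  have hvolS : volume (univ : Set (Torus Q)) = ENNReal.ofReal (volume.real univ) :=
    (ofReal_measureReal (measure_ne_top _ _)).symm
  set S : ℝ := (volume : Measure (Torus Q)).real univ
  set w : Torus Q → ℝ≥0∞ := pathLoss l
  set g := shannon C N0
  have hmass : Measurable fun μ : Measure (Torus Q) => μ univ :=
    Measure.measurable_coe MeasurableSet.univ
  have hN0' : ∫⁻ ω, X.config 0 ω univ ∂P = ENNReal.ofReal (β * S) := by
    rw [ENNReal.ofReal_mul β.coe_nonneg, ENNReal.ofReal_coe_nnreal, ← hvolS]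
    rw [← hβ, intensity, ENNReal.div_mul_cancel _ (measure_ne_top _ _)]
    rw [hvolS]
    simpa using hS
  have hN : ∀ s, 0 ≤ s → ∫⁻ ω, count w g (fullData X ω) s ∂P = ENNReal.ofReal (β * S) := by
    intro s hs
    have h1 := ((hsteady s hs).comp hmass).lintegral_eq
    refine Eq.trans ?_ (h1.trans hN0')
    refine lintegral_congr_ae ?_
    filter_upwards [hcfg] with ω hω
    simp only [Function.comp, hω s, configOf_univ]
  have hβS : 0 ≤ (β : ℝ) * S := by positivity
  have hfinite : ∀ t, ∀ᵐ ω ∂P, X.config t ω univ ≠ ∞ := by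
    intro t
    filter_upwards [hcfg, ae_locFin hX] with ω h1 h2
    rw [h1 t, configOf_univ]
    exact count_ne_top h2 t
  obtain ⟨F, hF, hF'⟩ := exists_measurable_pairFunctional hB
  -- Stationarity transfers the pair count from time `t` to time `0`; it applies to the measurable
  -- version `F`.
  have hpair : ∀ t, 0 ≤ t → ∫⁻ ω, pairSum w g t B (fullData X ω) ∂P ≤
      ∫⁻ ω, pairFunctional B (X.config 0 ω) ∂P := by
    intro t ht
    calc ∫⁻ ω, pairSum w g t B (fullData X ω) ∂P ≤ ∫⁻ ω, F (X.config t ω) ∂P := by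
          refine lintegral_mono_ae ?_
          filter_upwards [hcfg, hfinite t] with ω h1 h2
          rw [hF' _ h2, h1 t]
          exact pairSum_le_pairFunctional hB h0 _ _
      _ = ∫⁻ ω, F (X.config 0 ω) ∂P := ((hsteady t ht).comp hF).lintegral_eq
      _ = _ := by
          refine lintegral_congr_ae ?_
          filter_upwards [hfinite 0] with ω h
          exact hF' _ h
  have hb : ∀ x : Torus Q, (volume : Measure (Torus Q)).real {y | x - y ∈ B} = volume.real B :=
    fun x => congrArg ENNReal.toReal
      ((Measure.measurePreserving_sub_left volume x).measure_preimage hB.nullMeasurableSet)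
  set b := (volume : Measure (Torus Q)).real B
  set a : ℝ → ℝ := fun M => ∫ ω, cutoff M (X.config 0 ω univ) ∂P with ha_def
  have ha : ∀ M t, 0 ≤ t → a M = ∫ ω, cutoff M (count w g (fullData X ω) t) ∂P := by
    intro M t ht
    have h1 := ((hsteady t ht).comp ((measurable_cutoff M).comp hmass)).integral_eq
    refine h1.symm.trans (integral_congr_ae ?_)
    filter_upwards [hcfg] with ω hω
    simp only [Function.comp, hω t, configOf_univ]
  set G := ∫⁻ ω, pairFunctional B (X.config 0 ω) ∂P
  have step1 : ∀ M ε : ℝ, 0 < M → 0 < ε →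
      ENNReal.ofReal (max (a M - M * (2 * ε)) 0 * (b / S * max (a M - M * (2 * ε)) 0)) ≤ G := by
    intro M ε hM hε
    -- Chosen such that the bound `2 * (β * S) / (x + 1)` is at most `ε`.
    set x := 2 * (β * S) / ε
    have hx : 0 ≤ x := by positivity
    have hquiet : ∀ s : ℝ, 0 ≤ s → P.real {ω | ¬ Quiet w g (L * x) s (ENNReal.ofReal (x + 1))
        (joinData (initialLinks X ω) (arrivals X ω) (fileSizes X ω))} ≤ ε := by
      intro s hs
      simp only [joinData_eq_fullData]
      refine (prob_not_quiet_le hlam hL hw hg hX hx hβS (hN s hs)).trans ?_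
      rw [← mul_div_assoc, div_le_iff₀ (by positivity), mul_add, mul_div_cancel₀ _ hε.ne']
      linarith
    obtain ⟨K, hK, n, hn⟩ := hD.exists_prob_busy_le hw hw1 hg (by positivity)
      ENNReal.ofReal_ne_top hε hquiet
    -- One more period costs nothing and makes the final time positive.
    have hn' : P.real {ω | Busy w g K (n + 1)
        (joinData (initialLinks X ω) (arrivals X ω) (fileSizes X ω))} ≤ 2 * ε := by
      refine le_trans (measureReal_mono fun ω hω => ?_) hn
      have hω' : Busy w g K (n + 1)
        (joinData (initialLinks X ω) (arrivals X ω) (fileSizes X ω)) := hω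
      exact fun j hj => hω' j (hj.trans (Nat.le_succ n))
    have ht : 0 ≤ ((n + 1 : ℕ) : ℝ) * K := by positivity
    have := hD.pairSum_ge hw hg measurePreserving_arrivalIntensity hK (Nat.succ_pos n) hM hB
      volume hS hb (a := a M) (by
        simp only [joinData_eq_fullData]
        exact (ha M _ ht).le) hn'
    simp only [joinData_eq_fullData] at this
    exact this.trans (hpair _ ht)
  -- The memory error is `M * (2 * ε)`, so `ε` must tend to `0` before `M` tends to infinity.
  -- Stationarity makes `a M` independent of the time `n * K`, which varies with `ε`.
  have step2 : ∀ M : ℝ, 0 < M → ENNReal.ofReal (a M * (b / S * a M)) ≤ G := by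
    intro M hM
    have ha0 : 0 ≤ a M := integral_nonneg fun ω => (cutoff_mem hM.le _).1
    have h1 : Continuous fun ε : ℝ => ENNReal.ofReal (max (a M - M * (2 * ε)) 0 *
        (b / S * max (a M - M * (2 * ε)) 0)) :=
      ENNReal.continuous_ofReal.comp (by fun_prop)
    have h2 := (h1.tendsto 0).mono_left (nhdsWithin_le_nhds (s := Ioi 0))
    simp only [mul_zero, sub_zero, max_eq_left ha0] at h2
    exact le_of_tendsto h2 (Filter.eventually_of_mem self_mem_nhdsWithin
      fun ε hε => step1 M ε hM hε)
  -- Dominated convergence, with the integrable number of links as the bound.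
  have hlim : Filter.Tendsto a Filter.atTop (nhds (β * S)) := by
    have hcfg0 : AEMeasurable (fun ω => X.config 0 ω univ) P :=
      hmass.comp_aemeasurable (hsteady 0 le_rfl).aemeasurable_fst
    have hint : ∫ ω, (X.config 0 ω univ).toReal ∂P = β * S := by
      rw [integral_toReal hcfg0 ((hfinite 0).mono fun ω h => h.lt_top), hN0',
        ENNReal.toReal_ofReal hβS]
    rw [← hint]
    refine tendsto_integral_filter_of_dominated_convergence
      (fun ω => (X.config 0 ω univ).toReal) ?_ ?_ ?_ ?_
    · exact Filter.Eventually.of_forall fun M =>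
        ((measurable_cutoff M).comp_aemeasurable hcfg0).aestronglyMeasurable
    · refine Filter.Eventually.of_forall fun M => Filter.Eventually.of_forall fun ω => ?_
      unfold cutoff
      split_ifs
      · simp
      · simp
    · exact integrable_toReal_of_lintegral_ne_top hcfg0 (hN0' ▸ ENNReal.ofReal_ne_top)
    · filter_upwards [hfinite 0] with ω hω
      refine tendsto_const_nhds.congr' ?_
      filter_upwards [Filter.eventually_ge_atTop (X.config 0 ω univ).toReal] with M hM
      rw [cutoff, if_pos]
      rw [← ENNReal.ofReal_toReal hω]
      exact ENNReal.ofReal_le_ofReal hM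
  have h3 : Filter.Tendsto (fun M => ENNReal.ofReal (a M * (b / S * a M))) Filter.atTop
      (nhds (ENNReal.ofReal (β * S * (b / S * (β * S))))) :=
    (ENNReal.continuous_ofReal.tendsto _).comp (hlim.mul (hlim.const_mul _))
  have h4 := le_of_tendsto h3 ((Filter.eventually_gt_atTop 0).mono fun M hM => step2 M hM)
  refine le_trans (le_of_eq ?_) h4
  have h5 : b / S * (β * S) = β * b := by field_simp
  rw [h5, ENNReal.ofReal_mul hβS, ENNReal.ofReal_mul β.coe_nonneg, ENNReal.ofReal_mul β.coe_nonneg,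
    ENNReal.ofReal_coe_nnreal, ← hvolS, ofReal_measureReal]

end IsBirthDeath

end SteadyState

end SpatialBD

end

/-! ### Comparison of the two K-functions -/

theorem mainTheorem6
    (Q lam L C N0 : ℝ) [Fact (0 < 2 * Q)]
    (hlam : 0 < lam) (hL : 0 < L) (hC : 0 < C) (hN0 : 0 < N0)
    (l : ℝ → ℝ) (hl_nonneg : ∀ r, 0 ≤ r → 0 ≤ l r) (hl_anti : AntitoneOn l (Set.Ici 0))
    (hl_zero : l 0 = 1)
    {Ω : Type*} [MeasurableSpace Ω] (P : Measure Ω) [IsProbabilityMeasure P]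
    (X : LinkProcess Q Ω) (hX : X.IsBirthDeath lam L C N0 l P) (hsteady : X.IsSteadyState P)
    (β : ℝ≥0) (hβ : intensity P (X.config 0) = (β : ℝ≥0∞))
    {Ω' : Type*} [MeasurableSpace Ω'] (P' : Measure Ω') [IsProbabilityMeasure P']
    (ψ : Ω' → Measure (Torus Q))
    (hψ : IsPoissonPointProcess ((β : ℝ≥0∞) • (volume : Measure (Torus Q))) ψ P') :
    ∀ r : ℝ, 0 ≤ r → ripleyK P' ψ r ≤ ripleyK P (X.config 0) r := by
  intro r hr
  set B : Set (Torus Q) := {z | torusNorm z ≤ r}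
  have hBc : IsClosed B := isClosed_le SpatialBD.continuous_torusNorm continuous_const
  have h0 : (0 : Torus Q) ∈ B := by
    change torusNorm (0 : Torus Q) ≤ r
    simpa [torusNorm] using hr
  have hvol : volume (univ : Set (Torus Q)) ≠ 0 :=
    fun h => SpatialBD.volume_torus_pos.ne' (congrArg ENNReal.toReal h)
  have hvol' : volume (univ : Set (Torus Q)) ≠ ∞ := measure_ne_top _ _
  have hψβ : intensity P' ψ = (β : ℝ≥0∞) := by
    have hfin : ((β : ℝ≥0∞) • (volume : Measure (Torus Q))) univ ≠ ∞ := by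
      rw [Measure.smul_apply]
      exact ENNReal.mul_ne_top ENNReal.coe_ne_top hvol'
    rw [intensity, SpatialBD.lintegral_count hψ MeasurableSet.univ hfin, Measure.smul_apply,
      smul_eq_mul, ENNReal.mul_div_cancel_right hvol hvol']
  unfold ripleyK palmExpectation
  rw [hψβ, hβ]
  -- The prefactors agree because both intensities are `β`. The two pair functionals are compared
  -- through `(β|S|)(β|B|)`.
  refine mul_le_mul_right (mul_le_mul_right ?_ _) _
  exact (SpatialBD.lintegral_pairFunctional_le hψ hBc h0).trans
    (SpatialBD.IsBirthDeath.lintegral_pairFunctional_ge hlam hL hC hN0 hl_anti hl_nonneg hl_zero hX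
      hsteady hβ hBc.measurableSet h0)
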